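/- Let $\Gamma$ be a freely decomposable group, i.e. a free product of two nontrivial groups. **Definitions.** A *free factor system* of $\Gamma$ is a finite set $\mathcal A=\{[A_1],\dots,[A_K]\}$ of conjugacy classes of nontrivial subgroups for which there is a free factorization $\Gamma=A_1*\cdots*A_K*B$ with $B$ free of finite (possibly zero) rank; its corank is $\operatorname{corank}(\mathcal A)=\operatorname{rank}(\Gamma/N(\mathcal A))=\operatorname{rank}(B)$, where $N(\mathcal A)$ is the subgroup normally generated by the $A_i$; it is *proper* if $\mathcal A\ne\{[\Gamma]\}$. Put $D_{FS}(\mathcal A)=3\operatorname{corank}(\mathcal A)+2|\mathcal A|-4$. A *free splitting* is a minimal simplicial action of $\Gamma$ on a simplicial tree $T$, not a point, with trivial edge stabilizers and finitely many edge orbits; $[T]$ is its class up to $\Gamma$-equivariant homeomorphism. Its *relatively natural vertices* are the points of valence $\ge3$ or with nontrivial stabilizer; they cut $T$ into the *relatively natural edges*. Let $E(T)$ and $V(T)$ be the numbers of $\Gamma$-orbits of relatively natural edges and vertices. Let $\mathcal F(T)$ be the set of conjugacy classes of nontrivial vertex stabilizers. $T$ is a free splitting *rel* $\mathcal A$ if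 each $A_i$ is contained in a conjugate of a subgroup representing an element of $\mathcal F(T)$. $T$ is *generic* (rel $\mathcal A$) if $\mathcal F(T)=\mathcal A$, every vertex with trivial stabilizer has valence $\le3$, and for every vertex with nontrivial stabilizer that stabilizer acts transitively on the directions at the vertex. A *collapse map* $T\to S$ is a $\Gamma$-equivariant map, simplicial with respect to some subdivisions, such that the inverse image of each point is connected; its collapse forest $\sigma$ is the union of the inverse images of points which are not single points. It is *relatively natural* if $\sigma$ is a union of relatively natural edges, and *elementary* if $\sigma$ consists of a single orbit of relatively natural edges. Write $[S]\prec[T]$ if there is a collapse map $T\to S$. The complex $\mathcal{FS}(\Gamma;\mathcal A)$ has a $D$-simplex for each chain $[T_0]\prec\cdots\prec[T_D]$ of distinct classes of free splittings rel $\mathcal A$. **Statement.** Let $\mathcal A$ be a proper free factor system of $\Gamma$. (A) For every free splitting $T$ of $\Gamma$ rel $\mathcal A$: 1. $E(T)$ is finite and $E(T)\le D_{FS}(\mathcal A)+1$. 2. The following are equivalent: (a) $E(T)=D_{FS}(\mathcal A)+1$; (b) $T$ is generic; (c) $[T]$ is maximal among free splittings rel $\mathcal A$: for every free splitting $U$ rel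 $\mathcal A$, if there is a collapse map $U\to T$ then $[U]=[T]$. 3. $V(T)$ is finite and $V(T)\le D_{FS}(\mathcal A)+2-\operatorname{corank}(\mathcal A)=2\operatorname{corank}(\mathcal A)+2|\mathcal A|-2$; moreover $T$ is generic if and only if $\mathcal F(T)=\mathcal A$ and equality holds. (B) Every simplex of $\mathcal{FS}(\Gamma;\mathcal A)$ can be written as $[T_0]\prec\cdots\prec[T_D]$ with a corresponding sequence of relatively natural collapse maps $T_D\to T_{D-1}\to\cdots\to T_0$. For every $D$-simplex and every such sequence the following are equivalent: 1. $D=D_{FS}(\mathcal A)$. 2. $T_D$ is generic, each collapse map $T_d\to T_{d-1}$ $(1\le d\le D)$ is elementary, and $T_0$ has exactly one orbit of relatively natural edges. 3. The simplex $[T_0]\prec\cdots\prec[T_D]$ is maximal, i.e. it is not a proper face of any other simplex of $\mathcal{FS}(\Gamma;\mathcal A)$. (C) Consequently $\dim\mathcal{FS}(\Gamma;\mathcal A)=D_{FS}(\mathcal A)$, and every simplex of $\mathcal{FS}(\Gamma;\mathcal A)$ is a face of a simplex of dimension $D_{FS}(\mathcal A)$. -/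

import Mathlib

open scoped Pointwise

universe u

/-! ### Free factorizations and free factor systems -/

section FreeFactors

variable {Γ : Type u} [Group Γ]

/-- `Γ` is the internal free product of the family of subgroups `H`. -/
def IsInternalFreeProduct {ι : Type*} (H : ι → Subgroup Γ) : Prop :=
  Function.Bijective (Monoid.CoprodI.lift fun i => (H i).subtype)

variable (Γ) in
/-- `Γ` is a free product of two nontrivial groups. -/
def FreelyDecomposable : Prop :=
  ∃ A B : Subgroup Γ, A ≠ ⊥ ∧ B ≠ ⊥ ∧ IsInternalFreeProduct ![A, B]

variable (Γ) in
/-- Conjugacy classes of subgroups of `Γ`. -/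
abbrev ConjSubgroup : Type u := MulAction.orbitRel.Quotient (ConjAct Γ) (Subgroup Γ)

/-- The conjugacy class `[H]` of a subgroup `H`. -/
def conjClassOf (H : Subgroup Γ) : ConjSubgroup Γ := Quotient.mk _ H

/-- A realization `Γ = A₁ * ⋯ * A_K * B` of a set `𝒜` of conjugacy classes of subgroups: the `A i`
are nontrivial, `𝒜 = {[A₁], …, [A_K]}`, and the (possibly trivial) cofactor `B` is free of finite
rank. -/
structure IsRealization (𝒜 : Set (ConjSubgroup Γ)) {K : ℕ} (A : Fin K → Subgroup Γ)
    (B : Subgroup Γ) : Prop where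
  ne_bot : ∀ i, A i ≠ ⊥
  freeProduct : IsInternalFreeProduct fun o : Option (Fin K) => o.elim B A
  components_eq : 𝒜 = Set.range fun i => conjClassOf (A i)
  cofactor_free : ∃ r : ℕ, Nonempty (FreeGroupBasis (Fin r) B)

variable (Γ) in
/-- A free factor system of `Γ`. -/
structure FreeFactorSystem where
  components : Set (ConjSubgroup Γ)
  exists_realization : ∃ (K : ℕ) (A : Fin K → Subgroup Γ) (B : Subgroup Γ),
    IsRealization components A B

/-- The relation `𝒜 ⊏ ℬ`: each subgroup representing an element of `𝒜` is conjugate to a subgroup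
of a representative of some element of `ℬ`. -/
def SystemLE (𝒜 ℬ : Set (ConjSubgroup Γ)) : Prop :=
  ∀ a ∈ 𝒜, ∃ b ∈ ℬ, ∃ A B : Subgroup Γ, conjClassOf A = a ∧ conjClassOf B = b ∧ A ≤ B

namespace FreeFactorSystem

/-- `𝒜` is proper if it is different from `{[Γ]}`. -/
def IsProper (𝒜 : FreeFactorSystem Γ) : Prop :=
  𝒜.components ≠ {conjClassOf (⊤ : Subgroup Γ)}

/-- The subgroup `N(𝒜)` normally generated by all subgroups representing elements of `𝒜`. -/
def normalSubgroup (𝒜 : FreeFactorSystem Γ) : Subgroup Γ :=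
  Subgroup.normalClosure {g : Γ | ∃ H : Subgroup Γ, conjClassOf H ∈ 𝒜.components ∧ g ∈ H}

instance (𝒜 : FreeFactorSystem Γ) : 𝒜.normalSubgroup.Normal :=
  inferInstanceAs (Subgroup.normalClosure _).Normal

/-- The corank of `𝒜`: the rank of the free group `Γ / N(𝒜)`, which is isomorphic to the cofactor
of any realization. -/
noncomputable def corank (𝒜 : FreeFactorSystem Γ) : ℕ :=
  sInf {r : ℕ | Nonempty (FreeGroupBasis (Fin r) (Γ ⧸ 𝒜.normalSubgroup))}

/-- The number `|𝒜|` of components. -/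
noncomputable def card (𝒜 : FreeFactorSystem Γ) : ℕ := 𝒜.components.ncard

/-- The free splitting depth `3 corank(𝒜) + 2 |𝒜| - 4`. -/
noncomputable def depthFS (𝒜 : FreeFactorSystem Γ) : ℤ :=
  3 * (𝒜.corank : ℤ) + 2 * (𝒜.card : ℤ) - 4

end FreeFactorSystem

end FreeFactors

/-! ### Free splittings -/

/-- A free splitting of `Γ`: a minimal action of `Γ` on a simplicial tree which is not a point, with
trivial (setwise) edge stabilizers and finitely many edge orbits. Vertices of valence `2` with
trivial stabilizer are allowed. (By minimality and finiteness of the number of edge orbits, the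
vertex set always fits into the universe of `Γ`.) -/
structure FreeSplitting (Γ : Type u) [Group Γ] where
  V : Type u
  [act : MulAction Γ V]
  graph : SimpleGraph V
  isTree : graph.IsTree
  smul_adj : ∀ (g : Γ) {v w : V}, graph.Adj v w → graph.Adj (g • v) (g • w)
  not_point : Nontrivial V
  minimal : ∀ S : Set V, (∀ (g : Γ), ∀ v ∈ S, g • v ∈ S) → (graph.induce S).Connected →
    S = Set.univ
  edge_stabilizer : ∀ (g : Γ) {v w : V}, graph.Adj v w → s(g • v, g • w) = s(v, w) → g = 1
  finite_edge_orbits : ∃ F : Set (V × V), F.Finite ∧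
    ∀ v w, graph.Adj v w → ∃ p ∈ F, ∃ g : Γ, v = g • p.1 ∧ w = g • p.2

attribute [instance] FreeSplitting.act

namespace FreeSplitting

variable {Γ : Type u} [Group Γ]

/-- The valence of a vertex. -/
noncomputable def valence (T : FreeSplitting Γ) (v : T.V) : ℕ∞ := (T.graph.neighborSet v).encard

/-- The vertex set of the segment of the tree `T` with endpoints `v` and `w`. -/
def segment (T : FreeSplitting Γ) (v w : T.V) : Set T.V :=
  {x | T.graph.dist v x + T.graph.dist x w = T.graph.dist v w}

/-- The relatively natural vertices: those of valence at least `3` and those with nontrivial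
stabilizer. -/
def IsNatVertex (T : FreeSplitting Γ) (v : T.V) : Prop :=
  3 ≤ T.valence v ∨ MulAction.stabilizer Γ v ≠ ⊥

/-- The relatively natural edges, each represented by the set of vertices of `T` on it: the
nondegenerate segments whose endpoints, and no other points, are relatively natural. -/
def natEdges (T : FreeSplitting Γ) : Set (Set T.V) :=
  {e | ∃ v w, v ≠ w ∧ T.IsNatVertex v ∧ T.IsNatVertex w ∧ e = T.segment v w ∧
    ∀ x ∈ e, T.IsNatVertex x → x = v ∨ x = w}

/-- The set of `Γ`-orbits of relatively natural vertices. -/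
def natVertexOrbits (T : FreeSplitting Γ) : Set (Set T.V) :=
  MulAction.orbit Γ '' {v | T.IsNatVertex v}

/-- The set of `Γ`-orbits of relatively natural edges. -/
def natEdgeOrbits (T : FreeSplitting Γ) : Set (Set (Set T.V)) :=
  MulAction.orbit Γ '' T.natEdges

/-- The vertex stabilizer system `ℱ(T)`: the conjugacy classes of nontrivial vertex stabilizers. -/
def vertexSystem (T : FreeSplitting Γ) : Set (ConjSubgroup Γ) :=
  {c | ∃ v : T.V, MulAction.stabilizer Γ v ≠ ⊥ ∧ conjClassOf (MulAction.stabilizer Γ v) = c}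

/-- `T` is a free splitting rel `𝒜`. -/
def IsRel (T : FreeSplitting Γ) (𝒜 : FreeFactorSystem Γ) : Prop :=
  SystemLE 𝒜.components T.vertexSystem

/-- `T` is generic rel `𝒜`. -/
def IsGeneric (T : FreeSplitting Γ) (𝒜 : FreeFactorSystem Γ) : Prop :=
  T.vertexSystem = 𝒜.components ∧
  ∀ v : T.V,
    (MulAction.stabilizer Γ v = ⊥ → T.valence v ≤ 3) ∧
    (MulAction.stabilizer Γ v ≠ ⊥ → ∀ x y, T.graph.Adj v x → T.graph.Adj v y →
      ∃ g ∈ MulAction.stabilizer Γ v, g • x = y)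

/-- A one-edge free splitting: exactly one orbit of relatively natural edges. -/
def IsOneEdge (T : FreeSplitting Γ) : Prop := T.natEdgeOrbits.ncard = 1

/-- `S'` is a `Γ`-equivariant subdivision of `S`: the vertices of `S` are identified with vertices
of `S'`, each edge of `S` becomes a segment of `S'` having no vertex of `S` in its interior, these
segments cover `S'`, and the new vertices have valence `2`. -/
structure Subdivision (S S' : FreeSplitting Γ) where
  incl : S.V → S'.V
  injective : Function.Injective incl
  equivariant : ∀ (g : Γ) (v : S.V), incl (g • v) = g • incl v
  edge_interior : ∀ v w, S.graph.Adj v w → ∀ x, incl x ∈ S'.segment (incl v) (incl w) →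
    x = v ∨ x = w
  cover : ∀ x y, S'.graph.Adj x y → ∃ v w, S.graph.Adj v w ∧
    x ∈ S'.segment (incl v) (incl w) ∧ y ∈ S'.segment (incl v) (incl w)
  valence_two : ∀ x, x ∉ Set.range incl → S'.valence x = 2

/-- Two free splittings are equivalent if there is a `Γ`-equivariant homeomorphism between them.
Such a homeomorphism can be made simplicial by subdividing both trees, so this says that they have a
common subdivision. -/
def Equivalent (S T : FreeSplitting Γ) : Prop :=
  ∃ U : FreeSplitting Γ, Nonempty (Subdivision S U) ∧ Nonempty (Subdivision T U)

/-- A collapse map `T → S`: a `Γ`-equivariant map which is simplicial with respect to a subdivision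
`dom` of `T` and a subdivision `cod` of `S`, and for which the inverse image of each point is
connected. (As `dom` is a tree, connectedness of inverse images of vertices implies that only one
edge of `dom` maps onto a given edge of `cod`, so inverse images of interior points of edges are
single points.) -/
structure CollapseMap (T S : FreeSplitting Γ) where
  dom : FreeSplitting Γ
  cod : FreeSplitting Γ
  domSubdivision : Subdivision T dom
  codSubdivision : Subdivision S cod
  toFun : dom.V → cod.V
  equivariant : ∀ (g : Γ) (v : dom.V), toFun (g • v) = g • toFun v
  simplicial : ∀ v w, dom.graph.Adj v w → toFun v = toFun w ∨ cod.graph.Adj (toFun v) (toFun w)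
  connected_fiber : ∀ x : cod.V, (dom.graph.induce (toFun ⁻¹' {x})).Connected

namespace CollapseMap

variable {T S : FreeSplitting Γ}

/-- The relatively natural edges contained in the collapse forest `σ`, which is the union of the
edges of `dom` that are mapped to a point. (Subdividing does not change the relatively natural cell
structure, so the relatively natural edges of `dom` are those of `T`.) -/
def collapsedEdges (f : CollapseMap T S) : Set (Set f.dom.V) :=
  {e ∈ f.dom.natEdges | ∀ x ∈ e, ∀ y ∈ e, f.toFun x = f.toFun y}

/-- `f` is relatively natural: its collapse forest is a union of relatively natural edges. -/
def IsRelNatural (f : CollapseMap T S) : Prop :=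
  ∀ x y, f.dom.graph.Adj x y → f.toFun x = f.toFun y → ∃ e ∈ f.collapsedEdges, x ∈ e ∧ y ∈ e

/-- `f` is elementary: its collapse forest consists of a single orbit of relatively natural
edges. -/
def IsElementary (f : CollapseMap T S) : Prop :=
  f.IsRelNatural ∧ (MulAction.orbit Γ '' f.collapsedEdges).ncard = 1

end CollapseMap

/-! ### Free splitting complexes -/

variable (Γ) in
/-- Equivalence classes of free splittings of `Γ`. -/
def Class : Type (u + 1) := Quot (Equivalent (Γ := Γ))

/-- The equivalence class `[T]`. -/
def cls (T : FreeSplitting Γ) : Class Γ := Quot.mk _ T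

/-- The relation `c ≺ d` on equivalence classes: `d` collapses to `c`. -/
def Prec (c d : Class Γ) : Prop :=
  ∃ S T : FreeSplitting Γ, S.cls = c ∧ T.cls = d ∧ Nonempty (CollapseMap T S)

end FreeSplitting

section Complexes

variable {Γ : Type u} [Group Γ]

variable (Γ) in
/-- The free splitting complex: its simplices are the nonempty finite chains of the relation `≺` on
the set of equivalence classes of free splittings. -/
def freeSplittingComplex : PreAbstractSimplicialComplex (FreeSplitting.Class Γ) where
  faces := {s | s.Nonempty ∧ IsChain FreeSplitting.Prec (s : Set (FreeSplitting.Class Γ))}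
  isRelLowerSet_faces := fun _ hs =>
    ⟨hs.1, fun _ hts ht => ⟨ht, hs.2.mono (Finset.coe_subset.mpr hts)⟩⟩

/-- The free splitting complex of `Γ` relative to `𝒜`: the subcomplex of all simplices whose
vertices are represented by free splittings rel `𝒜`. -/
def relFreeSplittingComplex (𝒜 : FreeFactorSystem Γ) :
    PreAbstractSimplicialComplex (FreeSplitting.Class Γ) where
  faces := {s | s ∈ (freeSplittingComplex Γ).faces ∧
    ∀ T : FreeSplitting Γ, T.cls ∈ s → T.IsRel 𝒜}
  isRelLowerSet_faces := fun _ hs =>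
    ⟨hs.1.1, fun _ hts ht =>
      ⟨((freeSplittingComplex Γ).isRelLowerSet_faces hs.1).2 hts ht,
        fun T hT => hs.2 T (hts hT)⟩⟩

/-- The dimension of an abstract simplicial complex (a simplex with `n + 1` vertices has dimension
`n`). -/
noncomputable def complexDim {α : Type*} (K : PreAbstractSimplicialComplex α) : WithBot ℕ∞ :=
  ⨆ s : K.faces, ((s.1.card - 1 : ℕ) : WithBot ℕ∞)

end Complexes

/-!
All counts come from one Euler characteristic. For a free splitting `T` let `b` be the dimension of
the space of homomorphisms `Γ → ℤ/2` which vanish on all vertex stabilizers. Computing the dimension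
of the space of functions on vertices with `Γ`-invariant coboundary in two ways gives
`E + 1 = V + b` (`FreeSplitting.euler`). Here `T` may be replaced by the tree `natTree` of its
relatively natural vertices and edges, which is possible unless `Γ` is infinite cyclic
(`IsRel.hasNat`).

Call a vertex orbit of a free splitting `T` rel `𝒜` extra if its stabilizers are nontrivial and
contain no subgroup representing an element of `𝒜`. An extra stabilizer embeds into the free group
`Γ / N(𝒜)`, and a nontrivial homomorphism from it to `ℤ/2` extends to `Γ` (`exists_extension`), so
`b` plus the number of extra orbits is at most `corank 𝒜` (`finrank_add_ncard_le`). There are at most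
`|𝒜|` other orbits with nontrivial stabilizers. Counting darts by their initial vertices
(`three_mul_card_vertOrbits`) bounds `3 V` by `2 E` plus twice the number of orbits with nontrivial
stabilizers, with equality exactly if vertices with trivial stabilizer have valence `3` and the
other stabilizers are transitive on directions. Eliminating `E` or `V` gives both bounds and their
cases of equality (`card_bounds`).

A collapse map is, up to subdivision, an equivariant surjection which pulls back sides of edges to
sides of edges (`IsWallMap`). Such maps induce maps of the trees of relatively natural vertices, so
the relation `≺` can be studied on these trees (`prec_iff`), and the number of edge orbits drops by
the number of collapsed orbits. Hence this number is strictly monotone on chains, and equal numbers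
force equality of classes. This gives the bound on the dimension, and orders the vertices of a
simplex into a sequence of collapses.

Conversely, a free splitting `T` rel `𝒜` which is not generic is a proper collapse
(`IsRel.hasExpansion`). Let `S` be a free splitting with `ℱ(S) = 𝒜`, constructed from a realization
of `𝒜` (`exists_vertexSystem_eq`). If some vertex stabilizer of `T` fixes no vertex of `S`, then this
vertex is blown up to a collapse of `S` on which the stabilizer still has no fixed point
(`hasExpansion_of_no_fixed`). Otherwise `ℱ(T) = 𝒜`, and as `T` is not generic there are directions at
some vertex which can be pulled apart by a new edge (`hasExpansion_of_adj`). In the middle of a chain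
a collapse which loses more than one orbit of edges factors through one which loses a single orbit
(`NatCollapse.exists_between`), and a free splitting with at least two orbits of edges has a proper
collapse. So in a maximal simplex the numbers of edge orbits are exactly `1, …, D_FS(𝒜) + 1`
(`tfae_maximal`).

A recurring tool is that a connected graph is a tree as soon as each edge is the only one leaving
some vertex set (`SimpleGraph.isTree_of_isWall`).
-/

/-! ### Walls, sides and segments in trees -/

namespace SimpleGraph

variable {V : Type*} {G : SimpleGraph V}

/-- The vertex set `S` is a wall of `G` at the dart `(v, w)`: this is the only dart of `G` which
leaves `S`. -/
structure IsWall (G : SimpleGraph V) (S : Set V) (v w : V) : Prop where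
  adj : G.Adj v w
  left_mem : v ∈ S
  right_notMem : w ∉ S
  unique : ∀ x y, G.Adj x y → x ∈ S → y ∉ S → x = v ∧ y = w

/-- The side of the dart `(v, w)`: the set of vertices closer to `v` than to `w`. -/
def side (G : SimpleGraph V) (v w : V) : Set V := {x | G.dist x v < G.dist x w}

/-- The vertex set of the segment with endpoints `v` and `w`. -/
def seg (G : SimpleGraph V) (v w : V) : Set V := {x | G.dist v x + G.dist x w = G.dist v w}

lemma mem_side {v w x : V} : x ∈ G.side v w ↔ G.dist x v < G.dist x w := Iff.rfl

lemma mem_seg {v w x : V} : x ∈ G.seg v w ↔ G.dist v x + G.dist x w = G.dist v w := Iff.rfl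

lemma left_mem_seg (v w : V) : v ∈ G.seg v w := by simp [mem_seg]

lemma right_mem_seg (v w : V) : w ∈ G.seg v w := by simp [mem_seg]

lemma seg_comm (v w : V) : G.seg v w = G.seg w v := by
  ext x
  rw [mem_seg, mem_seg, add_comm, G.dist_comm (u := x) (v := w), G.dist_comm (u := v) (v := x),
    G.dist_comm (u := v) (v := w)]

/-- A set which is closed under adjacency in a connected graph is everything. -/
lemma Connected.eq_univ_of_closed (hG : G.Connected) {A : Set V} {a : V} (ha : a ∈ A)
    (h : ∀ x y, G.Adj x y → x ∈ A → y ∈ A) (x : V) : x ∈ A := by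
  obtain ⟨p⟩ := hG.preconnected a x
  induction p with
  | nil => exact ha
  | cons hadj _ ih => exact ih (h _ _ hadj ha)

/-- A connected graph has a dart leaving any vertex set which is neither avoided nor full. -/
lemma Connected.exists_adj_mem_notMem (hG : G.Connected) {A : Set V} {a b : V} (ha : a ∈ A)
    (hb : b ∉ A) : ∃ x y, G.Adj x y ∧ x ∈ A ∧ y ∉ A := by
  by_contra! h
  exact hb (hG.eq_univ_of_closed ha h b)

namespace IsWall

variable {S : Set V} {v w x y : V}

/-- A walk across a wall contains its dart. -/
lemma length_ge (h : IsWall G S v w) (hG : G.Connected) (p : G.Walk x y) (hx : x ∈ S)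
    (hy : y ∉ S) : G.dist x v + 1 + G.dist w y ≤ p.length := by
  induction p with
  | nil => exact absurd hx hy
  | @cons a b c hadj p ih =>
    rw [Walk.length_cons]
    by_cases hb : b ∈ S
    · have h1 := ih hb hy
      have h2 := hG.dist_triangle (u := a) (v := b) (w := v)
      have h3 := dist_eq_one_iff_adj.mpr hadj
      omega
    · obtain ⟨rfl, rfl⟩ := h.unique _ _ hadj hx hb
      have := dist_le p
      rw [dist_self]
      omega

/-- Every geodesic across a wall runs through its dart. -/
lemma dist_eq (h : IsWall G S v w) (hG : G.Connected) (hx : x ∈ S) (hy : y ∉ S) :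
    G.dist x y = G.dist x v + 1 + G.dist w y := by
  obtain ⟨p, hp⟩ := hG.exists_walk_length_eq_dist x y
  have h1 := h.length_ge hG p hx hy
  have h2 := hG.dist_triangle (u := x) (v := v) (w := y)
  have h3 := hG.dist_triangle (u := v) (v := w) (w := y)
  have h4 := dist_eq_one_iff_adj.mpr h.adj
  omega

/-- A wall is determined by its dart: it is the side of this dart. -/
lemma eq_side (h : IsWall G S v w) (hG : G.Connected) : S = G.side v w := by
  ext x
  rw [mem_side]
  by_cases hx : x ∈ S
  · have := h.dist_eq hG hx h.right_notMem
    simp only [hx, true_iff]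
    omega
  · have h1 := h.dist_eq hG h.left_mem hx
    simp only [hx, false_iff, not_lt]
    rw [dist_self] at h1
    rw [G.dist_comm (u := x), G.dist_comm (u := x)]
    omega

lemma compl (h : IsWall G S v w) : IsWall G Sᶜ w v where
  adj := h.adj.symm
  left_mem := h.right_notMem
  right_notMem := fun hv => hv h.left_mem
  unique := fun x y hxy hx hy => (h.unique y x hxy.symm (not_not.mp hy) hx).symm

end IsWall

/-- A connected graph in which every dart has a wall is a tree. -/
lemma isTree_of_isWall (hG : G.Connected) (h : ∀ v w, G.Adj v w → ∃ S, IsWall G S v w) :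
    G.IsTree := by
  refine ⟨hG, isAcyclic_iff_forall_adj_isBridge.mpr fun v w hvw => ?_⟩
  obtain ⟨S, hS⟩ := h v w hvw
  rw [isBridge_iff]
  rintro ⟨p⟩
  have key : ∀ {a b : V} (p : (G.deleteEdges {s(v, w)}).Walk a b), a ∈ S → b ∈ S := by
    intro a b p
    induction p with
    | nil => exact id
    | @cons a b c hadj p ih =>
      intro ha
      apply ih
      by_contra hb
      rw [deleteEdges_adj] at hadj
      obtain ⟨rfl, rfl⟩ := hS.unique _ _ hadj.1 ha hb
      exact hadj.2 rfl
  exact hS.right_notMem (key p hS.left_mem)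

namespace IsTree

variable {v w x y a b c : V}

/-- The sides of the darts of a tree are walls, as the edges are bridges. -/
lemma isWall_side (hG : G.IsTree) (hvw : G.Adj v w) : IsWall G (G.side v w) v w := by
  have hb := isAcyclic_iff_forall_adj_isBridge.mp hG.2 hvw
  rw [isBridge_iff] at hb
  have hS : IsWall G {x | (G.deleteEdges {s(v, w)}).Reachable v x} v w :=
    { adj := hvw
      left_mem := Reachable.refl _
      right_notMem := hb
      unique := by
        intro x y hxy hx hy
        by_cases he : s(x, y) = s(v, w)
        · rcases Sym2.eq_iff.mp he with h | ⟨rfl, rfl⟩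
          · exact h
          · exact absurd hx hb
        · refine absurd (Reachable.trans hx (Adj.reachable ?_)) hy
          rw [deleteEdges_adj]
          exact ⟨hxy, he⟩ }
  rwa [hS.eq_side hG.connected] at hS

lemma left_mem_side (hG : G.IsTree) (hvw : G.Adj v w) : v ∈ G.side v w :=
  (hG.isWall_side hvw).left_mem

lemma right_notMem_side (hG : G.IsTree) (hvw : G.Adj v w) : w ∉ G.side v w :=
  (hG.isWall_side hvw).right_notMem

lemma compl_side (hG : G.IsTree) (hvw : G.Adj v w) : (G.side v w)ᶜ = G.side w v :=
  (hG.isWall_side hvw).compl.eq_side hG.connected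

lemma mem_side_symm (hG : G.IsTree) (hvw : G.Adj v w) : x ∈ G.side w v ↔ x ∉ G.side v w := by
  rw [← hG.compl_side hvw, Set.mem_compl_iff]

/-- The first edge of the segment from `a` to `b`. -/
lemma exists_adj_mem_side (hG : G.IsTree) (hab : a ≠ b) : ∃ a', G.Adj a a' ∧ b ∈ G.side a' a := by
  obtain ⟨p, hp⟩ := hG.connected.exists_walk_length_eq_dist a b
  cases p with
  | nil => exact absurd rfl hab
  | @cons _ a' _ hadj p =>
    refine ⟨a', hadj, ?_⟩
    rw [mem_side, G.dist_comm (v := a), ← hp, Walk.length_cons, G.dist_comm]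
    have := dist_le p
    omega

lemma dist_eq_of_mem_side (hG : G.IsTree) (h : G.Adj a b) (hx : x ∈ G.side b a) :
    G.dist a x = G.dist b x + 1 := by
  have h1 := (hG.isWall_side h.symm).dist_eq hG.connected hx (hG.right_notMem_side h.symm)
  rw [dist_self] at h1
  rw [G.dist_comm (u := a), G.dist_comm (u := b)]
  omega

/-- Sides of different darts starting at the same vertex, taken at the far end, are disjoint. -/
lemma eq_of_mem_side (hG : G.IsTree) (hb : G.Adj a b) (hc : G.Adj a c) (h1 : x ∈ G.side b a)
    (h2 : x ∈ G.side c a) : b = c := by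
  by_contra hne
  have hcb : c ∉ G.side b a := fun h =>
    hne ((hG.isWall_side hb.symm).unique c a hc.symm h (hG.right_notMem_side hb.symm)).1.symm
  have h3 := (hG.isWall_side hb.symm).dist_eq hG.connected h1 hcb
  have h4 := dist_eq_one_iff_adj.mpr hc
  have h5 := hG.dist_eq_of_mem_side hb h1
  have h6 := hG.dist_eq_of_mem_side hc h2
  rw [G.dist_comm (u := x), G.dist_comm (u := x)] at h3
  omega

/-- Segments are the convex hulls of their endpoints with respect to sides. -/
lemma mem_seg_iff (hG : G.IsTree) : x ∈ G.seg a b ↔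
    ∀ v w, G.Adj v w → a ∈ G.side v w → b ∈ G.side v w → x ∈ G.side v w := by
  constructor
  · intro hx v w hvw ha hb
    by_contra hxS
    have h1 := (hG.isWall_side hvw).dist_eq hG.connected ha hxS
    have h2 := (hG.isWall_side hvw).dist_eq hG.connected hb hxS
    have h3 := hG.connected.dist_triangle (u := a) (v := v) (w := b)
    rw [mem_seg, G.dist_comm (u := x)] at hx
    rw [G.dist_comm (u := v)] at h3
    omega
  · intro h
    induction hn : G.dist a x generalizing a with
    | zero =>
      rw [hG.connected.dist_eq_zero_iff] at hn
      rw [hn]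
      exact left_mem_seg _ _
    | succ n ih =>
      have hax : a ≠ x := by
        rintro rfl
        simp at hn
      obtain ⟨a', haa', hx⟩ := hG.exists_adj_mem_side hax
      have hb : b ∈ G.side a' a := by
        rw [hG.mem_side_symm haa'] at hx ⊢
        exact fun hb => hx (h _ _ haa' (hG.left_mem_side haa') hb)
      have h1 := hG.dist_eq_of_mem_side haa' hx
      have h2 := hG.dist_eq_of_mem_side haa' hb
      have h3 := ih (a := a') (fun v w hvw ha' hb' => by
        by_cases ha : a ∈ G.side v w
        · exact h v w hvw ha hb'
        · obtain ⟨rfl, rfl⟩ := (hG.isWall_side hvw).unique _ _ haa'.symm ha' ha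
          exact hx) (by omega)
      rw [mem_seg] at h3 ⊢
      omega

lemma mem_side_of_mem_seg (hG : G.IsTree) (hx : x ∈ G.seg a b) (hvw : G.Adj v w)
    (ha : a ∈ G.side v w) (hb : b ∈ G.side v w) : x ∈ G.side v w :=
  hG.mem_seg_iff.mp hx v w hvw ha hb

lemma seg_subset_seg (hG : G.IsTree) (hx : x ∈ G.seg a b) (hy : y ∈ G.seg a b) :
    G.seg x y ⊆ G.seg a b := by
  intro z hz
  rw [hG.mem_seg_iff] at *
  exact fun v w hvw ha hb => hz v w hvw (hx v w hvw ha hb) (hy v w hvw ha hb)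

/-- Distinct vertices are separated by a wall. -/
lemma exists_side (hG : G.IsTree) (h : x ≠ y) : ∃ v w, G.Adj v w ∧ x ∈ G.side v w ∧
    y ∉ G.side v w := by
  obtain ⟨w, hw, hy⟩ := hG.exists_adj_mem_side h
  exact ⟨x, w, hw, hG.left_mem_side hw, (hG.mem_side_symm hw).mp hy⟩

lemma eq_of_forall_side (hG : G.IsTree)
    (h : ∀ v w, G.Adj v w → x ∈ G.side v w → y ∈ G.side v w) : x = y := by
  by_contra hne
  obtain ⟨v, w, hvw, hx, hy⟩ := hG.exists_side hne
  exact hy (h v w hvw hx)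

lemma seg_self (hG : G.IsTree) (x : V) : G.seg x x = {x} := by
  ext y
  rw [mem_seg, dist_self, Set.mem_singleton_iff, G.dist_comm (u := y)]
  have := hG.connected.dist_eq_zero_iff (u := x) (v := y)
  constructor
  · intro h
    exact (this.mp (by omega)).symm
  · rintro rfl
    simp

lemma seg_eq_pair_of_adj (hG : G.IsTree) (h : G.Adj x y) : G.seg x y = {x, y} := by
  ext z
  rw [mem_seg, dist_eq_one_iff_adj.mpr h, Set.mem_insert_iff, Set.mem_singleton_iff,
    ← hG.connected.dist_eq_zero_iff (u := z) (v := y), eq_comm (a := z),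
    ← hG.connected.dist_eq_zero_iff (u := x) (v := z)]
  constructor
  · omega
  · rintro (h' | h')
    · rw [hG.connected.dist_eq_zero_iff] at h'
      subst h'
      rw [dist_self, dist_eq_one_iff_adj.mpr h]
    · rw [hG.connected.dist_eq_zero_iff] at h'
      subst h'
      rw [dist_self, dist_eq_one_iff_adj.mpr h]

/-- The median of three vertices of a tree. -/
lemma exists_median (hG : G.IsTree) (a b c : V) :
    ∃ m, m ∈ G.seg a b ∧ m ∈ G.seg a c ∧ m ∈ G.seg b c := by
  obtain ⟨m, hm, hmin⟩ : ∃ m ∈ G.seg a b, ∀ m' ∈ G.seg a b, G.dist m c ≤ G.dist m' c := by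
    have := WellFounded.has_min (measure fun m => G.dist m c).wf (G.seg a b)
      ⟨a, left_mem_seg _ _⟩
    obtain ⟨m, hm, h⟩ := this
    exact ⟨m, hm, fun m' hm' => not_lt.mp (h m' hm')⟩
  have key : ∀ v w, G.Adj v w → c ∈ G.side v w → (a ∈ G.side v w ∨ b ∈ G.side v w) →
      m ∈ G.side v w := by
    intro v w hvw hc hab
    by_contra hmS
    have hW := hG.isWall_side hvw
    have hv : v ∈ G.seg a b := by
      by_cases ha : a ∈ G.side v w
      · have hb : b ∉ G.side v w := fun hb => hmS (hG.mem_side_of_mem_seg hm hvw ha hb)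
        have h1 := hW.dist_eq hG.connected ha hb
        have h2 := hW.dist_eq hG.connected hW.left_mem hb
        rw [dist_self] at h2
        rw [mem_seg]
        omega
      · have hb : b ∈ G.side v w := hab.resolve_left ha
        have h1 := hW.dist_eq hG.connected hb ha
        have h2 := hW.dist_eq hG.connected hW.left_mem ha
        rw [dist_self] at h2
        rw [seg_comm, mem_seg]
        omega
    have h1 := hmin v hv
    have h2 := hW.dist_eq hG.connected hc hmS
    rw [G.dist_comm (u := c), G.dist_comm (u := c)] at h2
    omega
  exact ⟨m, hm, hG.mem_seg_iff.mpr fun v w hvw ha hc => key v w hvw hc (Or.inl ha),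
    hG.mem_seg_iff.mpr fun v w hvw hb hc => key v w hvw hc (Or.inr hb)⟩

/-- A vertex in the interior of a segment sees the endpoints in different directions. -/
lemma ne_of_mem_seg (hG : G.IsTree) {a' b' : V} (hx : x ∈ G.seg a b) (ha' : G.Adj x a')
    (hb' : G.Adj x b') (ha : a ∈ G.side a' x) (hb : b ∈ G.side b' x) : a' ≠ b' := by
  rintro rfl
  exact hG.right_notMem_side ha'.symm (hG.mem_side_of_mem_seg hx ha'.symm ha hb)

/-- Conversely, a vertex which sees `a` and `b` in different directions is between them. -/
lemma mem_seg_of_ne (hG : G.IsTree) {a' b' : V} (ha' : G.Adj x a') (hb' : G.Adj x b')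
    (ha : a ∈ G.side a' x) (hb : b ∈ G.side b' x) (h : a' ≠ b') : x ∈ G.seg a b := by
  have hbS : b ∉ G.side a' x := fun hb2 => h (hG.eq_of_mem_side ha' hb' hb2 hb)
  have h1 := (hG.isWall_side ha'.symm).dist_eq hG.connected ha hbS
  have h2 := hG.dist_eq_of_mem_side ha' ha
  rw [mem_seg]
  rw [G.dist_comm (u := a) (v := a')] at h1
  rw [G.dist_comm (u := a) (v := x)]
  omega

/-- A branching of three segments produces three different neighbours of the branch point. -/
lemma exists_three_adj (hG : G.IsTree) {m : V} (hab : m ∈ G.seg a b) (hac : m ∈ G.seg a c)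
    (hbc : m ∈ G.seg b c) (ha : m ≠ a) (hb : m ≠ b) (hc : m ≠ c) :
    ∃ a' b' c', G.Adj m a' ∧ G.Adj m b' ∧ G.Adj m c' ∧ a' ≠ b' ∧ a' ≠ c' ∧ b' ≠ c' := by
  obtain ⟨a', ha1, ha2⟩ := hG.exists_adj_mem_side ha
  obtain ⟨b', hb1, hb2⟩ := hG.exists_adj_mem_side hb
  obtain ⟨c', hc1, hc2⟩ := hG.exists_adj_mem_side hc
  exact ⟨a', b', c', ha1, hb1, hc1, hG.ne_of_mem_seg hab ha1 hb1 ha2 hb2,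
    hG.ne_of_mem_seg hac ha1 hc1 ha2 hc2, hG.ne_of_mem_seg hbc hb1 hc1 hb2 hc2⟩

lemma reachable_induce (hG : G.IsTree) {S : Set V} (h : G.seg x y ⊆ S) :
    (G.induce S).Reachable ⟨x, h (left_mem_seg _ _)⟩ ⟨y, h (right_mem_seg _ _)⟩ := by
  induction hn : G.dist x y generalizing x with
  | zero =>
    rw [hG.connected.dist_eq_zero_iff] at hn
    subst hn
    exact Reachable.refl _
  | succ n ih =>
    have hxy : x ≠ y := by
      rintro rfl
      simp at hn
    obtain ⟨x', hxx', hy⟩ := hG.exists_adj_mem_side hxy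
    have h1 := hG.dist_eq_of_mem_side hxx' hy
    have hx' : x' ∈ G.seg x y := by
      rw [mem_seg, dist_eq_one_iff_adj.mpr hxx']
      omega
    have hsub : G.seg x' y ⊆ S := (hG.seg_subset_seg hx' (right_mem_seg _ _)).trans h
    refine Reachable.trans (Adj.reachable ?_) (ih hsub (by omega))
    exact hxx'

lemma connected_induce (hG : G.IsTree) {S : Set V} (hne : S.Nonempty)
    (h : ∀ x ∈ S, ∀ y ∈ S, G.seg x y ⊆ S) : (G.induce S).Connected := by
  rw [connected_iff]
  exact ⟨fun x y => hG.reachable_induce (h x x.2 y y.2), hne.to_subtype⟩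

/-- Connected vertex sets of trees are convex. -/
lemma seg_subset_of_connected (hG : G.IsTree) {S : Set V} (hS : (G.induce S).Connected)
    (ha : a ∈ S) (hb : b ∈ S) : G.seg a b ⊆ S := by
  intro x hx
  by_contra hxS
  have hxa : x ≠ a := fun h => hxS (h ▸ ha)
  obtain ⟨a', haa', ha'⟩ := hG.exists_adj_mem_side hxa
  have hb' : b ∉ G.side a' x := fun hb' =>
    hG.right_notMem_side haa'.symm (hG.mem_side_of_mem_seg hx haa'.symm ha' hb')
  obtain ⟨p, q, hpq, hp, hq⟩ := hS.exists_adj_mem_notMem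
    (A := {z | z.1 ∈ G.side a' x}) (a := ⟨a, ha⟩) (b := ⟨b, hb⟩) ha' hb'
  obtain ⟨-, h⟩ := (hG.isWall_side haa'.symm).unique p.1 q.1 hpq hp hq
  exact hxS (h ▸ q.2)

end IsTree

end SimpleGraph

/-! ### Group actions on trees and free splittings -/

/-- A group action on a tree is minimal if it has finitely many orbits of edges and no vertex has
valence less than two: starting outside of a proper invariant subtree, one can walk away from it
forever, whereas all vertices stay within bounded distance of it. -/
lemma minimal_of_exists_two_adj {Γ V : Type*} [Group Γ] [MulAction Γ V] {G : SimpleGraph V}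
    (hG : G.IsTree) (hadj : ∀ (g : Γ) {v w : V}, G.Adj v w → G.Adj (g • v) (g • w))
    (hfin : ∃ F : Set (V × V), F.Finite ∧
      ∀ v w, G.Adj v w → ∃ p ∈ F, ∃ g : Γ, v = g • p.1 ∧ w = g • p.2)
    (hval : ∀ v, ∃ a b, G.Adj v a ∧ G.Adj v b ∧ a ≠ b) (S : Set V)
    (hS : ∀ (g : Γ), ∀ v ∈ S, g • v ∈ S) (hconn : (G.induce S).Connected) : S = Set.univ := by
  have hle : ∀ (g : Γ) (x y : V), G.dist (g • x) (g • y) ≤ G.dist x y := by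
    intro g x y
    obtain ⟨p, hp⟩ := hG.connected.exists_walk_length_eq_dist x y
    let f : G →g G := ⟨fun x => g • x, fun h => hadj g h⟩
    rw [← hp, ← SimpleGraph.Walk.length_map f p]
    exact SimpleGraph.dist_le _
  obtain ⟨⟨s0, hs0⟩⟩ := hconn.nonempty
  obtain ⟨F, hF, hFe⟩ := hfin
  obtain ⟨C, hC⟩ : ∃ C, ∀ p ∈ F, G.dist p.1 s0 ≤ C := by
    obtain ⟨C, hC⟩ := (hF.image fun p => G.dist p.1 s0).bddAbove
    exact ⟨C, fun p hp => hC (Set.mem_image_of_mem _ hp)⟩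
  have hbdd : ∀ x, ∃ s ∈ S, G.dist x s ≤ C := by
    intro x
    obtain ⟨a, -, ha, -⟩ := hval x
    obtain ⟨p, hp, g, rfl, -⟩ := hFe x a ha
    exact ⟨g • s0, hS g s0 hs0, (hle g _ _).trans (hC p hp)⟩
  rw [Set.eq_univ_iff_forall]
  by_contra! hx
  obtain ⟨x0, hx0⟩ := hx
  have far : ∀ n, ∃ x, x ∉ S ∧ ∀ s ∈ S, n ≤ G.dist x s := by
    intro n
    induction n with
    | zero => exact ⟨x0, hx0, fun _ _ => Nat.zero_le _⟩
    | succ n ih =>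
      obtain ⟨x, hxS, hx⟩ := ih
      obtain ⟨a, ha, hs0a⟩ := hG.exists_adj_mem_side (a := x) (b := s0) (fun h => hxS (h ▸ hs0))
      have hSa : ∀ s ∈ S, s ∈ G.side a x := by
        intro s hs
        by_contra hsa
        obtain ⟨p, q, hpq, hp, hq⟩ := hconn.exists_adj_mem_notMem
          (A := {z | z.1 ∈ G.side a x}) (a := ⟨s0, hs0⟩) (b := ⟨s, hs⟩) hs0a hsa
        obtain ⟨-, h⟩ := (hG.isWall_side ha.symm).unique p.1 q.1 hpq hp hq
        exact hxS (h ▸ q.2)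
      obtain ⟨b, hb, hba⟩ : ∃ b, G.Adj x b ∧ b ≠ a := by
        obtain ⟨b, c, hb, hc, hbc⟩ := hval x
        by_cases h : b = a
        · exact ⟨c, hc, fun h' => hbc (h.trans h'.symm)⟩
        · exact ⟨b, hb, h⟩
      have hdist : ∀ s ∈ S, G.dist b s = G.dist x s + 1 := by
        intro s hs
        refine hG.dist_eq_of_mem_side hb.symm ?_
        rw [hG.mem_side_symm hb.symm]
        exact fun h => hba (hG.eq_of_mem_side hb ha h (hSa s hs))
      refine ⟨b, fun hbS => ?_, fun s hs => ?_⟩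
      · have := hdist b hbS
        rw [SimpleGraph.dist_self] at this
        omega
      · have := hx s hs
        have := hdist s hs
        omega
  obtain ⟨x, -, hx⟩ := far (C + 1)
  obtain ⟨s, hs, hsC⟩ := hbdd x
  have := hx s hs
  omega

namespace FreeSplitting

variable {Γ : Type u} [Group Γ] (T : FreeSplitting Γ)

instance : Nontrivial T.V := T.not_point

variable {T}

lemma smul_adj_iff (g : Γ) {v w : T.V} : T.graph.Adj (g • v) (g • w) ↔ T.graph.Adj v w :=
  ⟨fun h => by simpa using T.smul_adj g⁻¹ h, fun h => T.smul_adj g h⟩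

lemma dist_smul (g : Γ) (x y : T.V) : T.graph.dist (g • x) (g • y) = T.graph.dist x y := by
  have hle : ∀ (g : Γ) (x y : T.V), T.graph.dist (g • x) (g • y) ≤ T.graph.dist x y := by
    intro g x y
    obtain ⟨p, hp⟩ := T.isTree.connected.exists_walk_length_eq_dist x y
    let f : T.graph →g T.graph := ⟨fun x => g • x, fun h => T.smul_adj g h⟩
    rw [← hp, ← SimpleGraph.Walk.length_map f p]
    exact SimpleGraph.dist_le _
  refine le_antisymm (hle g x y) ?_
  simpa using hle g⁻¹ (g • x) (g • y)

lemma smul_mem_side (g : Γ) {v w x : T.V} :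
    g • x ∈ T.graph.side (g • v) (g • w) ↔ x ∈ T.graph.side v w := by
  rw [SimpleGraph.mem_side, SimpleGraph.mem_side, dist_smul, dist_smul]

lemma smul_mem_seg (g : Γ) {v w x : T.V} :
    g • x ∈ T.graph.seg (g • v) (g • w) ↔ x ∈ T.graph.seg v w := by
  rw [SimpleGraph.mem_seg, SimpleGraph.mem_seg, dist_smul, dist_smul, dist_smul]

lemma not_inversion {g : Γ} {v w : T.V} (h : T.graph.Adj v w) (h1 : g • v = w) (h2 : g • w = v) :
    False := by
  have := T.edge_stabilizer g h (by rw [h1, h2, Sym2.eq_swap])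
  subst this
  rw [one_smul] at h1
  exact h.ne h1

lemma eq_one_of_smul_adj {g : Γ} {v w : T.V} (h : T.graph.Adj v w) (h1 : g • v = v)
    (h2 : g • w = w) : g = 1 :=
  T.edge_stabilizer g h (by rw [h1, h2])

/-- As edge stabilizers are trivial, a nontrivial element fixes at most one vertex. -/
lemma eq_of_smul_eq {g : Γ} (hg : g ≠ 1) {v w : T.V} (hv : g • v = v) (hw : g • w = w) :
    v = w := by
  by_contra hne
  obtain ⟨a, ha, hwa⟩ := T.isTree.exists_adj_mem_side hne
  have h1 : T.graph.Adj v (g • a) := by simpa [hv] using T.smul_adj g ha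
  have h2 : w ∈ T.graph.side (g • a) v := by simpa [hv, hw] using (smul_mem_side g).mpr hwa
  exact hg (eq_one_of_smul_adj ha hv (T.isTree.eq_of_mem_side h1 ha h2 hwa))

lemma eq_of_le_stabilizer {H : Subgroup Γ} (hH : H ≠ ⊥) {v w : T.V}
    (hv : H ≤ MulAction.stabilizer Γ v) (hw : H ≤ MulAction.stabilizer Γ w) : v = w := by
  obtain ⟨g, hg⟩ := Subgroup.ne_bot_iff_exists_ne_one.mp hH
  exact eq_of_smul_eq (g := (g : Γ)) (fun h => hg (Subtype.ext (by simpa using h))) (hv g.2) (hw g.2)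

/-- By minimality, the tree is the hull of any nonempty invariant set. -/
lemma exists_mem_seg {P : Set T.V} (hne : P.Nonempty) (hP : ∀ (g : Γ), ∀ v ∈ P, g • v ∈ P)
    (x : T.V) : ∃ a ∈ P, ∃ b ∈ P, x ∈ T.graph.seg a b := by
  have h := T.minimal {x | ∃ a ∈ P, ∃ b ∈ P, x ∈ T.graph.seg a b} ?_ ?_
  · exact (Set.eq_univ_iff_forall.mp h) x
  · rintro g v ⟨a, ha, b, hb, hv⟩
    exact ⟨g • a, hP g a ha, g • b, hP g b hb, (smul_mem_seg g).mpr hv⟩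
  · obtain ⟨p, hp⟩ := hne
    set S := {x | ∃ a ∈ P, ∃ b ∈ P, x ∈ T.graph.seg a b}
    have hsub : ∀ a ∈ P, ∀ b ∈ P, T.graph.seg a b ⊆ S := fun a ha b hb x hx => ⟨a, ha, b, hb, hx⟩
    have hpS : p ∈ S := hsub p hp p hp (SimpleGraph.left_mem_seg _ _)
    have key : ∀ y : S, (T.graph.induce S).Reachable y ⟨p, hpS⟩ := by
      rintro ⟨y, a, ha, b, hb, hy⟩
      have h1 := T.isTree.reachable_induce (S := S) (x := y) (y := a)
        ((T.isTree.seg_subset_seg hy (SimpleGraph.left_mem_seg _ _)).trans (hsub a ha b hb))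
      have h2 := T.isTree.reachable_induce (S := S) (x := a) (y := p) (hsub a ha p hp)
      exact h1.trans h2
    rw [SimpleGraph.connected_iff]
    exact ⟨fun y z => (key y).trans (key z).symm, ⟨⟨p, hpS⟩⟩⟩

lemma exists_adj (v : T.V) : ∃ a, T.graph.Adj v a := by
  obtain ⟨w, hw⟩ := exists_ne v
  obtain ⟨a, ha, -⟩ := T.isTree.exists_adj_mem_side hw.symm
  exact ⟨a, ha⟩

/-- There are no vertices of valence one. -/
lemma exists_adj_ne (v a : T.V) : ∃ b, T.graph.Adj v b ∧ b ≠ a := by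
  by_contra! h
  obtain ⟨a', ha'⟩ := exists_adj v
  obtain rfl := h a' ha'
  have leaf : ∀ p q : T.V, v ∈ T.graph.seg p q → v = p ∨ v = q := by
    intro p q hv
    by_contra! hne
    obtain ⟨b, hb, hpb⟩ := T.isTree.exists_adj_mem_side hne.1
    obtain ⟨c, hc, hqc⟩ := T.isTree.exists_adj_mem_side hne.2
    exact T.isTree.ne_of_mem_seg hv hb hc hpb hqc ((h b hb).trans (h c hc).symm)
  have horb : ∀ w : T.V, ∃ g : Γ, v = g • w := by
    intro w
    obtain ⟨_, ⟨g, rfl⟩, _, ⟨k, rfl⟩, hv⟩ := exists_mem_seg (P := MulAction.orbit Γ w)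
      ⟨w, MulAction.mem_orbit_self w⟩ (fun g v hv => MulAction.mem_orbit_of_mem_orbit g hv) v
    rcases leaf _ _ hv with h | h
    · exact ⟨g, h⟩
    · exact ⟨k, h⟩
  obtain ⟨g, hg⟩ := horb a'
  have h1 : T.graph.Adj v (g • v) := by
    have := T.smul_adj g ha'.symm
    rwa [← hg] at this
  exact not_inversion (g := g) ha'.symm hg.symm (h _ h1)

/-- Every side of every edge contains translates of every vertex. -/
lemma exists_smul_mem_side {v w : T.V} (h : T.graph.Adj v w) (p : T.V) :
    ∃ g : Γ, g • p ∈ T.graph.side v w := by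
  obtain ⟨_, ⟨g, rfl⟩, _, ⟨k, rfl⟩, hv⟩ := exists_mem_seg (P := MulAction.orbit Γ p)
    ⟨p, MulAction.mem_orbit_self p⟩ (fun g v hv => MulAction.mem_orbit_of_mem_orbit g hv) v
  by_contra! hno
  have h1 := T.isTree.mem_side_of_mem_seg hv h.symm ((T.isTree.mem_side_symm h).mpr (hno g))
    ((T.isTree.mem_side_symm h).mpr (hno k))
  exact T.isTree.right_notMem_side h.symm h1

/-- Every side of every edge contains translates of every edge. -/
lemma exists_smul_mem_side₂ {v w p q : T.V} (h : T.graph.Adj v w) (hpq : T.graph.Adj p q) :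
    ∃ g : Γ, g • p ∈ T.graph.side v w ∧ g • q ∈ T.graph.side v w := by
  obtain ⟨b, hb, hbw⟩ := exists_adj_ne v w
  have hsub : ∀ x ∈ T.graph.side b v, x ∈ T.graph.side v w := by
    intro x hx
    by_contra hx2
    exact hbw (T.isTree.eq_of_mem_side hb h hx ((T.isTree.mem_side_symm h).mpr hx2))
  obtain ⟨g, hg⟩ := exists_smul_mem_side hb.symm p
  refine ⟨g, hsub _ hg, ?_⟩
  by_cases hq : g • q ∈ T.graph.side b v
  · exact hsub _ hq
  · obtain ⟨-, h2⟩ := (T.isTree.isWall_side hb.symm).unique _ _ (T.smul_adj g hpq) hg hq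
    rw [h2]
    exact T.isTree.left_mem_side h

/-- On a convex invariant set, a group element either fixes a vertex or, at a vertex `x` of minimal
displacement, `g • x` and `g⁻¹ • x` lie in different directions. -/
lemma exists_fixed_or_axis (g : Γ) {S : Set T.V} (hne : S.Nonempty)
    (hS : ∀ x ∈ S, ∀ y ∈ S, T.graph.seg x y ⊆ S) (hg : ∀ x ∈ S, g • x ∈ S) :
    (∃ x ∈ S, g • x = x) ∨ ∃ x ∈ S, ∃ y z, T.graph.Adj x y ∧ T.graph.Adj x z ∧ y ≠ z ∧
      g • x ∈ T.graph.side y x ∧ g⁻¹ • x ∈ T.graph.side z x := by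
  obtain ⟨x, hx, hmin⟩ : ∃ x ∈ S, ∀ y ∈ S, T.graph.dist x (g • x) ≤ T.graph.dist y (g • y) := by
    obtain ⟨x, hx, h⟩ :=
      WellFounded.has_min (measure fun x : T.V => T.graph.dist x (g • x)).wf S hne
    exact ⟨x, hx, fun y hy => not_lt.mp (h y hy)⟩
  by_cases hfix : g • x = x
  · exact Or.inl ⟨x, hx, hfix⟩
  have hfix' : x ≠ g⁻¹ • x := fun h => hfix (by
    conv_lhs => rw [h]
    simp)
  obtain ⟨y, hy, hgy⟩ := T.isTree.exists_adj_mem_side (Ne.symm hfix)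
  obtain ⟨z, hz, hgz⟩ := T.isTree.exists_adj_mem_side hfix'
  refine Or.inr ⟨x, hx, y, z, hy, hz, ?_, hgy, hgz⟩
  rintro rfl
  have h1 : x ∈ T.graph.side (g • y) (g • x) := by
    have := (smul_mem_side g).mpr hgz
    rwa [smul_inv_smul] at this
  have h2 := T.isTree.dist_eq_of_mem_side hy hgy
  have h3 := T.isTree.dist_eq_of_mem_side (T.smul_adj g hy) h1
  have h4 : g • y ∈ T.graph.side y x := by
    by_contra h4
    obtain ⟨h5, h6⟩ := (T.isTree.isWall_side hy.symm).unique _ _ (T.smul_adj g hy) hgy h4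
    exact not_inversion hy h5 h6
  have h5 := T.isTree.dist_eq_of_mem_side hy h4
  have h6 : y ∈ S := hS x hx (g • x) (hg x hx) (by
    rw [SimpleGraph.mem_seg, SimpleGraph.dist_eq_one_iff_adj.mpr hy]
    omega)
  have h7 := hmin y h6
  rw [T.graph.dist_comm (u := g • x), T.graph.dist_comm (u := g • y)] at h3
  omega

lemma exists_fixed_of_sq {g : Γ} (h : g * g = 1) {S : Set T.V} (hne : S.Nonempty)
    (hS : ∀ x ∈ S, ∀ y ∈ S, T.graph.seg x y ⊆ S) (hg : ∀ x ∈ S, g • x ∈ S) :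
    ∃ x ∈ S, g • x = x := by
  rcases exists_fixed_or_axis g hne hS hg with h1 | ⟨x, -, y, z, hy, hz, hyz, hgy, hgz⟩
  · exact h1
  · rw [inv_eq_of_mul_eq_one_left h] at hgz
    exact absurd (T.isTree.eq_of_mem_side hy hz hgy hgz) hyz

/-! ### Darts and orbits -/

/-- The oriented edges of a free splitting. -/
def Dart (T : FreeSplitting Γ) : Type u := {p : T.V × T.V // T.graph.Adj p.1 p.2}

instance : MulAction Γ T.Dart where
  smul g d := ⟨g • d.1, T.smul_adj g d.2⟩
  one_smul d := Subtype.ext (one_smul Γ d.1)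
  mul_smul g h d := Subtype.ext (mul_smul g h d.1)

@[simp] lemma Dart.smul_fst (g : Γ) (d : T.Dart) : (g • d).1.1 = g • d.1.1 := rfl

@[simp] lemma Dart.smul_snd (g : Γ) (d : T.Dart) : (g • d).1.2 = g • d.1.2 := rfl

lemma Dart.eq_one_of_smul_eq {g : Γ} {d : T.Dart} (h : g • d = d) : g = 1 :=
  eq_one_of_smul_adj d.2 (congrArg (fun d => d.1.1) h) (congrArg (fun d => d.1.2) h)

lemma Dart.smul_left_cancel {g h : Γ} {d : T.Dart} (H : g • d = h • d) : g = h := by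
  have : (h⁻¹ * g) • d = d := by rw [mul_smul, H, inv_smul_smul]
  exact (inv_mul_eq_one.mp (Dart.eq_one_of_smul_eq this)).symm

/-- The dart with the opposite orientation. -/
def Dart.flip (d : T.Dart) : T.Dart := ⟨d.1.swap, d.2.symm⟩

@[simp] lemma Dart.flip_flip (d : T.Dart) : d.flip.flip = d := rfl

lemma Dart.smul_ne_flip (g : Γ) (d : T.Dart) : g • d ≠ d.flip := fun h =>
  not_inversion (g := g) d.2 (congrArg (fun d => d.1.1) h) (congrArg (fun d => d.1.2) h)

variable (T) in
/-- The set of orbits of darts. -/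
abbrev DartOrbits : Type u := MulAction.orbitRel.Quotient Γ T.Dart

variable (T) in
/-- The set of orbits of vertices. -/
abbrev VertOrbits : Type u := MulAction.orbitRel.Quotient Γ T.V

lemma orbit_mk_eq {X : Type*} [MulAction Γ X] {x y : X} :
    (Quotient.mk _ x : MulAction.orbitRel.Quotient Γ X) = Quotient.mk _ y ↔
      ∃ g : Γ, g • y = x := by
  rw [Quotient.eq]
  exact MulAction.orbitRel_apply.trans MulAction.mem_orbit_iff

instance finite_dartOrbits : Finite T.DartOrbits := by
  obtain ⟨F, hF, h⟩ := T.finite_edge_orbits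
  have : Finite F := hF
  choose! f hfF g hg using fun d : T.Dart => h d.1.1 d.1.2 d.2
  refine Finite.of_injective (β := F) (fun o => ⟨f o.out, hfF _⟩) fun o o' hoo => ?_
  have hoo' : f o.out = f o'.out := congrArg Subtype.val hoo
  rw [← o.out_eq, ← o'.out_eq]
  refine orbit_mk_eq.mpr ⟨g o.out * (g o'.out)⁻¹, ?_⟩
  have h1 := hg o.out
  have h2 := hg o'.out
  refine Subtype.ext (Prod.ext ?_ ?_)
  · rw [Dart.smul_fst, h1.1, h2.1, hoo', mul_smul, inv_smul_smul]
  · rw [Dart.smul_snd, h1.2, h2.2, hoo', mul_smul, inv_smul_smul]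

lemma finite_edge_orbits_of_finite {V : Type*} [MulAction Γ V] {G : SimpleGraph V}
    {D : Type*} [Finite D] (f : D → V × V)
    (h : ∀ v w, G.Adj v w → ∃ d, ∃ g : Γ, v = g • (f d).1 ∧ w = g • (f d).2) :
    ∃ F : Set (V × V), F.Finite ∧
      ∀ v w, G.Adj v w → ∃ p ∈ F, ∃ g : Γ, v = g • p.1 ∧ w = g • p.2 :=
  ⟨Set.range f, Set.finite_range f, fun v w hvw =>
    let ⟨d, g, hd⟩ := h v w hvw
    ⟨f d, ⟨d, rfl⟩, g, hd⟩⟩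

variable (T) in
/-- The orbit of the initial vertex. -/
def src : T.DartOrbits → T.VertOrbits :=
  Quotient.map' (fun d => d.1.1) fun d d' h => by
    obtain ⟨g, rfl⟩ := h
    exact ⟨g, rfl⟩

lemma src_surjective : Function.Surjective T.src := by
  intro o
  induction o using Quotient.inductionOn with
  | h v =>
    obtain ⟨a, ha⟩ := exists_adj v
    exact ⟨Quotient.mk _ ⟨(v, a), ha⟩, rfl⟩

instance finite_vertOrbits : Finite T.VertOrbits := Finite.of_surjective _ T.src_surjective

/-! ### Relatively natural vertices -/

lemma three_le_valence_iff {v : T.V} : 3 ≤ T.valence v ↔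
    ∃ a b c, T.graph.Adj v a ∧ T.graph.Adj v b ∧ T.graph.Adj v c ∧ a ≠ b ∧ a ≠ c ∧ b ≠ c := by
  rw [valence, show (3 : ℕ∞) = ((3 : ℕ) : ℕ∞) from rfl]
  constructor
  · intro h
    obtain ⟨t, ht, htc⟩ := Set.exists_subset_encard_eq h
    obtain ⟨a, b, c, hab, hac, hbc, rfl⟩ := Set.encard_eq_three.mp htc
    exact ⟨a, b, c, ht (by simp), ht (by simp), ht (by simp), hab, hac, hbc⟩
  · rintro ⟨a, b, c, ha, hb, hc, hab, hac, hbc⟩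
    have h1 : ({a, b, c} : Set T.V).encard = 3 :=
      Set.encard_eq_three.mpr ⟨a, b, c, hab, hac, hbc, rfl⟩
    rw [← Nat.cast_ofNat] at h1
    rw [← h1]
    refine Set.encard_le_encard ?_
    rintro x (rfl | rfl | rfl) <;> assumption

lemma smul_isNatVertex (g : Γ) {v : T.V} : T.IsNatVertex (g • v) ↔ T.IsNatVertex v := by
  have key : ∀ (g : Γ) {v : T.V}, T.IsNatVertex v → T.IsNatVertex (g • v) := by
    rintro g v (h | h)
    · left
      rw [three_le_valence_iff] at h ⊢
      obtain ⟨a, b, c, ha, hb, hc, hab, hac, hbc⟩ := h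
      refine ⟨g • a, g • b, g • c, T.smul_adj g ha, T.smul_adj g hb, T.smul_adj g hc, ?_, ?_, ?_⟩
      all_goals simpa
    · right
      rw [MulAction.stabilizer_smul_eq_stabilizer_map_conj]
      rwa [Ne, Subgroup.map_eq_bot_iff_of_injective _ (MulAut.conj g).injective]
  exact ⟨fun h => by simpa using key g⁻¹ h, key g⟩

variable (T) in
/-- There is a relatively natural vertex. -/
def HasNat : Prop := ∃ v, T.IsNatVertex v

variable (T) in
/-- The darts of the relatively natural cell structure: pairs of different relatively natural
vertices with no relatively natural vertex between them. -/
def NatAdj (v w : T.V) : Prop :=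
  v ≠ w ∧ T.IsNatVertex v ∧ T.IsNatVertex w ∧
    ∀ x ∈ T.graph.seg v w, T.IsNatVertex x → x = v ∨ x = w

lemma mem_natEdges {e : Set T.V} :
    e ∈ T.natEdges ↔ ∃ v w, T.NatAdj v w ∧ e = T.graph.seg v w := by
  constructor
  · rintro ⟨v, w, hvw, hv, hw, rfl, h⟩
    exact ⟨v, w, ⟨hvw, hv, hw, h⟩, rfl⟩
  · rintro ⟨v, w, ⟨hvw, hv, hw, h⟩, rfl⟩
    exact ⟨v, w, hvw, hv, hw, rfl, h⟩

lemma stabilizer_ne_bot_iff {v : T.V} :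
    MulAction.stabilizer Γ v ≠ ⊥ ↔ ∃ g : Γ, g ≠ 1 ∧ g • v = v := by
  rw [Subgroup.ne_bot_iff_exists_ne_one]
  constructor
  · rintro ⟨g, hg⟩
    exact ⟨g, fun h => hg (Subtype.ext h), g.2⟩
  · rintro ⟨g, hg, hgv⟩
    exact ⟨⟨g, hgv⟩, fun h => hg (congrArg Subtype.val h)⟩

end FreeSplitting

/-! ### Coarsening a tree -/

namespace SimpleGraph

variable {V V' : Type*} {G : SimpleGraph V} {ι : V' → V}

/-- The coarsening of `G` along `ι`: two vertices are adjacent if no further vertex in the image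
of `ι` lies between them. -/
def coarse (G : SimpleGraph V) (ι : V' → V) : SimpleGraph V' where
  Adj p q := p ≠ q ∧ ∀ r, ι r ∈ G.seg (ι p) (ι q) → r = p ∨ r = q
  symm := ⟨fun p q h => ⟨h.1.symm, fun r hr => (h.2 r (by rwa [seg_comm])).symm⟩⟩
  loopless := ⟨fun _ h => h.1 rfl⟩

/-- The image of `ι` contains all branch vertices of `G`. -/
def ContainsBranching (G : SimpleGraph V) (ι : V' → V) : Prop :=
  ∀ x a b c, G.Adj x a → G.Adj x b → G.Adj x c → a ≠ b → a ≠ c → b ≠ c → x ∈ Set.range ι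

namespace IsTree

variable {p q p' q' r : V'} {v w : V}

/-- At most one edge of the coarsening crosses a given wall of the tree. For two such edges, the
median of their initial points and the far end of the wall is one of these points or a branch
vertex, which then lies in the image of `ι` and on both edges. -/
lemma eq_of_coarse_cross (hG : G.IsTree) (hbr : G.ContainsBranching ι) (hvw : G.Adj v w)
    (h : (G.coarse ι).Adj p q) (h' : (G.coarse ι).Adj p' q') (hp : ι p ∈ G.side v w)
    (hq : ι q ∉ G.side v w) (hp' : ι p' ∈ G.side v w) (hq' : ι q' ∉ G.side v w) : p = p' := by
  have hW := hG.isWall_side hvw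
  have hw : ∀ {a b}, a ∈ G.side v w → b ∉ G.side v w → w ∈ G.seg a b := by
    intro a b ha hb
    have h1 := hW.dist_eq hG.connected ha hb
    have h2 := hW.dist_eq hG.connected ha hW.right_notMem
    rw [dist_self] at h2
    rw [mem_seg]
    omega
  obtain ⟨m, hm1, hm2, hm3⟩ := hG.exists_median (ι p) (ι p') w
  have hmS : m ∈ G.side v w := hG.mem_side_of_mem_seg hm1 hvw hp hp'
  have hm : m ∈ G.seg (ι p) (ι q) := hG.seg_subset_seg (left_mem_seg _ _) (hw hp hq) hm2
  have hm' : m ∈ G.seg (ι p') (ι q') := hG.seg_subset_seg (left_mem_seg _ _) (hw hp' hq') hm3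
  by_cases h1 : m = ι p
  · subst h1
    exact (h'.2 p hm').resolve_right fun h => hq' (h ▸ hp)
  by_cases h2 : m = ι p'
  · subst h2
    exact ((h.2 p' hm).resolve_right fun h => hq (h ▸ hp')).symm
  have h3 : m ≠ w := fun h => hW.right_notMem (h ▸ hmS)
  obtain ⟨a, b, c, ha, hb, hc, hab, hac, hbc⟩ := hG.exists_three_adj hm1 hm2 hm3 h1 h2 h3
  obtain ⟨r, rfl⟩ := hbr m a b c ha hb hc hab hac hbc
  rcases h.2 r hm with rfl | rfl
  · exact absurd rfl h1
  · exact absurd hmS hq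

/-- Two points in the image of `ι` which are not adjacent in the coarsening have a third one between
them, so induction on the distance applies. -/
lemma coarse_connected (hG : G.IsTree) (hι : Function.Injective ι) [hne : Nonempty V'] :
    (G.coarse ι).Connected := by
  rw [connected_iff]
  refine ⟨fun p q => ?_, hne⟩
  induction hn : G.dist (ι p) (ι q) using Nat.strong_induction_on generalizing p q with
  | _ n ih =>
    by_cases hpq : p = q
    · subst hpq
      exact Reachable.refl _
    by_cases hadj : (G.coarse ι).Adj p q
    · exact hadj.reachable
    · obtain ⟨r, hr, hrp, hrq⟩ :
          ∃ r, ι r ∈ G.seg (ι p) (ι q) ∧ r ≠ p ∧ r ≠ q := by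
        by_contra! h
        refine hadj ⟨hpq, fun r hr => ?_⟩
        by_contra! h'
        exact h'.2 (h r hr h'.1)
      have h1 := hG.connected.pos_dist_of_ne (hι.ne hrp)
      have h2 := hG.connected.pos_dist_of_ne (hι.ne hrq)
      rw [mem_seg] at hr
      rw [G.dist_comm] at h1
      exact (ih _ (by omega) p r rfl).trans (ih _ (by omega) r q rfl)

lemma coarse_isWall (hG : G.IsTree) (hbr : G.ContainsBranching ι) (hvw : G.Adj v w)
    (h : (G.coarse ι).Adj p q) (hp : ι p ∈ G.side v w) (hq : ι q ∉ G.side v w) :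
    IsWall (G.coarse ι) (ι ⁻¹' G.side v w) p q where
  adj := h
  left_mem := hp
  right_notMem := hq
  unique := by
    intro x y hxy hx hy
    refine ⟨hG.eq_of_coarse_cross hbr hvw hxy h hx hy hp hq, ?_⟩
    have hsymm : ∀ {z}, z ∈ G.side w v ↔ z ∉ G.side v w := hG.mem_side_symm hvw
    exact hG.eq_of_coarse_cross hbr hvw.symm hxy.symm h.symm (hsymm.mpr hy)
      (fun hx' => hsymm.mp hx' hx) (hsymm.mpr hq) (fun hp' => hsymm.mp hp' hp)

lemma coarse_isTree (hG : G.IsTree) (hι : Function.Injective ι) (hbr : G.ContainsBranching ι)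
    [Nonempty V'] : (G.coarse ι).IsTree := by
  refine isTree_of_isWall (hG.coarse_connected hι) fun p q hpq => ?_
  obtain ⟨v, w, hvw, hp, hq⟩ := hG.exists_side (hι.ne hpq.1)
  exact ⟨_, hG.coarse_isWall hbr hvw hpq hp hq⟩

/-- The sides of the coarsening are the sides of the tree which separate points in the image of `ι`.
-/
lemma side_coarse (hG : G.IsTree) (hι : Function.Injective ι) (hbr : G.ContainsBranching ι)
    (hvw : G.Adj v w) (h : (G.coarse ι).Adj p q) (hp : ι p ∈ G.side v w)
    (hq : ι q ∉ G.side v w) : (G.coarse ι).side p q = ι ⁻¹' G.side v w :=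
  have : Nonempty V' := ⟨p⟩
  ((hG.coarse_isWall hbr hvw h hp hq).eq_side (hG.coarse_connected hι)).symm

/-- A wall of `G` which separates two points in the image of `ι` is crossed by the coarsening. -/
lemma exists_coarse_adj (hG : G.IsTree) (hι : Function.Injective ι)
    (hp : ι p ∈ G.side v w) (hq : ι q ∉ G.side v w) :
    ∃ x y, (G.coarse ι).Adj x y ∧ ι x ∈ G.side v w ∧ ι y ∉ G.side v w :=
  have : Nonempty V' := ⟨p⟩
  (hG.coarse_connected hι).exists_adj_mem_notMem (A := ι ⁻¹' G.side v w) hp hq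

lemma mem_seg_coarse (hG : G.IsTree) (hι : Function.Injective ι) (hbr : G.ContainsBranching ι) :
    r ∈ (G.coarse ι).seg p q ↔ ι r ∈ G.seg (ι p) (ι q) := by
  have : Nonempty V' := ⟨p⟩
  rw [hG.mem_seg_iff, (hG.coarse_isTree hι hbr).mem_seg_iff]
  constructor
  · intro h v w hvw hp hq
    by_contra hr
    obtain ⟨x, y, hxy, hx, hy⟩ := hG.exists_coarse_adj hι hp hr
    have hs := hG.side_coarse hι hbr hvw hxy hx hy
    have := h x y hxy (by rw [hs]; exact hp) (by rw [hs]; exact hq)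
    rw [hs] at this
    exact hr this
  · intro h x y hxy hp hq
    obtain ⟨v, w, hvw, hx, hy⟩ := hG.exists_side (hι.ne hxy.1)
    rw [hG.side_coarse hι hbr hvw hxy hx hy] at hp hq ⊢
    exact h v w hvw hp hq

/-- A connected subgraph on the same vertices of the coarsening, which is a tree, is all of it. -/
lemma coarse_adj_of_le (hG : G.IsTree) (hι : Function.Injective ι) (hbr : G.ContainsBranching ι)
    {S : SimpleGraph V'} (hS : S.Connected) (hle : S ≤ G.coarse ι) : S = G.coarse ι := by
  refine le_antisymm hle fun p q hpq => ?_
  have : Nonempty V' := ⟨p⟩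
  have hW := (hG.coarse_isTree hι hbr).isWall_side hpq
  obtain ⟨x, y, hxy, hx, hy⟩ := hS.exists_adj_mem_notMem hW.left_mem hW.right_notMem
  obtain ⟨rfl, rfl⟩ := hW.unique x y (hle hxy) hx hy
  exact hxy

end IsTree

end SimpleGraph

/-! ### The tree of relatively natural vertices and edges -/

namespace FreeSplitting

variable {Γ : Type u} [Group Γ] {T S : FreeSplitting Γ}

variable (T) in
/-- The set of relatively natural vertices. -/
abbrev NatVert : Type u := {v : T.V // T.IsNatVertex v}

instance : MulAction Γ T.NatVert where
  smul g v := ⟨g • v.1, (smul_isNatVertex g).mpr v.2⟩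
  one_smul v := Subtype.ext (one_smul Γ v.1)
  mul_smul g h v := Subtype.ext (mul_smul g h v.1)

@[simp] lemma NatVert.coe_smul (g : Γ) (v : T.NatVert) : ((g • v : T.NatVert) : T.V) = g • v.1 :=
  rfl

lemma containsBranching_natVert :
    T.graph.ContainsBranching (Subtype.val : T.NatVert → T.V) :=
  fun x a b c ha hb hc hab hac hbc =>
    ⟨⟨x, Or.inl (three_le_valence_iff.mpr ⟨a, b, c, ha, hb, hc, hab, hac, hbc⟩)⟩, rfl⟩

lemma coarse_adj_iff {v w : T.NatVert} :
    (T.graph.coarse Subtype.val).Adj v w ↔ T.NatAdj v w := by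
  constructor
  · rintro ⟨h1, h2⟩
    refine ⟨fun h => h1 (Subtype.ext h), v.2, w.2, fun x hx hxn => ?_⟩
    exact (h2 ⟨x, hxn⟩ hx).imp (congrArg Subtype.val) (congrArg Subtype.val)
  · rintro ⟨h1, -, -, h2⟩
    exact ⟨fun h => h1 (congrArg Subtype.val h), fun r hr =>
      (h2 r hr r.2).imp Subtype.ext Subtype.ext⟩

lemma NatAdj.smul {v w : T.V} (h : T.NatAdj v w) (g : Γ) : T.NatAdj (g • v) (g • w) := by
  obtain ⟨h1, hv, hw, h2⟩ := h
  refine ⟨fun h => h1 (smul_left_cancel g h), (smul_isNatVertex g).mpr hv,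
    (smul_isNatVertex g).mpr hw, fun x hx hxn => ?_⟩
  rw [← smul_inv_smul g x, smul_mem_seg] at hx
  have := h2 (g⁻¹ • x) hx ((smul_isNatVertex g⁻¹).mpr hxn)
  simpa [inv_smul_eq_iff] using this

lemma NatAdj.symm {v w : T.V} (h : T.NatAdj v w) : T.NatAdj w v :=
  ⟨h.1.symm, h.2.2.1, h.2.1, fun x hx hxn =>
    (h.2.2.2 x (by rwa [SimpleGraph.seg_comm]) hxn).symm⟩

/-- Relatively natural edges have trivial stabilizer: an inversion of such an edge would be an
involution which fixes a vertex in the interior of the edge, and this vertex would be relatively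
natural. -/
lemma NatAdj.eq_one {v w : T.V} (h : T.NatAdj v w) {g : Γ} (hg : s(g • v, g • w) = s(v, w)) :
    g = 1 := by
  by_contra hg1
  rcases Sym2.eq_iff.mp hg with ⟨h1, h2⟩ | ⟨h1, h2⟩
  · exact h.1 (eq_of_smul_eq hg1 h1 h2)
  · have hsq : g * g = 1 := by
      by_contra hsq
      exact h.1 (eq_of_smul_eq hsq (by rw [mul_smul, h1, h2]) (by rw [mul_smul, h2, h1]))
    obtain ⟨x, hx, hgx⟩ := exists_fixed_of_sq hsq (S := T.graph.seg v w)
      ⟨v, SimpleGraph.left_mem_seg _ _⟩ (fun x hx y hy => T.isTree.seg_subset_seg hx hy)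
      (fun x hx => by
        have := (smul_mem_seg g).mpr hx
        rwa [h1, h2, SimpleGraph.seg_comm] at this)
    have hxn : T.IsNatVertex x := Or.inr (stabilizer_ne_bot_iff.mpr ⟨g, hg1, hgx⟩)
    rcases h.2.2.2 x hx hxn with rfl | rfl
    · exact h.1 (hgx.symm.trans h1)
    · exact h.1 (h2.symm.trans hgx)

/-- The first edge of the segment representing a dart of the relatively natural cell structure
determines this dart. -/
lemma NatAdj.eq_of_first {v w w' a : T.V} (h : T.NatAdj v w) (h' : T.NatAdj v w')
    (ha : T.graph.Adj v a) (hw : w ∈ T.graph.side a v) (hw' : w' ∈ T.graph.side a v) : w = w' := by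
  have key := T.isTree.eq_of_coarse_cross containsBranching_natVert ha.symm
    (p := ⟨w, h.2.2.1⟩) (q := ⟨v, h.2.1⟩) (p' := ⟨w', h'.2.2.1⟩) (q' := ⟨v, h'.2.1⟩)
    (coarse_adj_iff.mpr h.symm) (coarse_adj_iff.mpr h'.symm) hw
    (T.isTree.right_notMem_side ha.symm) hw' (T.isTree.right_notMem_side ha.symm)
  exact congrArg Subtype.val key

lemma HasNat.exists_mem_side (hT : T.HasNat) {v w : T.V} (h : T.graph.Adj v w) :
    ∃ p : T.NatVert, p.1 ∈ T.graph.side v w := by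
  obtain ⟨p, hp⟩ := hT
  obtain ⟨g, hg⟩ := exists_smul_mem_side h p
  exact ⟨⟨g • p, (smul_isNatVertex g).mpr hp⟩, hg⟩

/-- In every direction at a relatively natural vertex there starts a relatively natural edge. -/
lemma HasNat.exists_natAdj (hT : T.HasNat) {v a : T.V} (hv : T.IsNatVertex v)
    (ha : T.graph.Adj v a) : ∃ w, T.NatAdj v w ∧ w ∈ T.graph.side a v := by
  obtain ⟨p, hp⟩ := hT.exists_mem_side ha.symm
  obtain ⟨x, y, hxy, hx, hy⟩ := T.isTree.exists_coarse_adj (ι := (Subtype.val : T.NatVert → T.V))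
    Subtype.val_injective (q := ⟨v, hv⟩) hp (T.isTree.right_notMem_side ha.symm)
  have hvseg : v ∈ T.graph.seg x y := by
    have hW := T.isTree.isWall_side ha.symm
    have h1 := hW.dist_eq T.isTree.connected hx hy
    have h2 := hW.dist_eq T.isTree.connected hx hW.right_notMem
    rw [SimpleGraph.dist_self] at h2
    rw [SimpleGraph.mem_seg]
    omega
  rcases hxy.2 ⟨v, hv⟩ hvseg with h | h
  · subst h
    exact absurd hx (T.isTree.right_notMem_side ha.symm)
  · subst h
    exact ⟨x, (coarse_adj_iff.mp hxy).symm, hx⟩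

/-- The free splitting formed by the relatively natural vertices and edges of `T`. -/
def natTree (T : FreeSplitting Γ) (hT : T.HasNat) : FreeSplitting Γ where
  V := T.NatVert
  graph := T.graph.coarse Subtype.val
  isTree :=
    have : Nonempty T.NatVert := ⟨⟨hT.choose, hT.choose_spec⟩⟩
    T.isTree.coarse_isTree Subtype.val_injective containsBranching_natVert
  smul_adj := fun g v w h => coarse_adj_iff.mpr ((coarse_adj_iff.mp h).smul g)
  not_point := by
    obtain ⟨v, hv⟩ := hT
    obtain ⟨a, ha⟩ := exists_adj v
    obtain ⟨w, hw, -⟩ := HasNat.exists_natAdj ⟨v, hv⟩ hv ha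
    exact ⟨⟨v, hv⟩, ⟨w, hw.2.2.1⟩, fun h => hw.1 (congrArg Subtype.val h)⟩
  minimal := by
    intro S hS hconn
    have : Nonempty T.NatVert := ⟨⟨hT.choose, hT.choose_spec⟩⟩
    obtain ⟨⟨s, hs⟩⟩ := hconn.nonempty
    rw [Set.eq_univ_iff_forall]
    intro x
    obtain ⟨a, ⟨a', ha, rfl⟩, b, ⟨b', hb, rfl⟩, hx⟩ :=
      exists_mem_seg (P := Subtype.val '' S) ⟨s.1, s, hs, rfl⟩ (by
        rintro g _ ⟨v, hv, rfl⟩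
        exact ⟨g • v, hS g v hv, rfl⟩) x.1
    rw [← T.isTree.mem_seg_coarse Subtype.val_injective containsBranching_natVert] at hx
    exact (T.isTree.coarse_isTree Subtype.val_injective
      containsBranching_natVert).seg_subset_of_connected hconn ha hb hx
  edge_stabilizer := by
    intro g v w h hg
    refine (coarse_adj_iff.mp h).eq_one ?_
    have := congrArg (Sym2.map Subtype.val) hg
    simpa using this
  finite_edge_orbits := by
    classical
    have hr : ∀ o : T.DartOrbits, ∃ p : T.NatVert × T.NatVert,
        (∃ d : T.Dart, Quotient.mk _ d = o ∧ ∃ w, d.1.1 = p.1 ∧ w = p.2.1 ∧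
          T.NatAdj p.1 w ∧ w ∈ T.graph.side d.1.2 d.1.1) ∨
        ¬ ∃ p : T.NatVert × T.NatVert, ∃ d : T.Dart, Quotient.mk _ d = o ∧ ∃ w, d.1.1 = p.1 ∧
          w = p.2.1 ∧ T.NatAdj p.1 w ∧ w ∈ T.graph.side d.1.2 d.1.1 := by
      intro o
      by_cases h : ∃ p : T.NatVert × T.NatVert, ∃ d : T.Dart, Quotient.mk _ d = o ∧
          ∃ w, d.1.1 = p.1 ∧ w = p.2.1 ∧ T.NatAdj p.1 w ∧ w ∈ T.graph.side d.1.2 d.1.1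
      · exact h.imp fun _ h => Or.inl h
      · exact ⟨⟨⟨hT.choose, hT.choose_spec⟩, ⟨hT.choose, hT.choose_spec⟩⟩, Or.inr h⟩
    choose f hf using hr
    refine finite_edge_orbits_of_finite f fun v w hvw => ?_
    have hvw' := coarse_adj_iff.mp hvw
    obtain ⟨a, ha, hwa⟩ := T.isTree.exists_adj_mem_side hvw'.1
    have h := (hf (Quotient.mk _ ⟨(v.1, a), ha⟩)).resolve_right
      (not_not.mpr ⟨(v, w), _, rfl, w.1, rfl, rfl, hvw', hwa⟩)
    obtain ⟨d, hd, w', h1, h2, h3, h4⟩ := h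
    obtain ⟨g, hg⟩ := orbit_mk_eq.mp hd
    have hg1 : g • v.1 = d.1.1 := congrArg (fun d : T.Dart => d.1.1) hg
    have hg2 : g • a = d.1.2 := congrArg (fun d : T.Dart => d.1.2) hg
    refine ⟨Quotient.mk _ ⟨(v.1, a), ha⟩, g⁻¹, ?_, ?_⟩
    · refine Subtype.ext ?_
      rw [NatVert.coe_smul, ← h1, ← hg1, inv_smul_smul]
    · refine Subtype.ext ?_
      rw [NatVert.coe_smul, ← h2]
      have h5 := h3.smul g⁻¹
      rw [← h1, ← hg1, inv_smul_smul] at h5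
      refine hvw'.eq_of_first h5 ha hwa ?_
      have h6 := (smul_mem_side g⁻¹).mpr h4
      rwa [← hg1, ← hg2, inv_smul_smul, inv_smul_smul] at h6

section NatTree

variable (hT : T.HasNat)

lemma natTree_adj {v w : T.NatVert} : (T.natTree hT).graph.Adj v w ↔ T.NatAdj v w :=
  coarse_adj_iff

lemma natTree_stabilizer (v : T.NatVert) :
    MulAction.stabilizer Γ (α := (T.natTree hT).V) v = MulAction.stabilizer Γ v.1 := by
  ext g
  exact Subtype.ext_iff

/-- At a relatively natural vertex, the directions in `T` and in the tree of relatively natural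
vertices correspond. -/
lemma exists_dirEquiv (v : T.NatVert) :
    ∃ f : T.graph.neighborSet v.1 ≃ (T.natTree hT).graph.neighborSet v,
      ∀ a, ((f a).1 : T.NatVert).1 ∈ T.graph.side a.1 v.1 := by
  choose f hf hfs using fun a : T.graph.neighborSet v.1 => hT.exists_natAdj v.2 a.2
  refine ⟨Equiv.ofBijective
    (fun a => ⟨⟨f a, (hf a).2.2.1⟩, (natTree_adj hT).mpr (hf a)⟩) ⟨?_, ?_⟩, hfs⟩
  · intro a b hab
    have h : f a = f b := congrArg (fun x => (Subtype.val (Subtype.val x))) hab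
    exact Subtype.ext (T.isTree.eq_of_mem_side a.2 b.2 (hfs a) (h ▸ hfs b))
  · rintro ⟨w, hw⟩
    have hw' := (natTree_adj hT).mp hw
    obtain ⟨a, ha, hwa⟩ := T.isTree.exists_adj_mem_side hw'.1
    refine ⟨⟨a, ha⟩, Subtype.ext (Subtype.ext ?_)⟩
    exact (hf ⟨a, ha⟩).eq_of_first hw' ha (hfs ⟨a, ha⟩) hwa

lemma natTree_valence (v : T.NatVert) : (T.natTree hT).valence v = T.valence v.1 := by
  obtain ⟨f, -⟩ := exists_dirEquiv hT v
  exact (Set.encard_congr f).symm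

lemma natTree_isNatVertex (v : (T.natTree hT).V) : (T.natTree hT).IsNatVertex v := by
  have h := (show T.NatVert from v).2
  unfold IsNatVertex at h ⊢
  have h1 := natTree_valence hT v
  have h2 := natTree_stabilizer hT v
  rwa [← h1, ← h2] at h

lemma natTree_hasNat : (T.natTree hT).HasNat := ⟨_, natTree_isNatVertex hT ⟨_, hT.choose_spec⟩⟩

lemma natTree_vertexSystem : (T.natTree hT).vertexSystem = T.vertexSystem := by
  ext c
  constructor
  · rintro ⟨v, hv, rfl⟩
    have := natTree_stabilizer hT v
    exact ⟨_, this ▸ hv, congrArg conjClassOf this.symm⟩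
  · rintro ⟨v, hv, rfl⟩
    have := natTree_stabilizer hT ⟨v, Or.inr hv⟩
    exact ⟨_, this.symm ▸ hv, congrArg conjClassOf this⟩

lemma natTree_isGeneric {𝒜 : FreeFactorSystem Γ} :
    (T.natTree hT).IsGeneric 𝒜 ↔ T.IsGeneric 𝒜 := by
  unfold IsGeneric
  rw [natTree_vertexSystem]
  refine and_congr_right fun _ => ?_
  have key : ∀ v : T.NatVert, (∀ x y, (T.natTree hT).graph.Adj v x →
      (T.natTree hT).graph.Adj v y → ∃ g ∈ MulAction.stabilizer Γ v.1, g • x = y) ↔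
      (∀ x y, T.graph.Adj v.1 x → T.graph.Adj v.1 y →
        ∃ g ∈ MulAction.stabilizer Γ v.1, g • x = y) := by
    intro v
    obtain ⟨f, hf⟩ := exists_dirEquiv hT v
    constructor
    · intro h x y hx hy
      obtain ⟨g, hg, hgxy⟩ := h (f ⟨x, hx⟩).1 (f ⟨y, hy⟩).1 (f ⟨x, hx⟩).2 (f ⟨y, hy⟩).2
      refine ⟨g, hg, ?_⟩
      have h1 := (smul_mem_side g).mpr (hf ⟨x, hx⟩)
      have h2 := hf ⟨y, hy⟩
      have h3 : g • v.1 = v.1 := hg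
      have h4 := T.smul_adj g hx
      rw [h3] at h1 h4
      rw [← hgxy] at h2
      exact T.isTree.eq_of_mem_side h4 hy h1 h2
    · intro h x y hx hy
      obtain ⟨⟨a, ha⟩, hax⟩ := f.surjective ⟨x, hx⟩
      obtain ⟨⟨b, hb⟩, hby⟩ := f.surjective ⟨y, hy⟩
      obtain ⟨g, hg, hgab⟩ := h a b ha hb
      refine ⟨g, hg, ?_⟩
      have h3 : g • v.1 = v.1 := hg
      have h1 := (smul_mem_side g).mpr (hf ⟨a, ha⟩)
      have h2 := hf ⟨b, hb⟩
      have h4 := ((natTree_adj hT).mp hx).smul g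
      simp only [hax, hby, h3, hgab] at h1 h2 h4
      refine Subtype.ext ?_
      exact h4.eq_of_first ((natTree_adj hT).mp hy) hb h1 h2
  constructor
  · intro h v
    by_cases hv : T.IsNatVertex v
    · have h1 := h ⟨v, hv⟩
      rwa [natTree_stabilizer, natTree_valence hT ⟨v, hv⟩, key ⟨v, hv⟩] at h1
    · have hv' := not_or.mp hv
      exact ⟨fun _ => (not_le.mp hv'.1).le, fun h => absurd h hv'.2⟩
  · intro h v
    have h1 := h (show T.NatVert from v).1
    rw [← key] at h1
    rwa [natTree_stabilizer hT v, natTree_valence hT v]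

end NatTree

end FreeSplitting

/-! ### Subdivisions and equivalence -/

namespace FreeSplitting

variable {Γ : Type u} [Group Γ] {S T U : FreeSplitting Γ}

namespace Subdivision

variable (φ : Subdivision S U)

include φ in
lemma containsBranching : U.graph.ContainsBranching φ.incl := by
  intro x a b c ha hb hc hab hac hbc
  by_contra hx
  have h3 := three_le_valence_iff.mpr ⟨a, b, c, ha, hb, hc, hab, hac, hbc⟩
  rw [φ.valence_two x hx] at h3
  exact absurd h3 (by norm_num)

lemma graph_eq : S.graph = U.graph.coarse φ.incl :=
  U.isTree.coarse_adj_of_le φ.injective φ.containsBranching S.isTree.connected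
    fun v w h => ⟨h.ne, φ.edge_interior v w h⟩

lemma incl_mem_seg {x v w : S.V} :
    φ.incl x ∈ U.graph.seg (φ.incl v) (φ.incl w) ↔ x ∈ S.graph.seg v w := by
  rw [φ.graph_eq, U.isTree.mem_seg_coarse φ.injective φ.containsBranching]

lemma eq_of_cross {v w v' w' : S.V} {x y : U.V} (hxy : U.graph.Adj x y) (h : S.graph.Adj v w)
    (h' : S.graph.Adj v' w') (hv : φ.incl v ∈ U.graph.side x y)
    (hw : φ.incl w ∉ U.graph.side x y) (hv' : φ.incl v' ∈ U.graph.side x y)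
    (hw' : φ.incl w' ∉ U.graph.side x y) : v = v' := by
  rw [φ.graph_eq] at h h'
  exact U.isTree.eq_of_coarse_cross φ.containsBranching hxy h h' hv hw hv' hw'

lemma valence_incl (v : S.V) : U.valence (φ.incl v) = S.valence v := by
  choose f hf hfs using fun q : S.graph.neighborSet v =>
    U.isTree.exists_adj_mem_side (φ.injective.ne q.2.ne)
  refine (Set.encard_congr (Equiv.ofBijective (fun q => ⟨f q, hf q⟩) ⟨?_, ?_⟩)).symm
  · intro q q' h
    have h1 : f q = f q' := congrArg Subtype.val h
    have h2 := hfs q'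
    rw [← h1] at h2
    exact Subtype.ext (φ.eq_of_cross (hf q).symm q.2.symm q'.2.symm (hfs q)
      (U.isTree.right_notMem_side (hf q).symm) h2 (U.isTree.right_notMem_side (hf q).symm))
  · rintro ⟨a, ha⟩
    have hend : ∀ w, S.graph.Adj v w → a ∈ U.graph.seg (φ.incl v) (φ.incl w) →
        ∃ q : S.graph.neighborSet v, (⟨f q, hf q⟩ : U.graph.neighborSet (φ.incl v)) = ⟨a, ha⟩ := by
      intro w hw haw
      refine ⟨⟨w, hw⟩, Subtype.ext (U.isTree.eq_of_mem_side (hf ⟨w, hw⟩) ha (hfs ⟨w, hw⟩) ?_)⟩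
      rw [SimpleGraph.mem_seg, SimpleGraph.dist_eq_one_iff_adj.mpr ha] at haw
      rw [SimpleGraph.mem_side, U.graph.dist_comm, U.graph.dist_comm (v := φ.incl v)]
      exact Nat.lt_of_lt_of_eq (Nat.lt_add_of_pos_left one_pos) haw
    obtain ⟨p, q, hpq, hv, ha'⟩ := φ.cover _ _ ha
    rcases φ.edge_interior p q hpq v hv with rfl | rfl
    · exact hend q hpq ha'
    · exact hend p hpq.symm (by rw [SimpleGraph.seg_comm]; exact ha')

lemma stabilizer_incl (v : S.V) :
    MulAction.stabilizer Γ (φ.incl v) = MulAction.stabilizer Γ v := by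
  ext g
  rw [MulAction.mem_stabilizer_iff, MulAction.mem_stabilizer_iff, ← φ.equivariant,
    φ.injective.eq_iff]

lemma isNatVertex_incl (v : S.V) : U.IsNatVertex (φ.incl v) ↔ S.IsNatVertex v := by
  unfold IsNatVertex
  rw [φ.valence_incl, φ.stabilizer_incl]

lemma mem_range_of_isNatVertex {x : U.V} (hx : U.IsNatVertex x) : x ∈ Set.range φ.incl := by
  by_contra hr
  have hval := φ.valence_two x hr
  have h3 : ¬ 3 ≤ U.valence x := by
    rw [hval]
    norm_num
  rcases hx with hx | hx
  · exact h3 hx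
  obtain ⟨g, hg1, hgx⟩ := stabilizer_ne_bot_iff.mp hx
  obtain ⟨y, hy⟩ := exists_adj x
  obtain ⟨v, w, hvw, hxs, -⟩ := φ.cover x y hy
  obtain ⟨a, ha, hva⟩ := U.isTree.exists_adj_mem_side (a := x) (b := φ.incl v)
    fun h => hr ⟨v, h.symm⟩
  obtain ⟨b, hb, hwb⟩ := U.isTree.exists_adj_mem_side (a := x) (b := φ.incl w)
    fun h => hr ⟨w, h.symm⟩
  have hab := U.isTree.ne_of_mem_seg hxs ha hb hva hwb
  have hnbr : ∀ c, U.graph.Adj x c → c = a ∨ c = b := by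
    intro c hc
    by_contra! h
    exact h3 (three_le_valence_iff.mpr ⟨a, b, c, ha, hb, hc, hab, h.1.symm, h.2.symm⟩)
  have hga : g • a = b := by
    have hadj := U.smul_adj g ha
    rw [hgx] at hadj
    exact (hnbr _ hadj).resolve_left fun h => hg1 (eq_one_of_smul_adj ha hgx h)
  have hgb : g • b = a := by
    have hadj := U.smul_adj g hb
    rw [hgx] at hadj
    exact (hnbr _ hadj).resolve_right fun h => hg1 (eq_one_of_smul_adj hb hgx h)
  have hwa : φ.incl w ∉ U.graph.side a x := fun h => hab (U.isTree.eq_of_mem_side ha hb h hwb)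
  have hvb : φ.incl v ∉ U.graph.side b x := fun h => hab (U.isTree.eq_of_mem_side ha hb hva h)
  have tr : ∀ {c d : U.V} {z : S.V}, g • c = d →
      (φ.incl (g • z) ∈ U.graph.side d x ↔ φ.incl z ∈ U.graph.side c x) := by
    rintro c d z rfl
    have := smul_mem_side (T := U) g (v := c) (w := x) (x := φ.incl z)
    rwa [hgx, ← φ.equivariant] at this
  have h1 := φ.eq_of_cross hb.symm (S.smul_adj g hvw) hvw.symm ((tr hga).mpr hva)
    (fun h => hwa ((tr hga).mp h)) hwb hvb
  have h2 := φ.eq_of_cross ha.symm (S.smul_adj g hvw.symm) hvw ((tr hgb).mpr hwb)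
    (fun h => hvb ((tr hgb).mp h)) hva hwa
  exact not_inversion hvw h1 h2

end Subdivision

/-- The relatively natural cell structures of `S` and `T` are isomorphic. -/
def NatIso (S T : FreeSplitting Γ) : Prop :=
  ∃ f : S.NatVert ≃ T.NatVert, (∀ (g : Γ) v, f (g • v) = g • f v) ∧
    ∀ v w : S.NatVert, S.NatAdj v w ↔ T.NatAdj (f v) (f w)

lemma NatIso.refl (S : FreeSplitting Γ) : NatIso S S :=
  ⟨Equiv.refl _, fun _ _ => rfl, fun _ _ => Iff.rfl⟩

lemma NatIso.symm (h : NatIso S T) : NatIso T S := by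
  obtain ⟨f, h1, h2⟩ := h
  refine ⟨f.symm, fun g v => ?_, fun v w => ?_⟩
  · rw [Equiv.symm_apply_eq, h1, Equiv.apply_symm_apply]
  · rw [h2, Equiv.apply_symm_apply, Equiv.apply_symm_apply]

lemma NatIso.trans (h : NatIso S T) (h' : NatIso T U) : NatIso S U := by
  obtain ⟨f, h1, h2⟩ := h
  obtain ⟨f', h1', h2'⟩ := h'
  refine ⟨f.trans f', fun g v => ?_, fun v w => ?_⟩
  · simp [h1, h1']
  · rw [h2, h2', Equiv.trans_apply, Equiv.trans_apply]

lemma Subdivision.natIso (φ : Subdivision S U) : NatIso S U := by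
  refine ⟨Equiv.ofBijective
    (fun v => ⟨φ.incl v.1, (φ.isNatVertex_incl v.1).mpr v.2⟩) ⟨?_, ?_⟩, ?_, ?_⟩
  · intro v w h
    exact Subtype.ext (φ.injective (congrArg Subtype.val h))
  · rintro ⟨x, hx⟩
    obtain ⟨v, rfl⟩ := φ.mem_range_of_isNatVertex hx
    exact ⟨⟨v, (φ.isNatVertex_incl v).mp hx⟩, rfl⟩
  · intro g v
    exact Subtype.ext (φ.equivariant g v.1)
  · intro v w
    constructor
    · rintro ⟨h1, hv, hw, h2⟩
      refine ⟨φ.injective.ne h1, (φ.isNatVertex_incl _).mpr hv, (φ.isNatVertex_incl _).mpr hw, ?_⟩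
      intro x hx hxn
      obtain ⟨z, rfl⟩ := φ.mem_range_of_isNatVertex hxn
      exact (h2 z (φ.incl_mem_seg.mp hx) ((φ.isNatVertex_incl z).mp hxn)).imp
        (congrArg φ.incl) (congrArg φ.incl)
    · rintro ⟨h1, -, -, h2⟩
      refine ⟨fun h => h1 (congrArg φ.incl h), v.2, w.2, fun x hx hxn => ?_⟩
      exact (h2 _ (φ.incl_mem_seg.mpr hx) ((φ.isNatVertex_incl x).mpr hxn)).imp
        (fun h => φ.injective h) (fun h => φ.injective h)

/-- A free splitting as a subdivision of itself. -/
def Subdivision.refl (S : FreeSplitting Γ) : Subdivision S S where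
  incl := id
  injective := Function.injective_id
  equivariant := fun _ _ => rfl
  edge_interior := by
    intro v w h x hx
    have hx' : x ∈ S.graph.seg v w := hx
    rwa [S.isTree.seg_eq_pair_of_adj h] at hx'
  cover := fun x y h =>
    ⟨x, y, h, SimpleGraph.left_mem_seg x y, SimpleGraph.right_mem_seg x y⟩
  valence_two := fun x hx => absurd ⟨x, rfl⟩ hx

lemma valence_eq_two {x : T.V} (hx : ¬ T.IsNatVertex x) : T.valence x = 2 := by
  have h3 : T.valence x < 3 := not_le.mp fun h => hx (Or.inl h)
  obtain ⟨a, ha⟩ := exists_adj x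
  obtain ⟨b, hb, hba⟩ := exists_adj_ne x a
  have h2 : 2 ≤ T.valence x := by
    rw [valence, ← Set.encard_pair hba]
    refine Set.encard_le_encard ?_
    rintro z (rfl | rfl) <;> assumption
  exact le_antisymm (Order.le_of_lt_add_one h3) h2

/-- If the relatively natural cell structures of `S` and `T` are isomorphic, then `T` is a
subdivision of the tree of relatively natural vertices of `S`. -/
lemma NatIso.exists_subdivision (h : NatIso S T) (hS : S.HasNat) :
    Nonempty (Subdivision (S.natTree hS) T) := by
  obtain ⟨f, h1, h2⟩ := h
  have hT : T.HasNat := ⟨_, (f ⟨hS.choose, hS.choose_spec⟩).2⟩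
  exact ⟨
    { incl := fun v => (f v).1
      injective := fun v w h => f.injective (Subtype.ext h)
      equivariant := fun g v => congrArg Subtype.val (h1 g v)
      edge_interior := by
        intro v w h x hx
        have h3 := (h2 v w).mp ((natTree_adj hS).mp h)
        exact (h3.2.2.2 _ hx (f x).2).imp (fun h => f.injective (Subtype.ext h))
          (fun h => f.injective (Subtype.ext h))
      cover := by
        intro x y hxy
        obtain ⟨p, hp⟩ := hT.exists_mem_side hxy
        obtain ⟨q, hq⟩ := hT.exists_mem_side hxy.symm
        rw [T.isTree.mem_side_symm hxy] at hq
        obtain ⟨v, w, hvw, hv, hw⟩ := T.isTree.exists_coarse_adj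
          (ι := (Subtype.val : T.NatVert → T.V)) Subtype.val_injective hp hq
        have hd := (T.isTree.isWall_side hxy).dist_eq T.isTree.connected hv hw
        have hW := T.isTree.isWall_side hxy
        have hd1 := hW.dist_eq T.isTree.connected hW.left_mem hw
        have hd2 := hW.dist_eq T.isTree.connected hv hW.right_notMem
        rw [SimpleGraph.dist_self] at hd1 hd2
        refine ⟨f.symm v, f.symm w, (natTree_adj hS).mpr ?_, ?_, ?_⟩
        · rw [h2, Equiv.apply_symm_apply, Equiv.apply_symm_apply]
          exact coarse_adj_iff.mp hvw
        · rw [Equiv.apply_symm_apply, Equiv.apply_symm_apply]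
          exact SimpleGraph.mem_seg.mpr (by omega)
        · rw [Equiv.apply_symm_apply, Equiv.apply_symm_apply]
          exact SimpleGraph.mem_seg.mpr (by omega)
      valence_two := by
        intro x hx
        refine valence_eq_two fun hxn => hx ⟨f.symm ⟨x, hxn⟩, ?_⟩
        exact congrArg Subtype.val (f.apply_symm_apply ⟨x, hxn⟩) }⟩

lemma NatIso.hasNat (h : NatIso S T) (hS : S.HasNat) : T.HasNat :=
  let ⟨f, _⟩ := h
  ⟨_, (f ⟨hS.choose, hS.choose_spec⟩).2⟩

lemma Equivalent.natIso (h : Equivalent S T) : NatIso S T := by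
  obtain ⟨U, ⟨φ⟩, ⟨ψ⟩⟩ := h
  exact φ.natIso.trans ψ.natIso.symm

lemma natIso_of_cls_eq (h : S.cls = T.cls) : NatIso S T := by
  have h' := Quot.eq.mp h
  clear h
  induction h' with
  | rel _ _ h => exact h.natIso
  | refl => exact NatIso.refl _
  | symm _ _ _ ih => exact ih.symm
  | trans _ _ _ _ _ ih ih' => exact ih.trans ih'

lemma natTree_cls_of_natIso (h : NatIso S T) (hS : S.HasNat) : (S.natTree hS).cls = T.cls :=
  Quot.sound ⟨T, h.exists_subdivision hS, ⟨Subdivision.refl T⟩⟩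

lemma natTree_cls (hS : S.HasNat) : (S.natTree hS).cls = S.cls :=
  natTree_cls_of_natIso (NatIso.refl S) hS

lemma NatIso.cls_eq (h : NatIso S T) (hS : S.HasNat) : S.cls = T.cls :=
  (natTree_cls hS).symm.trans (natTree_cls_of_natIso h hS)

lemma NatIso.vertexSystem_eq (h : NatIso S T) : S.vertexSystem = T.vertexSystem := by
  have key : ∀ {S T : FreeSplitting Γ}, NatIso S T → S.vertexSystem ⊆ T.vertexSystem := by
    rintro S T ⟨f, h1, -⟩ c ⟨v, hv, rfl⟩
    have hst : MulAction.stabilizer Γ (f ⟨v, Or.inr hv⟩).1 = MulAction.stabilizer Γ v := by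
      ext g
      have h3 := h1 g ⟨v, Or.inr hv⟩
      rw [MulAction.mem_stabilizer_iff, MulAction.mem_stabilizer_iff, ← NatVert.coe_smul, ← h3,
        ← Subtype.ext_iff, f.injective.eq_iff]
      exact Subtype.ext_iff
    exact ⟨_, hst.symm ▸ hv, by rw [hst]⟩
  exact (key h).antisymm (key h.symm)

lemma NatIso.isRel (h : NatIso S T) {𝒜 : FreeFactorSystem Γ} (hS : S.IsRel 𝒜) : T.IsRel 𝒜 := by
  unfold IsRel at hS ⊢
  rwa [← h.vertexSystem_eq]

end FreeSplitting

/-! ### Collapse maps and walls -/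

namespace FreeSplitting

variable {Γ : Type u} [Group Γ] {X Y Z : FreeSplitting Γ}

/-- A wall map is an equivariant surjection for which the inverse image of each side of an edge is
a side of an edge. These are the collapse maps which are simplicial without subdivisions; the
description by sides is stable under passage to the trees of relatively natural vertices. -/
structure IsWallMap (f : X.V → Y.V) : Prop where
  equivariant : ∀ (g : Γ) v, f (g • v) = g • f v
  surjective : Function.Surjective f
  pull : ∀ y y', Y.graph.Adj y y' → ∃ x x', X.graph.Adj x x' ∧
    ∀ z, f z ∈ Y.graph.side y y' ↔ z ∈ X.graph.side x x'

/-- If the fibers are connected then only one edge lies over a given edge, so the inverse image of a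
side is a wall. -/
lemma isWallMap_of_connected_fiber {f : X.V → Y.V} (heq : ∀ (g : Γ) v, f (g • v) = g • f v)
    (hsimp : ∀ v w, X.graph.Adj v w → f v = f w ∨ Y.graph.Adj (f v) (f w))
    (hconn : ∀ y, (X.graph.induce (f ⁻¹' {y})).Connected) : IsWallMap f := by
  have hsurj : Function.Surjective f := fun y =>
    let ⟨x⟩ := (hconn y).nonempty
    ⟨x.1, x.2⟩
  refine ⟨heq, hsurj, fun y y' hyy' => ?_⟩
  have hWY := Y.isTree.isWall_side hyy'
  have cross : ∀ u u', X.graph.Adj u u' → f u ∈ Y.graph.side y y' → f u' ∉ Y.graph.side y y' →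
      f u = y ∧ f u' = y' := by
    intro u u' h hu hu'
    rcases hsimp u u' h with h | h
    · exact absurd (h ▸ hu) hu'
    · exact hWY.unique _ _ h hu hu'
  obtain ⟨x0, hx0⟩ := hsurj y
  obtain ⟨x0', hx0'⟩ := hsurj y'
  obtain ⟨x, x', hxx', hx, hx'⟩ := X.isTree.connected.exists_adj_mem_notMem
    (A := f ⁻¹' Y.graph.side y y') (a := x0) (b := x0')
    (by rw [Set.mem_preimage, hx0]; exact hWY.left_mem)
    (by rw [Set.mem_preimage, hx0']; exact hWY.right_notMem)
  obtain ⟨hxy, hxy'⟩ := cross x x' hxx' hx hx'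
  have hWX := X.isTree.isWall_side hxx'
  have fib : ∀ {a b z : X.V} {c : Y.V}, f a = c → f b = c → z ∈ X.graph.seg a b → f z = c :=
    fun ha hb hz => X.isTree.seg_subset_of_connected (hconn _) ha hb hz
  have endp : ∀ {a b : X.V}, a ∈ X.graph.side x x' → b ∉ X.graph.side x x' →
      x ∈ X.graph.seg a b ∧ x' ∈ X.graph.seg a b := by
    intro a b ha hb
    have h1 := hWX.dist_eq X.isTree.connected ha hb
    have h2 := hWX.dist_eq X.isTree.connected ha hWX.right_notMem
    have h3 := hWX.dist_eq X.isTree.connected hWX.left_mem hb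
    rw [SimpleGraph.dist_self] at h2 h3
    rw [SimpleGraph.mem_seg, SimpleGraph.mem_seg]
    omega
  have hW : SimpleGraph.IsWall X.graph (f ⁻¹' Y.graph.side y y') x x' :=
    { adj := hxx'
      left_mem := hx
      right_notMem := hx'
      unique := by
        intro u u' h hu hu'
        obtain ⟨huy, huy'⟩ := cross u u' h hu hu'
        by_cases h1 : u ∈ X.graph.side x x'
        · by_cases h2 : u' ∈ X.graph.side x x'
          · exact absurd (hxy.symm.trans (fib huy' hxy' (endp h2 hWX.right_notMem).1)) hyy'.ne
          · exact hWX.unique u u' h h1 h2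
        · exact absurd ((fib hxy huy (endp hWX.left_mem h1).2).symm.trans hxy') hyy'.ne }
  have := hW.eq_side X.isTree.connected
  exact ⟨x, x', hxx', fun z => by rw [← this, Set.mem_preimage]⟩

namespace IsWallMap

variable {f : X.V → Y.V} {f' : Y.V → Z.V}

lemma comp (hf' : IsWallMap f') (hf : IsWallMap f) : IsWallMap (f' ∘ f) where
  equivariant g v := by rw [Function.comp, Function.comp, hf.equivariant, hf'.equivariant]
  surjective := hf'.surjective.comp hf.surjective
  pull := by
    intro z z' hz
    obtain ⟨y, y', hy, h1⟩ := hf'.pull z z' hz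
    obtain ⟨x, x', hx, h2⟩ := hf.pull y y' hy
    exact ⟨x, x', hx, fun v => (h1 (f v)).trans (h2 v)⟩

variable (hf : IsWallMap f)

include hf

lemma mem_seg {x a b : X.V} (hx : x ∈ X.graph.seg a b) : f x ∈ Y.graph.seg (f a) (f b) := by
  rw [Y.isTree.mem_seg_iff]
  intro v w hvw ha hb
  obtain ⟨p, q, hpq, h⟩ := hf.pull v w hvw
  rw [h] at ha hb ⊢
  exact X.isTree.mem_side_of_mem_seg hx hpq ha hb

lemma fiber_convex {x a b : X.V} {y : Y.V} (ha : f a = y) (hb : f b = y)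
    (hx : x ∈ X.graph.seg a b) : f x = y := by
  have := hf.mem_seg hx
  rwa [ha, hb, Y.isTree.seg_self] at this

lemma connected_fiber (y : Y.V) : (X.graph.induce (f ⁻¹' {y})).Connected :=
  X.isTree.connected_induce (hf.surjective y) fun _ ha _ hb _ hx => hf.fiber_convex ha hb hx

/-- The segment between the images of adjacent vertices has at most one edge, since the walls of two
different edges pull back to different walls. -/
lemma simplicial (x x' : X.V) (h : X.graph.Adj x x') :
    f x = f x' ∨ Y.graph.Adj (f x) (f x') := by
  by_contra! hne
  obtain ⟨y, hy, hxy⟩ := Y.isTree.exists_adj_mem_side hne.1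
  have hyx : y ≠ f x' := by
    rintro rfl
    exact hne.2 hy
  obtain ⟨z, hz, hyz⟩ := Y.isTree.exists_adj_mem_side hyx
  have hxz : f x ∉ Y.graph.side z y := fun h1 => by
    obtain ⟨h2, -⟩ := (Y.isTree.isWall_side hz.symm).unique _ _ hy h1
      (Y.isTree.right_notMem_side hz.symm)
    have h3 := Y.isTree.right_notMem_side hy.symm
    rw [h2] at h3
    have h4 := (Y.isTree.mem_side_symm hz).mp hyz
    rw [h2] at hxy
    exact h4 hxy
  obtain ⟨u, u', hu, h1⟩ := hf.pull _ _ hy.symm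
  obtain ⟨w, w', hw, h2⟩ := hf.pull _ _ hz.symm
  have e1 := (X.isTree.isWall_side hu).unique x' x h.symm ((h1 x').mp hxy)
    fun h3 => Y.isTree.right_notMem_side hy.symm ((h1 x).mpr h3)
  have e2 := (X.isTree.isWall_side hw).unique x' x h.symm ((h2 x').mp hyz)
    fun h3 => hxz ((h2 x).mpr h3)
  obtain ⟨t, rfl⟩ := hf.surjective y
  have h3 := (h1 t).mp (Y.isTree.left_mem_side hy.symm)
  rw [← e1.1, ← e1.2, e2.1, e2.2, ← h2] at h3
  exact Y.isTree.right_notMem_side hz.symm h3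

/-- Exactly one edge is mapped onto a given edge. -/
lemma exists_lift {y y' : Y.V} (h : Y.graph.Adj y y') : ∃ x x', X.graph.Adj x x' ∧ f x = y ∧
    f x' = y' ∧ ∀ u u', X.graph.Adj u u' → f u = y → f u' = y' → u = x ∧ u' = x' := by
  obtain ⟨x, x', hx, h1⟩ := hf.pull y y' h
  have hW := X.isTree.isWall_side hx
  have hWY := Y.isTree.isWall_side h
  have h2 := (h1 x).mpr hW.left_mem
  have h3 : f x' ∉ Y.graph.side y y' := fun h3 => hW.right_notMem ((h1 x').mp h3)
  have h4 : f x = y ∧ f x' = y' := by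
    rcases hf.simplicial x x' hx with h5 | h5
    · exact absurd (h5 ▸ h2) h3
    · exact hWY.unique _ _ h5 h2 h3
  refine ⟨x, x', hx, h4.1, h4.2, fun u u' hu hy hy' => hW.unique u u' hu ?_ ?_⟩
  · rw [← h1, hy]
    exact hWY.left_mem
  · rw [← h1, hy']
    exact hWY.right_notMem

/-- No direction is collapsed as a whole. -/
lemma exists_mem_side_ne {v a : X.V} (ha : X.graph.Adj v a) :
    ∃ z ∈ X.graph.side a v, f z ≠ f v := by
  obtain ⟨y⟩ : Nonempty Y.V := inferInstance
  obtain ⟨y', hy⟩ := exists_adj y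
  obtain ⟨x, x', hx, h1, h2, -⟩ := hf.exists_lift hy
  obtain ⟨g, hg, hg'⟩ := exists_smul_mem_side₂ ha.symm hx
  by_cases h : f (g • x) = f v
  · refine ⟨g • x', hg', fun h' => ?_⟩
    rw [hf.equivariant, h1] at h
    rw [hf.equivariant, h2, ← h] at h'
    exact hy.ne (smul_left_cancel g h').symm
  · exact ⟨g • x, hg, h⟩

/-- Relatively natural vertices are mapped to such vertices, since different directions at a vertex
contain points with images in different directions. -/
lemma isNatVertex {v : X.V} (hv : X.IsNatVertex v) : Y.IsNatVertex (f v) := by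
  rcases hv with hv | hv
  · left
    rw [three_le_valence_iff] at hv ⊢
    obtain ⟨a, b, c, ha, hb, hc, hab, hac, hbc⟩ := hv
    have key : ∀ a, X.graph.Adj v a → ∃ z ∈ X.graph.side a v, ∃ a', Y.graph.Adj (f v) a' ∧
        f z ∈ Y.graph.side a' (f v) := by
      intro a ha
      obtain ⟨z, hz, hzv⟩ := hf.exists_mem_side_ne ha
      exact ⟨z, hz, Y.isTree.exists_adj_mem_side hzv.symm⟩
    obtain ⟨z1, hz1, a', ha', h1⟩ := key a ha
    obtain ⟨z2, hz2, b', hb', h2⟩ := key b hb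
    obtain ⟨z3, hz3, c', hc', h3⟩ := key c hc
    exact ⟨a', b', c', ha', hb', hc',
      Y.isTree.ne_of_mem_seg (hf.mem_seg (X.isTree.mem_seg_of_ne ha hb hz1 hz2 hab)) ha' hb' h1 h2,
      Y.isTree.ne_of_mem_seg (hf.mem_seg (X.isTree.mem_seg_of_ne ha hc hz1 hz3 hac)) ha' hc' h1 h3,
      Y.isTree.ne_of_mem_seg (hf.mem_seg (X.isTree.mem_seg_of_ne hb hc hz2 hz3 hbc)) hb' hc' h2 h3⟩
  · right
    rw [stabilizer_ne_bot_iff] at hv ⊢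
    obtain ⟨g, hg, hgv⟩ := hv
    exact ⟨g, hg, by rw [← hf.equivariant, hgv]⟩

/-- Over every relatively natural vertex there is a relatively natural vertex: at a branch vertex
take the median of points in three directions, and an involution which stabilizes a fiber has a
fixed vertex in it. -/
lemma exists_isNatVertex {y : Y.V} (hy : Y.IsNatVertex y) : ∃ x, X.IsNatVertex x ∧ f x = y := by
  have h3 : 3 ≤ Y.valence y → ∃ x, X.IsNatVertex x ∧ f x = y := by
    intro h
    rw [three_le_valence_iff] at h
    obtain ⟨a, b, c, ha, hb, hc, hab, hac, hbc⟩ := h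
    obtain ⟨a, rfl⟩ := hf.surjective a
    obtain ⟨b, rfl⟩ := hf.surjective b
    obtain ⟨c, rfl⟩ := hf.surjective c
    obtain ⟨m, h1, h2, h3⟩ := X.isTree.exists_median a b c
    -- the image of the median lies on the same side as `y` of every edge, since at most one of the
    -- three neighbours of `y` is beyond the edge
    have hm : f m = y := by
      refine (Y.isTree.eq_of_forall_side fun v w hvw hy => ?_).symm
      have hW := Y.isTree.isWall_side hvw
      by_cases ha' : f a ∈ Y.graph.side v w
      · by_cases hb' : f b ∈ Y.graph.side v w
        · exact Y.isTree.mem_side_of_mem_seg (hf.mem_seg h1) hvw ha' hb'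
        · refine Y.isTree.mem_side_of_mem_seg (hf.mem_seg h2) hvw ha' ?_
          by_contra hc'
          exact hbc ((hW.unique _ _ hb hy hb').2.trans (hW.unique _ _ hc hy hc').2.symm)
      · refine Y.isTree.mem_side_of_mem_seg (hf.mem_seg h3) hvw ?_ ?_
        · by_contra hb'
          exact hab ((hW.unique _ _ ha hy ha').2.trans (hW.unique _ _ hb hy hb').2.symm)
        · by_contra hc'
          exact hac ((hW.unique _ _ ha hy ha').2.trans (hW.unique _ _ hc hy hc').2.symm)
    refine ⟨m, Or.inl (three_le_valence_iff.mpr ?_), hm⟩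
    exact X.isTree.exists_three_adj h1 h2 h3 (fun h => ha.ne (by rw [← hm, h]))
      (fun h => hb.ne (by rw [← hm, h])) (fun h => hc.ne (by rw [← hm, h]))
  rcases hy with hy | hy
  · exact h3 hy
  · obtain ⟨g, hg, hgy⟩ := stabilizer_ne_bot_iff.mp hy
    obtain ⟨b, hb⟩ := exists_adj y
    have hb1 := Y.smul_adj g hb
    have hb2 := Y.smul_adj g hb1
    rw [hgy] at hb1 hb2
    rw [hgy] at hb2
    have hne : g • b ≠ b := fun h => hg (eq_one_of_smul_adj hb hgy h)
    by_cases hgg : g • g • b = b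
    · have hsq : g * g = 1 := eq_one_of_smul_adj hb (by rw [mul_smul, hgy, hgy])
        (by rw [mul_smul, hgg])
      obtain ⟨x, hx, hgx⟩ := exists_fixed_of_sq (T := X) hsq (S := f ⁻¹' {y}) (hf.surjective y)
        (fun a ha b hb x hx => hf.fiber_convex ha hb hx)
        (fun x hx => by
          have hx' : f x = y := hx
          rw [Set.mem_preimage, hf.equivariant, hx', hgy, Set.mem_singleton_iff])
      exact ⟨x, Or.inr (stabilizer_ne_bot_iff.mpr ⟨g, hg, hgx⟩), hx⟩
    · refine h3 (three_le_valence_iff.mpr ⟨b, g • b, g • g • b, hb, hb1, hb2, hne.symm,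
        Ne.symm hgg, fun h => hne ?_⟩)
      exact (smul_left_cancel g h).symm

lemma hasNat_iff : X.HasNat ↔ Y.HasNat :=
  ⟨fun ⟨_, hv⟩ => ⟨_, hf.isNatVertex hv⟩, fun ⟨_, hv⟩ =>
    (hf.exists_isNatVertex hv).imp fun _ h => h.1⟩

/-- A wall map induces a wall map of the trees of relatively natural vertices. -/
lemma natMap (hX : X.HasNat) (hY : Y.HasNat) :
    IsWallMap (X := X.natTree hX) (Y := Y.natTree hY)
      (fun v : X.NatVert => (⟨f v.1, hf.isNatVertex v.2⟩ : Y.NatVert)) where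
  equivariant g v := Subtype.ext (hf.equivariant g (show X.NatVert from v).1)
  surjective := by
    rintro ⟨y, hy⟩
    obtain ⟨x, hx, rfl⟩ := hf.exists_isNatVertex hy
    exact ⟨⟨x, hx⟩, rfl⟩
  pull := by
    intro (p : Y.NatVert) (q : Y.NatVert) hpq
    obtain ⟨v, w, hvw, hp, hq⟩ := Y.isTree.exists_side ((natTree_adj hY).mp hpq).1
    have hs : (Y.natTree hY).graph.side p q = Subtype.val ⁻¹' Y.graph.side v w :=
      Y.isTree.side_coarse Subtype.val_injective containsBranching_natVert hvw hpq hp hq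
    obtain ⟨x, x', hx, h⟩ := hf.pull v w hvw
    obtain ⟨p', hp', hpp⟩ := hf.exists_isNatVertex p.2
    obtain ⟨q', hq', hqq⟩ := hf.exists_isNatVertex q.2
    rw [← hpp, h] at hp
    rw [← hqq, h] at hq
    obtain ⟨a, b, hab, ha, hb⟩ := X.isTree.exists_coarse_adj
      (ι := (Subtype.val : X.NatVert → X.V)) Subtype.val_injective (p := ⟨p', hp'⟩)
      (q := ⟨q', hq'⟩) hp hq
    have hs' : (X.natTree hX).graph.side a b = Subtype.val ⁻¹' X.graph.side x x' :=
      X.isTree.side_coarse Subtype.val_injective containsBranching_natVert hx hab ha hb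
    refine ⟨a, b, hab, fun z => ?_⟩
    rw [hs, hs']
    exact h (show X.NatVert from z).1

/-! ### Counting the orbits of collapsed darts -/

omit hf in
/-- The set of orbits of collapsed darts. -/
def collapsedOrbits (f : X.V → Y.V) : Set X.DartOrbits :=
  {o | ∃ d : X.Dart, Quotient.mk _ d = o ∧ f d.1.1 = f d.1.2}

lemma mk_mem_collapsedOrbits {d : X.Dart} :
    (Quotient.mk _ d : X.DartOrbits) ∈ collapsedOrbits f ↔ f d.1.1 = f d.1.2 := by
  refine ⟨?_, fun h => ⟨d, rfl, h⟩⟩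
  rintro ⟨d', hd, h⟩
  obtain ⟨g, rfl⟩ := orbit_mk_eq.mp hd
  rw [Dart.smul_fst, Dart.smul_snd, hf.equivariant, hf.equivariant] at h
  exact smul_left_cancel g h

/-- The darts which are not collapsed correspond to the darts of the image. -/
lemma card_dartOrbits :
    Nat.card X.DartOrbits = Nat.card Y.DartOrbits + (collapsedOrbits f).ncard := by
  have hl : ∀ d : Y.Dart, ∃ d' : X.Dart, f d'.1.1 = d.1.1 ∧ f d'.1.2 = d.1.2 := fun d =>
    let ⟨x, x', hx, h1, h2, _⟩ := hf.exists_lift d.2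
    ⟨⟨(x, x'), hx⟩, h1, h2⟩
  choose l hl1 hl2 using hl
  have huniq : ∀ d d' : X.Dart, f d.1.1 = f d'.1.1 → f d.1.2 = f d'.1.2 → f d.1.1 ≠ f d.1.2 →
      d = d' := by
    intro d d' h1 h2 hne
    have hadj := (hf.simplicial _ _ d.2).resolve_left hne
    obtain ⟨x, x', -, -, -, h⟩ := hf.exists_lift hadj
    obtain ⟨h3, h4⟩ := h _ _ d.2 rfl rfl
    obtain ⟨h5, h6⟩ := h _ _ d'.2 h1.symm h2.symm
    exact Subtype.ext (Prod.ext (h3.trans h5.symm) (h4.trans h6.symm))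
  have hlne : ∀ d, f (l d).1.1 ≠ f (l d).1.2 := fun d => by
    rw [hl1, hl2]
    exact d.2.ne
  let F : Y.DartOrbits → X.DartOrbits := Quotient.map' l (by
    rintro d d' ⟨g, rfl⟩
    refine ⟨g, (huniq _ _ ?_ ?_ (hlne _)).symm⟩
    · change f (l (g • d')).1.1 = f (g • (l d').1.1)
      rw [hl1, hf.equivariant, hl1, Dart.smul_fst]
    · change f (l (g • d')).1.2 = f (g • (l d').1.2)
      rw [hl2, hf.equivariant, hl2, Dart.smul_snd])
  have hF : ∀ d, F (Quotient.mk _ d) = Quotient.mk _ (l d) := fun _ => rfl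
  have hinj : Function.Injective F := by
    intro o o'
    induction o using Quotient.inductionOn with | h d => ?_
    induction o' using Quotient.inductionOn with | h d' => ?_
    intro h
    rw [hF, hF] at h
    obtain ⟨g, hg⟩ := orbit_mk_eq.mp h
    refine orbit_mk_eq.mpr ⟨g, Subtype.ext (Prod.ext ?_ ?_)⟩
    · rw [Dart.smul_fst, ← hl1, ← hl1, ← hg, Dart.smul_fst, hf.equivariant]
    · rw [Dart.smul_snd, ← hl2, ← hl2, ← hg, Dart.smul_snd, hf.equivariant]
  have hrange : Set.range F = (collapsedOrbits f)ᶜ := by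
    ext o
    induction o using Quotient.inductionOn with | h d => ?_
    rw [Set.mem_compl_iff, hf.mk_mem_collapsedOrbits]
    constructor
    · rintro ⟨o', ho'⟩ h
      induction o' using Quotient.inductionOn with | h d' => ?_
      rw [hF] at ho'
      have := hf.mk_mem_collapsedOrbits.mpr h
      rw [← ho', hf.mk_mem_collapsedOrbits] at this
      exact hlne d' this
    · intro h
      have hadj := (hf.simplicial _ _ d.2).resolve_left h
      let d' : Y.Dart := ⟨(f d.1.1, f d.1.2), hadj⟩
      have h' : l d' = d := huniq (l d') d (hl1 d') (hl2 d') (hlne d')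
      exact ⟨Quotient.mk _ d', (hF d').trans (by rw [h'])⟩
  rw [← Set.ncard_add_ncard_compl (collapsedOrbits f), ← hrange, add_comm,
    ← Set.image_univ, Set.ncard_image_of_injective _ hinj, Set.ncard_univ]

lemma card_dartOrbits_le : Nat.card Y.DartOrbits ≤ Nat.card X.DartOrbits := by
  have := hf.card_dartOrbits
  omega

/-- A wall map which collapses no dart is injective, since its fibers are convex. -/
lemma injective_of_card (h : Nat.card X.DartOrbits = Nat.card Y.DartOrbits) :
    Function.Injective f := by
  have h0 : (collapsedOrbits f).ncard = 0 := by
    have := hf.card_dartOrbits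
    omega
  rw [Set.ncard_eq_zero] at h0
  intro a b hab
  by_contra hne
  obtain ⟨c, hc, hbc⟩ := X.isTree.exists_adj_mem_side hne
  have h1 : c ∈ X.graph.seg a b := by
    have := X.isTree.dist_eq_of_mem_side hc hbc
    rw [SimpleGraph.mem_seg, SimpleGraph.dist_eq_one_iff_adj.mpr hc]
    omega
  have h2 := hf.fiber_convex rfl hab.symm h1
  have h3 := (hf.mk_mem_collapsedOrbits (d := ⟨(a, c), hc⟩)).mpr h2.symm
  rw [h0] at h3
  exact h3

lemma adj_iff (hinj : Function.Injective f) {v w : X.V} :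
    X.graph.Adj v w ↔ Y.graph.Adj (f v) (f w) := by
  constructor
  · intro h
    exact (hf.simplicial v w h).resolve_left fun h' => h.ne (hinj h')
  · intro h
    obtain ⟨x, x', hx, h1, h2, -⟩ := hf.exists_lift h
    rwa [← hinj h1, ← hinj h2]

end IsWallMap

lemma IsWallMap.natIso {S T : FreeSplitting Γ} {hS : S.HasNat} {hT : T.HasNat}
    {f : (S.natTree hS).V → (T.natTree hT).V} (hf : IsWallMap f) (hinj : Function.Injective f) :
    NatIso S T :=
  ⟨Equiv.ofBijective (α := S.NatVert) (β := T.NatVert) f ⟨hinj, hf.surjective⟩, hf.equivariant,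
    fun _ _ => (natTree_adj hS).symm.trans ((hf.adj_iff hinj).trans (natTree_adj hT))⟩

lemma NatIso.exists_isWallMap {S T : FreeSplitting Γ} (h : NatIso S T) (hS : S.HasNat)
    (hT : T.HasNat) : ∃ f : (S.natTree hS).V → (T.natTree hT).V, IsWallMap f := by
  obtain ⟨f, h1, h2⟩ := h
  refine ⟨f, isWallMap_of_connected_fiber h1 (fun v w hvw => Or.inr ?_) fun y => ?_⟩
  · exact (natTree_adj hT).mpr ((h2 v w).mp ((natTree_adj hS).mp hvw))
  · refine (S.natTree hS).isTree.connected_induce ⟨f.symm y, f.apply_symm_apply y⟩ ?_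
    intro a ha b hb
    have hab : f a = f b := Eq.trans ha (Eq.symm hb)
    rw [f.injective hab, (S.natTree hS).isTree.seg_self, Set.singleton_subset_iff]
    exact hb

/-- `T` collapses to `S`, expressed through the trees of relatively natural vertices. -/
def NatCollapse (T S : FreeSplitting Γ) : Prop :=
  ∃ (hT : T.HasNat) (hS : S.HasNat) (f : (T.natTree hT).V → (S.natTree hS).V), IsWallMap f

lemma NatCollapse.trans (h : NatCollapse X Y) (h' : NatCollapse Y Z) : NatCollapse X Z := by
  obtain ⟨hX, hY, f, hf⟩ := h
  obtain ⟨_, hZ, f', hf'⟩ := h'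
  exact ⟨hX, hZ, f' ∘ f, hf'.comp hf⟩

lemma NatIso.natCollapse (h : NatIso X Y) (hX : X.HasNat) : NatCollapse X Y :=
  ⟨hX, h.hasNat hX, h.exists_isWallMap hX (h.hasNat hX)⟩

lemma CollapseMap.isWallMap {S T : FreeSplitting Γ} (f : CollapseMap T S) : IsWallMap f.toFun :=
  isWallMap_of_connected_fiber f.equivariant f.simplicial f.connected_fiber

/-- A wall map as a collapse map, with the trivial subdivisions. -/
def IsWallMap.toCollapseMap {f : X.V → Y.V} (hf : IsWallMap f) : CollapseMap X Y where
  dom := X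
  cod := Y
  domSubdivision := Subdivision.refl X
  codSubdivision := Subdivision.refl Y
  toFun := f
  equivariant := hf.equivariant
  simplicial := hf.simplicial
  connected_fiber := hf.connected_fiber

lemma IsWallMap.natCollapse {f : X.V → Y.V} (hf : IsWallMap f) (hY : Y.HasNat) :
    NatCollapse X Y :=
  ⟨hf.hasNat_iff.mpr hY, hY, _, hf.natMap _ _⟩

lemma CollapseMap.natCollapse {S T : FreeSplitting Γ} (f : CollapseMap T S) (hS : S.HasNat) :
    NatCollapse T S := by
  have h1 := f.codSubdivision.natIso
  have h2 := f.domSubdivision.natIso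
  have h3 := f.isWallMap.natCollapse (h1.hasNat hS)
  exact ((h2.natCollapse (h2.symm.hasNat h3.1)).trans h3).trans
    (h1.symm.natCollapse (h1.hasNat hS))

end FreeSplitting

/-! ### Relatively natural edge orbits and the relation `≺` -/

namespace FreeSplitting

variable {Γ : Type u} [Group Γ] {S T : FreeSplitting Γ}

lemma smul_seg (g : Γ) (v w : T.V) : g • T.graph.seg v w = T.graph.seg (g • v) (g • w) := by
  ext x
  rw [Set.mem_smul_set_iff_inv_smul_mem, ← smul_mem_seg g, smul_inv_smul]

lemma NatAdj.endpoints_eq {v w v' w' : T.V} (h : T.NatAdj v w) (h' : T.NatAdj v' w')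
    (heq : T.graph.seg v w = T.graph.seg v' w') : (v' = v ∧ w' = w) ∨ (v' = w ∧ w' = v) := by
  have h1 := h.2.2.2 v' (heq ▸ SimpleGraph.left_mem_seg _ _) h'.2.1
  have h2 := h.2.2.2 w' (heq ▸ SimpleGraph.right_mem_seg _ _) h'.2.2.1
  have h3 := h'.1
  rcases h1 with rfl | rfl <;> rcases h2 with rfl | rfl
  · exact absurd rfl h3
  · exact Or.inl ⟨rfl, rfl⟩
  · exact Or.inr ⟨rfl, rfl⟩
  · exact absurd rfl h3

/-- Each orbit of relatively natural edges consists of two orbits of darts of the tree of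
relatively natural vertices, as there are no inversions. This is stated for a symmetric
family `P` of relatively natural edges. -/
lemma ncard_dartOrbits_natTree (hT : T.HasNat) {P : T.V → T.V → Prop}
    (hsymm : ∀ v w, P v w → P w v) :
    (MulAction.orbit Γ '' {e | ∃ v w, T.NatAdj v w ∧ P v w ∧ e = T.graph.seg v w}).Finite ∧
    {o : (T.natTree hT).DartOrbits | ∃ d : (T.natTree hT).Dart, Quotient.mk _ d = o ∧
      P (show T.NatVert from d.1.1).1 (show T.NatVert from d.1.2).1}.ncard =
    2 * (MulAction.orbit Γ ''
      {e | ∃ v w, T.NatAdj v w ∧ P v w ∧ e = T.graph.seg v w}).ncard := by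
  classical
  set R := T.natTree hT
  let a : R.Dart → T.V := fun d => (show T.NatVert from d.1.1).1
  let b : R.Dart → T.V := fun d => (show T.NatVert from d.1.2).1
  have ha : ∀ (g : Γ) d, a (g • d) = g • a d := fun _ _ => rfl
  have hb : ∀ (g : Γ) d, b (g • d) = g • b d := fun _ _ => rfl
  have hadj : ∀ d, T.NatAdj (a d) (b d) := fun d => (natTree_adj hT).mp d.2
  have hext : ∀ d d' : R.Dart, a d = a d' → b d = b d' → d = d' := fun d d' h1 h2 =>
    Subtype.ext (Prod.ext (Subtype.ext h1) (Subtype.ext h2))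
  let β : R.DartOrbits → Set (Set T.V) :=
    Quotient.lift (fun d => MulAction.orbit Γ (T.graph.seg (a d) (b d))) (by
      rintro _ d ⟨g, rfl⟩
      change MulAction.orbit Γ (T.graph.seg (a (g • d)) (b (g • d))) = _
      rw [ha, hb, ← smul_seg, MulAction.orbit_smul])
  have hβ : ∀ d, β (Quotient.mk _ d) = MulAction.orbit Γ (T.graph.seg (a d) (b d)) := fun _ => rfl
  have hβeq : ∀ d d' : R.Dart, β (Quotient.mk _ d) = β (Quotient.mk _ d') →
      (Quotient.mk _ d : R.DartOrbits) = Quotient.mk _ d' ∨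
        (Quotient.mk _ d : R.DartOrbits) = Quotient.mk _ d'.flip := by
    intro d d' h
    rw [hβ, hβ, MulAction.orbit_eq_iff] at h
    obtain ⟨g, hg⟩ := h
    have hg' : T.graph.seg (a (g • d')) (b (g • d')) = T.graph.seg (a d) (b d) := by
      rw [ha, hb, ← smul_seg]
      exact hg
    rcases (hadj _).endpoints_eq (hadj _) hg' with ⟨h1, h2⟩ | ⟨h1, h2⟩
    · exact Or.inl (orbit_mk_eq.mpr ⟨g, hext _ _ h1.symm h2.symm⟩)
    · exact Or.inr (orbit_mk_eq.mpr ⟨g, hext _ _ h1.symm h2.symm⟩)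
  have hβflip : ∀ d : R.Dart, β (Quotient.mk _ d.flip) = β (Quotient.mk _ d) := by
    intro d
    rw [hβ, hβ, SimpleGraph.seg_comm]
    rfl
  set A := {o : R.DartOrbits | ∃ d : R.Dart, Quotient.mk _ d = o ∧ P (a d) (b d)} with hA
  have himage : MulAction.orbit Γ '' {e | ∃ v w, T.NatAdj v w ∧ P v w ∧ e = T.graph.seg v w} =
      β '' A := by
    ext c
    constructor
    · rintro ⟨_, ⟨v, w, hvw, h, rfl⟩, rfl⟩
      let d : R.Dart := ⟨(⟨v, hvw.2.1⟩, ⟨w, hvw.2.2.1⟩), (natTree_adj hT).mpr hvw⟩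
      exact ⟨Quotient.mk _ d, ⟨d, rfl, h⟩, rfl⟩
    · rintro ⟨_, ⟨d, rfl, h⟩, rfl⟩
      exact ⟨_, ⟨a d, b d, hadj d, h, rfl⟩, rfl⟩
  have hfin : (β '' A).Finite := (Set.toFinite A).image β
  rw [himage]
  refine ⟨hfin, ?_⟩
  have hAfin := Set.toFinite A
  rw [Set.ncard_eq_toFinset_card A hAfin, Set.ncard_eq_toFinset_card _ hfin,
    Finset.card_eq_sum_card_image β, mul_comm,
    show hfin.toFinset = hAfin.toFinset.image β by
      ext
      simp]
  refine Finset.sum_const_nat fun c hc => ?_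
  obtain ⟨o, ho, rfl⟩ := Finset.mem_image.mp hc
  obtain ⟨d, rfl, hd⟩ := hAfin.mem_toFinset.mp ho
  refine Finset.card_eq_two.mpr ⟨Quotient.mk _ d, Quotient.mk _ d.flip, fun h => ?_, ?_⟩
  · obtain ⟨g, hg⟩ := orbit_mk_eq.mp h.symm
    exact Dart.smul_ne_flip g d hg
  · ext o'
    rw [Finset.mem_filter, Finset.mem_insert, Finset.mem_singleton, hAfin.mem_toFinset]
    constructor
    · rintro ⟨⟨d', rfl, -⟩, h⟩
      exact hβeq d' d h
    · rintro (rfl | rfl)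
      · exact ⟨⟨d, rfl, hd⟩, rfl⟩
      · exact ⟨⟨d.flip, rfl, hsymm _ _ hd⟩, hβflip d⟩

lemma natEdgeOrbits_finite (hT : T.HasNat) : T.natEdgeOrbits.Finite := by
  have h := (ncard_dartOrbits_natTree hT (P := fun _ _ => True) (fun _ _ => id)).1
  have he : {e | ∃ v w, T.NatAdj v w ∧ True ∧ e = T.graph.seg v w} = T.natEdges := by
    ext e
    simp [mem_natEdges]
  rwa [he] at h

lemma two_mul_ncard_natEdgeOrbits (hT : T.HasNat) :
    Nat.card (T.natTree hT).DartOrbits = 2 * T.natEdgeOrbits.ncard := by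
  have h := (ncard_dartOrbits_natTree hT (P := fun _ _ => True) (fun _ _ => id)).2
  have he : {e | ∃ v w, T.NatAdj v w ∧ True ∧ e = T.graph.seg v w} = T.natEdges := by
    ext e
    simp [mem_natEdges]
  rw [he] at h
  rw [natEdgeOrbits, ← h, ← Set.ncard_univ]
  congr 1
  refine (Set.eq_univ_of_forall fun o => ?_).symm
  induction o using Quotient.inductionOn with | h d => ?_
  exact ⟨d, rfl, trivial⟩

lemma NatCollapse.ncard_le (h : NatCollapse T S) :
    S.natEdgeOrbits.ncard ≤ T.natEdgeOrbits.ncard := by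
  obtain ⟨hT, hS, f, hf⟩ := h
  have := hf.card_dartOrbits_le
  rw [two_mul_ncard_natEdgeOrbits, two_mul_ncard_natEdgeOrbits] at this
  omega

/-- A collapse which does not decrease the number of relatively natural edge orbits is an
isomorphism. -/
lemma IsWallMap.natIso_of_ncard {hT : T.HasNat} {hS : S.HasNat}
    {f : (T.natTree hT).V → (S.natTree hS).V} (hf : IsWallMap f)
    (hE : S.natEdgeOrbits.ncard = T.natEdgeOrbits.ncard) :
    Function.Injective f ∧ NatIso T S := by
  have hinj := hf.injective_of_card (by
    rw [two_mul_ncard_natEdgeOrbits, two_mul_ncard_natEdgeOrbits, hE])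
  exact ⟨hinj, hf.natIso hinj⟩

lemma NatCollapse.natIso (h : NatCollapse T S)
    (hE : S.natEdgeOrbits.ncard = T.natEdgeOrbits.ncard) : NatIso T S := by
  obtain ⟨hT, hS, f, hf⟩ := h
  exact (hf.natIso_of_ncard hE).2

lemma NatIso.ncard_natEdgeOrbits_eq (h : NatIso S T) (hS : S.HasNat) :
    S.natEdgeOrbits.ncard = T.natEdgeOrbits.ncard :=
  le_antisymm (h.symm.natCollapse (h.hasNat hS)).ncard_le (h.natCollapse hS).ncard_le

/-- A collapse map decreases the number of orbits of relatively natural edges by the number of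
orbits of collapsed edges. -/
lemma CollapseMap.ncard_natEdgeOrbits (f : CollapseMap T S) (hS : S.HasNat) :
    T.natEdgeOrbits.ncard =
      S.natEdgeOrbits.ncard + (MulAction.orbit Γ '' f.collapsedEdges).ncard := by
  have hf := f.isWallMap
  have hcS := f.codSubdivision.natIso
  have hcod := hcS.hasNat hS
  have hdom := hf.hasNat_iff.mpr hcod
  have hcT := f.domSubdivision.natIso
  rw [hcT.ncard_natEdgeOrbits_eq (hcT.symm.hasNat hdom), hcS.ncard_natEdgeOrbits_eq hS]
  have h1 := (hf.natMap hdom hcod).card_dartOrbits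
  rw [two_mul_ncard_natEdgeOrbits, two_mul_ncard_natEdgeOrbits] at h1
  have h2 := (ncard_dartOrbits_natTree hdom (P := fun v w => f.toFun v = f.toFun w)
    (fun _ _ => Eq.symm)).2
  have h3 : {e | ∃ v w, f.dom.NatAdj v w ∧ f.toFun v = f.toFun w ∧ e = f.dom.graph.seg v w} =
      f.collapsedEdges := by
    ext e
    rw [collapsedEdges, Set.mem_ofPred_eq, Set.mem_ofPred_eq, mem_natEdges]
    constructor
    · rintro ⟨v, w, hvw, h, rfl⟩
      refine ⟨⟨v, w, hvw, rfl⟩, fun x hx y hy => ?_⟩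
      rw [hf.fiber_convex rfl h.symm hx, hf.fiber_convex rfl h.symm hy]
    · rintro ⟨⟨v, w, hvw, rfl⟩, h⟩
      exact ⟨v, w, hvw, h _ (SimpleGraph.left_mem_seg _ _) _ (SimpleGraph.right_mem_seg _ _), rfl⟩
  rw [h3] at h2
  have h4 : {o : (f.dom.natTree hdom).DartOrbits | ∃ d : (f.dom.natTree hdom).Dart,
      Quotient.mk _ d = o ∧ f.toFun (show f.dom.NatVert from d.1.1).1 =
        f.toFun (show f.dom.NatVert from d.1.2).1} =
      IsWallMap.collapsedOrbits (X := f.dom.natTree hdom) (Y := f.cod.natTree hcod)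
        (fun v : f.dom.NatVert => (⟨f.toFun v.1, hf.isNatVertex v.2⟩ : f.cod.NatVert)) := by
    ext o
    refine exists_congr fun d => and_congr_right fun _ => ?_
    exact ⟨fun h => Subtype.ext h, fun h => congrArg Subtype.val h⟩
  rw [h4] at h2
  omega

/-- The relation `≺` of classes, for arbitrary representatives. -/
lemma prec_iff (hS : S.HasNat) : Prec S.cls T.cls ↔ NatCollapse T S := by
  constructor
  · rintro ⟨S', T', h1, h2, ⟨f⟩⟩
    have h1' := natIso_of_cls_eq h1
    have h2' := natIso_of_cls_eq h2
    have h3 := f.natCollapse (h1'.symm.hasNat hS)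
    exact ((h2'.symm.natCollapse (h2'.hasNat h3.choose)).trans h3).trans
      (h1'.natCollapse (h1'.symm.hasNat hS))
  · rintro ⟨hT, hS, f, hf⟩
    exact ⟨S.natTree hS, T.natTree hT, natTree_cls hS, natTree_cls hT, ⟨hf.toCollapseMap⟩⟩

/-- Between trees all of whose vertices are relatively natural, every wall map is a relatively
natural collapse map. -/
lemma IsWallMap.isRelNatural {f : T.V → S.V} (hf : IsWallMap f) (hT : ∀ v, T.IsNatVertex v) :
    hf.toCollapseMap.IsRelNatural := by
  intro (x : T.V) (y : T.V) (hxy : T.graph.Adj x y) (h : f x = f y)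
  have hseg := T.isTree.seg_eq_pair_of_adj hxy
  have hadj : T.NatAdj x y := ⟨hxy.ne, hT x, hT y, fun z hz _ => by rwa [hseg] at hz⟩
  refine ⟨T.graph.seg x y, ⟨mem_natEdges.mpr ⟨x, y, hadj, rfl⟩, fun a ha b hb => ?_⟩,
    SimpleGraph.left_mem_seg _ _, SimpleGraph.right_mem_seg _ _⟩
  exact (hf.fiber_convex rfl h.symm ha).trans (hf.fiber_convex rfl h.symm hb).symm

end FreeSplitting

/-! ### Integration on trees and extension of homomorphisms -/

/-- On a tree, every antisymmetric function on darts with values in a group is the coboundary of a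
function on vertices. -/
lemma SimpleGraph.IsTree.exists_potential {V K : Type*} [Group K] {G : SimpleGraph V}
    (hG : G.IsTree) (η : V → V → K) (hη : ∀ v w, G.Adj v w → η w v = (η v w)⁻¹) :
    ∃ μ : V → K, ∀ v w, G.Adj v w → μ w = μ v * η v w := by
  classical
  obtain ⟨r⟩ := hG.connected.nonempty
  have hp : ∀ v, ∃ p, v ≠ r → G.Adj v p ∧ r ∈ G.side p v := by
    intro v
    by_cases hv : v = r
    · exact ⟨v, fun h => absurd hv h⟩
    · obtain ⟨p, hp⟩ := hG.exists_adj_mem_side hv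
      exact ⟨p, fun _ => hp⟩
  choose par hpar using hp
  let F : ℕ → V → K := fun n => Nat.rec (fun _ => 1)
    (fun _ f v => if v = r then 1 else f (par v) * η (par v) v) n
  have hF : ∀ n v, F (n + 1) v = if v = r then 1 else F n (par v) * η (par v) v := fun _ _ => rfl
  have hrec : ∀ v, v ≠ r →
      F (G.dist v r) v = F (G.dist (par v) r) (par v) * η (par v) v := by
    intro v hv
    rw [hG.dist_eq_of_mem_side (hpar v hv).1 (hpar v hv).2, hF, if_neg hv]
  have key : ∀ v w, G.Adj v w → r ∈ G.side v w → F (G.dist w r) w = F (G.dist v r) v * η v w := by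
    intro v w h hr
    have hw : w ≠ r := by
      rintro rfl
      exact hG.right_notMem_side h hr
    rw [hrec w hw, hG.eq_of_mem_side (hpar w hw).1 h.symm (hpar w hw).2 hr]
  refine ⟨fun v => F (G.dist v r) v, fun v w h => ?_⟩
  by_cases hr : r ∈ G.side v w
  · exact key v w h hr
  · have := key w v h.symm ((hG.mem_side_symm h).mpr hr)
    simp only [this, hη v w h, inv_mul_cancel_right]

namespace FreeSplitting

variable {Γ : Type u} [Group Γ] {T : FreeSplitting Γ}

lemma exists_smul_out {X : Type*} [MulAction Γ X] (x : X) :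
    ∃ g : Γ, g • (Quotient.mk _ x : MulAction.orbitRel.Quotient Γ X).out = x :=
  orbit_mk_eq.mp (Quotient.out_eq _).symm

/-- As darts have trivial stabilizers, the group elements which move the chosen representatives of
the orbits of darts to given darts depend equivariantly on the darts. -/
lemma exists_transporter (T : FreeSplitting Γ) : ∃ γ : T.Dart → Γ,
    (∀ d, γ d • (Quotient.mk _ d : T.DartOrbits).out = d) ∧ ∀ g d, γ (g • d) = g * γ d := by
  choose γ hγ using fun d : T.Dart => exists_smul_out (Γ := Γ) d
  refine ⟨γ, hγ, fun g d => ?_⟩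
  have h1 : (Quotient.mk _ (g • d) : T.DartOrbits) = Quotient.mk _ d := orbit_mk_eq.mpr ⟨g, rfl⟩
  refine Dart.smul_left_cancel (d := (Quotient.mk _ d : T.DartOrbits).out) ?_
  have := hγ (g • d)
  rw [h1] at this
  rw [this, mul_smul, hγ]

/-- Homomorphisms from a vertex group extend, up to conjugation, to the whole group, in such a way
that the vertex groups in other orbits are killed. This is the part of Bass-Serre theory
which says that vertex groups are free factors. The homomorphism `Φ g = μ (g v) a(g, v) μ(v)⁻¹` is
a trivialization of a cocycle `a` of the action of `Γ` on the vertices: `a` is a coboundary over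
the darts, where the action is free, and the primitive is integrated over the tree. -/
lemma exists_extension (v₁ : T.V) {K : Type*} [Group K] (φ : MulAction.stabilizer Γ v₁ →* K) :
    ∃ (Φ : Γ →* K) (c : K), (∀ h : MulAction.stabilizer Γ v₁, Φ h = c * φ h * c⁻¹) ∧
      ∀ w, w ∉ MulAction.orbit Γ v₁ → ∀ g ∈ MulAction.stabilizer Γ w, Φ g = 1 := by
  classical
  let φ' : Γ → K := fun g => if h : g ∈ MulAction.stabilizer Γ v₁ then φ ⟨g, h⟩ else 1
  have hφ' : ∀ h : MulAction.stabilizer Γ v₁, φ' h = φ h := fun h => dif_pos h.2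
  have hmul : ∀ g ∈ MulAction.stabilizer Γ v₁, ∀ h ∈ MulAction.stabilizer Γ v₁,
      φ' (g * h) = φ' g * φ' h := by
    intro g hg h hh
    rw [hφ' ⟨g, hg⟩, hφ' ⟨h, hh⟩, ← map_mul]
    exact hφ' (⟨g, hg⟩ * ⟨h, hh⟩)
  have hσ : ∀ v, ∃ s : Γ, v ∈ MulAction.orbit Γ v₁ → s • v₁ = v := by
    intro v
    by_cases hv : v ∈ MulAction.orbit Γ v₁
    · exact hv.imp fun s hs _ => hs
    · exact ⟨1, fun h => absurd h hv⟩
  choose σ hσ using hσ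
  let a : Γ → T.V → K := fun g v =>
    if v ∈ MulAction.orbit Γ v₁ then φ' ((σ (g • v))⁻¹ * g * σ v) else 1
  have horb : ∀ (g : Γ) v, g • v ∈ MulAction.orbit Γ v₁ ↔ v ∈ MulAction.orbit Γ v₁ := fun g v =>
    ⟨fun h => by simpa using MulAction.mem_orbit_of_mem_orbit g⁻¹ h,
      fun h => MulAction.mem_orbit_of_mem_orbit g h⟩
  have hstab : ∀ (g : Γ) v, v ∈ MulAction.orbit Γ v₁ →
      (σ (g • v))⁻¹ * g * σ v ∈ MulAction.stabilizer Γ v₁ := by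
    intro g v hv
    rw [MulAction.mem_stabilizer_iff, mul_smul, mul_smul, hσ v hv, inv_smul_eq_iff,
      hσ _ ((horb g v).mpr hv)]
  -- `a` is a cocycle of the action groupoid of the vertices
  have ha : ∀ (g h : Γ) v, a (g * h) v = a g (h • v) * a h v := by
    intro g h v
    by_cases hv : v ∈ MulAction.orbit Γ v₁
    · simp only [a, if_pos hv, if_pos ((horb h v).mpr hv)]
      rw [← hmul _ (hstab g _ ((horb h v).mpr hv)) _ (hstab h v hv)]
      congr 1
      rw [mul_smul]
      group
    · simp only [a, if_neg hv, if_neg fun h' => hv ((horb h v).mp h'), mul_one]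
  obtain ⟨γ, hγ, hγg⟩ := exists_transporter T
  -- over the darts, where the action is free, `a` is the coboundary of `β`
  let β : T.Dart → K := fun d => a (γ d) (Quotient.mk _ d : T.DartOrbits).out.1.1
  have hβ : ∀ (g : Γ) d, β (g • d) = a g d.1.1 * β d := by
    intro g d
    have h1 : (Quotient.mk _ (g • d) : T.DartOrbits) = Quotient.mk _ d := orbit_mk_eq.mpr ⟨g, rfl⟩
    simp only [β, h1, hγg, ha]
    congr 2
    exact congrArg (fun d : T.Dart => d.1.1) (hγ d)
  -- the values of `β` at both ends of an edge are compared along the tree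
  let η : T.V → T.V → K := fun v w =>
    if h : T.graph.Adj v w then β ⟨(v, w), h⟩ * (β ⟨(w, v), h.symm⟩)⁻¹ else 1
  have hη : ∀ v w (h : T.graph.Adj v w), η v w = β ⟨(v, w), h⟩ * (β ⟨(w, v), h.symm⟩)⁻¹ :=
    fun v w h => dif_pos h
  have hηg : ∀ (g : Γ) v w, T.graph.Adj v w → η (g • v) (g • w) = a g v * η v w * (a g w)⁻¹ := by
    intro g v w h
    rw [hη _ _ (T.smul_adj g h), hη v w h]
    have h1 := hβ g ⟨(v, w), h⟩
    have h2 := hβ g ⟨(w, v), h.symm⟩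
    change β ⟨(g • v, g • w), T.smul_adj g h⟩ = _ at h1
    change β ⟨(g • w, g • v), T.smul_adj g h.symm⟩ = _ at h2
    rw [h1, h2]
    group
  obtain ⟨μ, hμ⟩ := T.isTree.exists_potential η fun v w h => by
    rw [hη v w h, hη w v h.symm]
    group
  obtain ⟨v₀⟩ : Nonempty T.V := inferInstance
  let Φ : Γ → K := fun g => μ (g • v₀) * a g v₀ * (μ v₀)⁻¹
  have hΦ : ∀ g v, μ (g • v) * a g v * (μ v)⁻¹ = Φ g := by
    intro g
    refine T.isTree.connected.eq_univ_of_closed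
      (A := {v | μ (g • v) * a g v * (μ v)⁻¹ = Φ g}) (a := v₀) rfl ?_
    intro v w h (hv : _ = _)
    change _ = _
    rw [hμ v w h, hμ _ _ (T.smul_adj g h), hηg g v w h, ← hv]
    group
  refine ⟨MonoidHom.mk' Φ fun g h => ?_, μ v₁ * (φ' (σ v₁))⁻¹, fun h => ?_, fun w hw g hg => ?_⟩
  · rw [← hΦ g (h • v₀)]
    simp only [Φ, mul_smul, ha]
    group
  · have hv₁ := MulAction.mem_orbit_self (M := Γ) v₁
    have hs : σ v₁ ∈ MulAction.stabilizer Γ v₁ := hσ v₁ hv₁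
    have hh : (h : Γ) • v₁ = v₁ := h.2
    have h1 : a h v₁ = (φ' (σ v₁))⁻¹ * φ h * φ' (σ v₁) := by
      simp only [a, if_pos hv₁, hh]
      have h2 := hmul _ hs _ (mul_mem (mul_mem (inv_mem hs) h.2) hs)
      rw [show σ v₁ * ((σ v₁)⁻¹ * (h : Γ) * σ v₁) = h * σ v₁ by group, hmul _ h.2 _ hs, hφ' h] at h2
      rw [mul_assoc (φ' (σ v₁))⁻¹, h2, inv_mul_cancel_left]
    change Φ h = _
    rw [← hΦ h v₁, hh, h1]
    group
  · change Φ g = 1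
    have hg' : g • w = w := hg
    rw [← hΦ g w, hg']
    simp only [a, if_neg hw]
    group

/-! ### The Euler characteristic -/

variable (Γ) in
/-- The homomorphisms from `Γ` to `ℤ/2` which vanish on the given set. -/
def homsVanishing (A : Set Γ) : Submodule (ZMod 2) (Γ → ZMod 2) where
  carrier := {d | (∀ g h, d (g * h) = d g + d h) ∧ ∀ g ∈ A, d g = 0}
  add_mem' := by
    rintro c d ⟨hc, hc'⟩ ⟨hd, hd'⟩
    refine ⟨fun g h => ?_, fun g hg => ?_⟩
    · simp only [Pi.add_apply, hc, hd]
      ring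
    · simp [hc' g hg, hd' g hg]
  zero_mem' := by simp
  smul_mem' := by
    rintro c d ⟨hd, hd'⟩
    refine ⟨fun g h => ?_, fun g hg => ?_⟩
    · simp only [Pi.smul_apply, hd, smul_add]
    · simp [hd' g hg]

lemma homsVanishing_one {A : Set Γ} {d : Γ → ZMod 2} (hd : d ∈ homsVanishing Γ A) : d 1 = 0 := by
  have := hd.1 1 1
  rw [mul_one] at this
  exact left_eq_add.mp this

lemma homsVanishing_inv {A : Set Γ} {d : Γ → ZMod 2} (hd : d ∈ homsVanishing Γ A) (g : Γ) :
    d g⁻¹ = - d g := by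
  have := hd.1 g⁻¹ g
  rw [inv_mul_cancel, homsVanishing_one hd] at this
  exact eq_neg_of_add_eq_zero_left this.symm

lemma homsVanishing_mono {A B : Set Γ} (h : A ⊆ B) : homsVanishing Γ B ≤ homsVanishing Γ A :=
  fun _ hd => ⟨hd.1, fun g hg => hd.2 g (h hg)⟩

variable (T) in
/-- The set of all elements which fix a vertex. -/
def elliptic : Set Γ := {g | ∃ v : T.V, g • v = v}

variable (T) in
/-- The functions on vertices with invariant coboundary. -/
def potentials : Submodule (ZMod 2) (T.V → ZMod 2) where
  carrier := {m | ∀ (g : Γ) v w, m (g • v) - m v = m (g • w) - m w}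
  add_mem' := by
    intro m n hm hn g v w
    have h1 := hm g v w
    have h2 := hn g v w
    simp only [Pi.add_apply]
    linear_combination h1 + h2
  zero_mem' := by simp
  smul_mem' := by
    intro c m hm g v w
    simp only [Pi.smul_apply, ← smul_sub, hm g v w]

/-- A fixed point free involution of a finite set has a fundamental domain with half of the
elements. -/
lemma exists_half {D : Type*} [Finite D] (τ : D → D) (hτ : ∀ o, τ (τ o) = o) (hne : ∀ o, τ o ≠ o) :
    ∃ P : Set D, (∀ o, τ o ∈ P ↔ o ∉ P) ∧ Nat.card D = 2 * P.ncard := by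
  obtain ⟨n, ⟨e⟩⟩ := Finite.exists_equiv_fin D
  have hP : ∀ o, τ o ∈ {o | e o < e (τ o)} ↔ o ∉ {o | e o < e (τ o)} := by
    intro o
    simp only [Set.mem_ofPred_eq, hτ, not_lt]
    exact ⟨fun h => h.le, fun h => lt_of_le_of_ne h fun h' => hne o (e.injective h')⟩
  refine ⟨_, hP, ?_⟩
  set P := {o | e o < e (τ o)}
  have himage : τ '' P = Pᶜ := by
    ext o
    constructor
    · rintro ⟨o', ho', rfl⟩
      rw [Set.mem_compl_iff, hP]
      exact not_not.mpr ho'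
    · intro ho
      exact ⟨τ o, (hP o).mpr ho, hτ o⟩
  have hinj : Function.Injective τ := fun a b h => by rw [← hτ a, h, hτ]
  rw [← Set.ncard_add_ncard_compl P, ← himage, Set.ncard_image_of_injective _ hinj, two_mul]

variable (T) in
/-- The Euler characteristic formula: with `E` and `V` the numbers of orbits of edges and vertices
and `b` the dimension of the space of homomorphisms to `ℤ/2` which vanish on vertex groups,
`E + 1 = V + b`. Both sides are the dimension of the space of functions on vertices with invariant
coboundary. -/
lemma euler : Module.Finite (ZMod 2) (homsVanishing Γ T.elliptic) ∧
    ∃ E : ℕ, Nat.card T.DartOrbits = 2 * E ∧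
      E + 1 = Nat.card T.VertOrbits + Module.finrank (ZMod 2) (homsVanishing Γ T.elliptic) := by
  classical
  let τ : T.DartOrbits → T.DartOrbits := Quotient.map' Dart.flip (by
    rintro _ d ⟨g, rfl⟩
    exact ⟨g, rfl⟩)
  have hτmk : ∀ d : T.Dart, τ (Quotient.mk _ d) = Quotient.mk _ d.flip := fun _ => rfl
  obtain ⟨P, hP, hcard⟩ := exists_half τ
    (fun o => by
      induction o using Quotient.inductionOn with | h d => ?_
      rw [hτmk, hτmk, Dart.flip_flip])
    (fun o => by
      induction o using Quotient.inductionOn with | h d => ?_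
      rw [hτmk]
      intro h
      obtain ⟨g, hg⟩ := orbit_mk_eq.mp h
      exact Dart.smul_ne_flip g d hg)
  obtain ⟨v₀⟩ : Nonempty T.V := inferInstance
  have hchar : ∀ x : ZMod 2, -x = x := ZMod.neg_eq_self_mod_two
  -- a potential is determined by its value at one vertex and its coboundary
  let δ : T.potentials → T.DartOrbits → ZMod 2 := fun m =>
    Quotient.lift (fun d => m.1 d.1.2 - m.1 d.1.1) (by
      rintro _ d ⟨g, rfl⟩
      have := m.2 g d.1.2 d.1.1
      change m.1 (g • d.1.2) - m.1 (g • d.1.1) = _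
      linear_combination this)
  have hδ : ∀ m d, δ m (Quotient.mk _ d) = m.1 d.1.2 - m.1 d.1.1 := fun _ _ => rfl
  have hadd : ∀ m n o, δ (m + n) o = δ m o + δ n o := by
    intro m n o
    induction o using Quotient.inductionOn with | h d => ?_
    change (m.1 _ + n.1 _) - (m.1 _ + n.1 _) = (m.1 _ - m.1 _) + (n.1 _ - n.1 _)
    ring
  have hsmul : ∀ (c : ZMod 2) m o, δ (c • m) o = c * δ m o := by
    intro c m o
    induction o using Quotient.inductionOn with | h d => ?_
    change c * m.1 _ - c * m.1 _ = c * (m.1 _ - m.1 _)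
    ring
  let f₁ : T.potentials →ₗ[ZMod 2] ZMod 2 × (P → ZMod 2) :=
    { toFun := fun m => (m.1 v₀, fun o => δ m o.1)
      map_add' := fun m n => Prod.ext rfl (funext fun o => hadd m n o.1)
      map_smul' := fun c m => Prod.ext rfl (funext fun o => hsmul c m o.1) }
  have hf₁ : Function.Bijective f₁ := by
    constructor
    · rw [← LinearMap.ker_eq_bot, LinearMap.ker_eq_bot']
      intro m hm
      have h0 : m.1 v₀ = 0 := congrArg Prod.fst hm
      have h1 : ∀ o ∈ P, δ m o = 0 := fun o ho => congrFun (congrArg Prod.snd hm) ⟨o, ho⟩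
      refine Subtype.ext (funext ?_)
      refine T.isTree.connected.eq_univ_of_closed (A := {v | m.1 v = 0}) h0 ?_
      intro v w h (hv : m.1 v = 0)
      change m.1 w = 0
      by_cases ho : (Quotient.mk _ ⟨(v, w), h⟩ : T.DartOrbits) ∈ P
      · have := h1 _ ho
        change m.1 w - m.1 v = 0 at this
        rwa [hv, sub_zero] at this
      · have := h1 _ ((hP _).mpr ho)
        change m.1 v - m.1 w = 0 at this
        rwa [hv, zero_sub, neg_eq_zero] at this
    · rintro ⟨x, c⟩
      let c' : T.DartOrbits → ZMod 2 := fun o =>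
        if h : o ∈ P then c ⟨o, h⟩ else if h : τ o ∈ P then c ⟨τ o, h⟩ else 0
      have hc' : ∀ d : T.Dart, c' (Quotient.mk _ d.flip) = c' (Quotient.mk _ d) := by
        intro d
        have h2 : τ (Quotient.mk _ d.flip) = Quotient.mk _ d := rfl
        have h3 := hP (Quotient.mk _ d)
        rw [hτmk] at h3
        by_cases ho : (Quotient.mk _ d : T.DartOrbits) ∈ P
        · simp only [c', dif_neg fun h => h3.mp h ho, h2, dif_pos ho]
        · simp only [c', dif_pos (h3.mpr ho), dif_neg ho, hτmk]
      obtain ⟨μ, hμ⟩ := T.isTree.exists_potential (K := Multiplicative (ZMod 2))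
        (fun v w => if h : T.graph.Adj v w then
          Multiplicative.ofAdd (c' (Quotient.mk _ ⟨(v, w), h⟩)) else 1)
        (fun v w h => by
          rw [dif_pos h, dif_pos h.symm, ← ofAdd_neg, hchar]
          exact congrArg _ (hc' ⟨(v, w), h⟩))
      have hμ' : ∀ v w (h : T.graph.Adj v w), (μ w).toAdd - (μ v).toAdd =
          c' (Quotient.mk _ ⟨(v, w), h⟩) := by
        intro v w h
        rw [hμ v w h, dif_pos h, toAdd_mul, toAdd_ofAdd, add_sub_cancel_left]
      have hm : (fun v => (μ v).toAdd - (μ v₀).toAdd + x) ∈ T.potentials := by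
        intro g v w
        have key : ∀ v, (μ (g • v)).toAdd - (μ v).toAdd = (μ (g • v₀)).toAdd - (μ v₀).toAdd := by
          refine T.isTree.connected.eq_univ_of_closed (A := {v | (μ (g • v)).toAdd - (μ v).toAdd =
            (μ (g • v₀)).toAdd - (μ v₀).toAdd}) (a := v₀) rfl ?_
          intro v w h (hv : _ = _)
          change _ = _
          have e1 := hμ' v w h
          have e2 := hμ' _ _ (T.smul_adj g h)
          have e3 : (Quotient.mk _ ⟨(g • v, g • w), T.smul_adj g h⟩ : T.DartOrbits) =
            Quotient.mk _ ⟨(v, w), h⟩ := orbit_mk_eq.mpr ⟨g, rfl⟩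
          rw [e3] at e2
          linear_combination hv + e2 - e1
        have h1 := key v
        have h2 := key w
        linear_combination h1 - h2
      refine ⟨⟨_, hm⟩, Prod.ext ?_ (funext fun ⟨o, ho⟩ => ?_)⟩
      · change (μ v₀).toAdd - (μ v₀).toAdd + x = x
        ring
      · induction o using Quotient.inductionOn with | h d => ?_
        have h1 : _ = c' (Quotient.mk _ d) := hμ' _ _ d.2
        change ((μ d.1.2).toAdd - (μ v₀).toAdd + x) - ((μ d.1.1).toAdd - (μ v₀).toAdd + x) = _
        have h2 : c' (Quotient.mk _ d) = c ⟨Quotient.mk _ d, ho⟩ := dif_pos ho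
        refine Eq.trans ?_ h2
        linear_combination h1
  -- a potential is determined by its associated homomorphism and its values on representatives
  let f₂ : T.potentials →ₗ[ZMod 2] homsVanishing Γ T.elliptic × (T.VertOrbits → ZMod 2) :=
    { toFun := fun m => (⟨fun g => m.1 (g • v₀) - m.1 v₀, by
          constructor
          · intro g h
            have := m.2 g (h • v₀) v₀
            change m.1 ((g * h) • v₀) - m.1 v₀ = (m.1 (g • v₀) - m.1 v₀) + (m.1 (h • v₀) - m.1 v₀)
            rw [mul_smul]
            linear_combination this
          · rintro g ⟨v, hv⟩
            have := m.2 g v₀ v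
            change m.1 (g • v₀) - m.1 v₀ = 0
            rw [this, hv, sub_self]⟩, fun o => m.1 o.out)
      map_add' := fun m n => by
        refine Prod.ext (Subtype.ext (funext fun g => ?_)) rfl
        change (m.1 _ + n.1 _) - (m.1 _ + n.1 _) = (m.1 _ - m.1 _) + (n.1 _ - n.1 _)
        ring
      map_smul' := fun c m => by
        refine Prod.ext (Subtype.ext (funext fun g => ?_)) rfl
        change c * m.1 _ - c * m.1 _ = c * (m.1 _ - m.1 _)
        ring }
  choose γ hγ using fun v : T.V => exists_smul_out (Γ := Γ) v
  have hf₂ : Function.Bijective f₂ := by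
    constructor
    · rw [← LinearMap.ker_eq_bot, LinearMap.ker_eq_bot']
      intro m hm
      have h0 : ∀ g : Γ, m.1 (g • v₀) - m.1 v₀ = 0 := fun g =>
        congrFun (congrArg Subtype.val (congrArg Prod.fst hm)) g
      have h1 : ∀ o : T.VertOrbits, m.1 o.out = 0 := fun o => congrFun (congrArg Prod.snd hm) o
      refine Subtype.ext (funext fun v => ?_)
      have h2 := m.2 (γ v) (Quotient.mk _ v : T.VertOrbits).out v₀
      rw [hγ, h0, h1, sub_zero] at h2
      exact h2
    · rintro ⟨⟨d, hd⟩, c⟩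
      have hm : ∀ (g : Γ) (v : T.V), (d (γ (g • v)) + c (Quotient.mk _ (g • v))) -
          (d (γ v) + c (Quotient.mk _ v)) = d g := by
        intro g v
        have h1 : (Quotient.mk _ (g • v) : T.VertOrbits) = Quotient.mk _ v :=
          orbit_mk_eq.mpr ⟨g, rfl⟩
        have h2 : d ((γ (g • v))⁻¹ * g * γ v) = 0 := by
          refine hd.2 _ ⟨(Quotient.mk _ v : T.VertOrbits).out, ?_⟩
          have h3 := hγ (g • v)
          rw [h1] at h3
          rw [mul_smul, mul_smul, hγ, inv_smul_eq_iff, h3]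
        rw [hd.1, hd.1, homsVanishing_inv hd] at h2
        rw [h1]
        linear_combination -h2
      refine ⟨⟨fun v => d (γ v) + c (Quotient.mk _ v), fun g v w => by rw [hm, hm]⟩,
        Prod.ext (Subtype.ext (funext fun g => hm g v₀)) (funext fun o => ?_)⟩
      change d (γ o.out) + c (Quotient.mk _ o.out) = c o
      have h1 : d (γ o.out) = 0 := by
        refine hd.2 _ ⟨o.out, ?_⟩
        have h2 := hγ o.out
        rwa [o.out_eq] at h2
      rw [h1, zero_add, o.out_eq]
  have e₁ := LinearEquiv.ofBijective f₁ hf₁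
  have e₂ := LinearEquiv.ofBijective f₂ hf₂
  have : Fintype P := Fintype.ofFinite _
  have : Fintype T.VertOrbits := Fintype.ofFinite _
  have hfin : Module.Finite (ZMod 2) (homsVanishing Γ T.elliptic × (T.VertOrbits → ZMod 2)) :=
    Module.Finite.equiv (e₁.symm.trans e₂)
  have hfin' : Module.Finite (ZMod 2) (homsVanishing Γ T.elliptic) :=
    Module.Finite.of_surjective (LinearMap.fst (ZMod 2) _ (T.VertOrbits → ZMod 2))
      LinearMap.fst_surjective
  refine ⟨hfin', P.ncard, hcard, ?_⟩
  have h1 := (e₁.symm.trans e₂).finrank_eq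
  rw [Module.finrank_prod, Module.finrank_prod, Module.finrank_self, Module.finrank_pi,
    Module.finrank_pi, ← Nat.card_eq_fintype_card, ← Nat.card_eq_fintype_card,
    Nat.card_coe_set_eq] at h1
  omega

end FreeSplitting

/-! ### Free factor systems -/

section FreeProducts

variable {Γ : Type u} [Group Γ]

namespace IsInternalFreeProduct

variable {ι : Type*} {H : ι → Subgroup Γ} {K : Type*} [Group K]

lemma exists_lift (h : IsInternalFreeProduct H) (f : ∀ i, H i →* K) :
    ∃ F : Γ →* K, ∀ i (x : H i), F x = f i x := by
  refine ⟨(Monoid.CoprodI.lift f).comp (MulEquiv.ofBijective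
    (Monoid.CoprodI.lift fun i => (H i).subtype) h).symm.toMonoidHom, fun i x => ?_⟩
  have h1 : (MulEquiv.ofBijective (Monoid.CoprodI.lift fun i => (H i).subtype) h).symm (x : Γ) =
      Monoid.CoprodI.of (M := fun i => H i) x := by
    rw [MulEquiv.symm_apply_eq]
    exact (Monoid.CoprodI.lift_of (fun i => (H i).subtype) x).symm
  change Monoid.CoprodI.lift f ((MulEquiv.ofBijective (Monoid.CoprodI.lift _) h).symm (x : Γ)) = _
  rw [h1, Monoid.CoprodI.lift_of]

lemma hom_ext (h : IsInternalFreeProduct H) {F G : Γ →* K}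
    (hFG : ∀ i, ∀ x ∈ H i, F x = G x) : F = G := by
  have h1 : F.comp (Monoid.CoprodI.lift fun i => (H i).subtype) =
      G.comp (Monoid.CoprodI.lift fun i => (H i).subtype) := by
    refine Monoid.CoprodI.ext_hom _ _ fun i => MonoidHom.ext fun x => ?_
    simpa using hFG i x x.2
  ext g
  obtain ⟨w, rfl⟩ := h.2 g
  exact DFunLike.congr_fun h1 w

/-- Nontrivial elements of two different factors do not commute. -/
lemma mul_ne_mul (h : IsInternalFreeProduct H) {i j : ι} (hij : i ≠ j) {a b : Γ} (ha : a ∈ H i)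
    (hb : b ∈ H j) (ha1 : a ≠ 1) (hb1 : b ≠ 1) : a * b ≠ b * a := by
  classical
  intro hab
  have ha' : (⟨a, ha⟩ : H i) ≠ 1 := fun h => ha1 (congrArg Subtype.val h)
  have hb' : (⟨b, hb⟩ : H j) ≠ 1 := fun h => hb1 (congrArg Subtype.val h)
  let w₁ : Monoid.CoprodI.NeWord (fun i => H i) i j := .append (.singleton _ ha') hij (.singleton _ hb')
  let w₂ : Monoid.CoprodI.NeWord (fun i => H i) j i :=
    .append (.singleton _ hb') hij.symm (.singleton _ ha')
  have h1 : w₁.prod = w₂.prod := by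
    apply h.1
    simpa [w₁, w₂] using hab
  have h2 : w₁.toWord = w₂.toWord := Monoid.CoprodI.Word.equiv.symm.injective h1
  have h3 := congrArg (fun w => w.toList.head?.map Sigma.fst) h2
  have h4 : some i = some j := h3
  exact hij (Option.some.inj h4)

end IsInternalFreeProduct

lemma FreelyDecomposable.exists_mul_ne_mul (h : FreelyDecomposable Γ) :
    ∃ a b : Γ, a * b ≠ b * a := by
  obtain ⟨A, B, hA, hB, h⟩ := h
  obtain ⟨a, ha⟩ := Subgroup.ne_bot_iff_exists_ne_one.mp hA
  obtain ⟨b, hb⟩ := Subgroup.ne_bot_iff_exists_ne_one.mp hB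
  exact ⟨a, b, h.mul_ne_mul (i := 0) (j := 1) (by simp) a.2 b.2 (fun h => ha (Subtype.ext h))
    (fun h => hb (Subtype.ext h))⟩

lemma conjClassOf_eq_iff {H H' : Subgroup Γ} :
    conjClassOf H = conjClassOf H' ↔ ∃ g : Γ, ∀ x, x ∈ H ↔ g⁻¹ * x * g ∈ H' := by
  have key : ∀ (g : ConjAct Γ) x, x ∈ g • H' ↔
      (ConjAct.ofConjAct g)⁻¹ * x * ConjAct.ofConjAct g ∈ H' := by
    intro g x
    rw [Subgroup.mem_pointwise_smul_iff_inv_smul_mem, ConjAct.smul_def, ConjAct.ofConjAct_inv,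
      inv_inv]
  refine FreeSplitting.orbit_mk_eq.trans ⟨?_, ?_⟩
  · rintro ⟨g, rfl⟩
    exact ⟨_, key g⟩
  · rintro ⟨g, hg⟩
    exact ⟨ConjAct.toConjAct g, Subgroup.ext fun x => (key _ x).trans (hg x).symm⟩

end FreeProducts

namespace FreeFactorSystem

variable {Γ : Type u} [Group Γ] (𝒜 : FreeFactorSystem Γ)

/-- The union of all subgroups which represent an element of `𝒜`. -/
def elements : Set Γ := {g : Γ | ∃ H : Subgroup Γ, conjClassOf H ∈ 𝒜.components ∧ g ∈ H}

lemma components_finite : 𝒜.components.Finite := by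
  obtain ⟨K, A, B, h⟩ := 𝒜.exists_realization
  rw [h.components_eq]
  exact Set.finite_range _

variable {𝒜}

lemma ne_bot {H : Subgroup Γ} (hH : conjClassOf H ∈ 𝒜.components) : H ≠ ⊥ := by
  obtain ⟨K, A, B, h⟩ := 𝒜.exists_realization
  rw [h.components_eq] at hH
  obtain ⟨i, hi⟩ := hH
  obtain ⟨g, hg⟩ := conjClassOf_eq_iff.mp hi
  rintro rfl
  refine h.ne_bot i ((Subgroup.eq_bot_iff_forall _).mpr fun x hx => ?_)
  have h1 := (hg x).mp hx
  rw [Subgroup.mem_bot, mul_eq_one_iff_eq_inv, inv_mul_eq_iff_eq_mul, mul_inv_cancel] at h1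
  exact h1

lemma mem_normalSubgroup {g : Γ} (hg : g ∈ 𝒜.elements) : g ∈ 𝒜.normalSubgroup :=
  Subgroup.subset_normalClosure hg

lemma normalSubgroup_le_ker {K : Type*} [Group K] {F : Γ →* K} (hF : ∀ g ∈ 𝒜.elements, F g = 1) :
    𝒜.normalSubgroup ≤ F.ker :=
  Subgroup.normalClosure_le_normal hF

variable (𝒜) in
/-- The quotient of `Γ` by the normal closure of `𝒜` is free on `corank` many generators: it is
isomorphic to the cofactor of any realization. -/
lemma nonempty_basis :
    Nonempty (FreeGroupBasis (Fin 𝒜.corank) (Γ ⧸ 𝒜.normalSubgroup)) := by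
  refine Nat.sInf_mem (s := {r : ℕ | Nonempty (FreeGroupBasis (Fin r) (Γ ⧸ 𝒜.normalSubgroup))}) ?_
  obtain ⟨K, A, B, h⟩ := 𝒜.exists_realization
  obtain ⟨r, ⟨b⟩⟩ := h.cofactor_free
  obtain ⟨F, hF⟩ := h.freeProduct.exists_lift (K := B) (fun o => match o with
    | none => MonoidHom.id B
    | some i => 1)
  have hFB : ∀ x : B, F x = x := fun x => hF none x
  have hFA : ∀ i, ∀ x ∈ A i, F x = 1 := fun i x hx => hF (some i) ⟨x, hx⟩
  have hker : 𝒜.normalSubgroup ≤ F.ker := by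
    refine normalSubgroup_le_ker ?_
    rintro g ⟨H, hH, hg⟩
    rw [h.components_eq] at hH
    obtain ⟨i, hi⟩ := hH
    obtain ⟨c, hc⟩ := conjClassOf_eq_iff.mp hi.symm
    have h1 := hFA i _ ((hc g).mp hg)
    rw [map_mul, map_mul, map_inv, mul_eq_one_iff_eq_inv, inv_mul_eq_iff_eq_mul,
      mul_inv_cancel] at h1
    exact h1
  have hinv : ((QuotientGroup.mk' 𝒜.normalSubgroup).comp B.subtype).comp
      (QuotientGroup.lift _ F hker) = MonoidHom.id _ := by
    refine QuotientGroup.monoidHom_ext _ (h.freeProduct.hom_ext fun o x hx => ?_)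
    match o with
    | none =>
      change QuotientGroup.mk ((F x : B) : Γ) = QuotientGroup.mk x
      rw [hFB ⟨x, hx⟩]
    | some i =>
      change QuotientGroup.mk ((F x : B) : Γ) = QuotientGroup.mk x
      rw [hFA i x hx, eq_comm]
      refine (QuotientGroup.eq_one_iff x).mpr (mem_normalSubgroup ⟨A i, ?_, hx⟩)
      rw [h.components_eq]
      exact ⟨i, rfl⟩
  have e : B ≃* Γ ⧸ 𝒜.normalSubgroup := MonoidHom.toMulEquiv _ (QuotientGroup.lift _ F hker)
    (MonoidHom.ext hFB) hinv
  exact ⟨r, ⟨b.map e⟩⟩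

/-- A homomorphism to `ℤ/2` as a homomorphism to the corresponding multiplicative group. -/
def toHom {A : Set Γ} (d : FreeSplitting.homsVanishing Γ A) : Γ →* Multiplicative (ZMod 2) :=
  MonoidHom.mk' (fun g => Multiplicative.ofAdd (d.1 g)) fun g h => congrArg _ (d.2.1 g h)

end FreeFactorSystem

namespace FreeFactorSystem

variable {Γ : Type u} [Group Γ] (𝒜 : FreeFactorSystem Γ)

open FreeSplitting in
/-- The homomorphisms to `ℤ/2` which vanish on `𝒜` are those of the free group `Γ / N(𝒜)`. -/
lemma finrank_homsVanishing : Module.Finite (ZMod 2) (homsVanishing Γ 𝒜.elements) ∧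
    Module.finrank (ZMod 2) (homsVanishing Γ 𝒜.elements) = 𝒜.corank := by
  obtain ⟨b⟩ := 𝒜.nonempty_basis
  have hs := fun i => QuotientGroup.mk'_surjective 𝒜.normalSubgroup (b i)
  choose c hc using hs
  let f : homsVanishing Γ 𝒜.elements →ₗ[ZMod 2] Fin 𝒜.corank → ZMod 2 :=
    { toFun := fun d i => d.1 (c i)
      map_add' := fun _ _ => rfl
      map_smul' := fun _ _ => rfl }
  have hf : Function.Bijective f := by
    constructor
    · rw [← LinearMap.ker_eq_bot, LinearMap.ker_eq_bot']
      intro d hd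
      have hker : 𝒜.normalSubgroup ≤ (toHom d).ker := normalSubgroup_le_ker fun g hg =>
        congrArg Multiplicative.ofAdd (d.2.2 g hg)
      have h1 : QuotientGroup.lift _ (toHom d) hker = 1 := b.ext_hom _ _ fun i => by
        rw [← hc i]
        exact congrArg Multiplicative.ofAdd (congrFun hd i)
      refine Subtype.ext (funext fun g => ?_)
      exact congrArg Multiplicative.toAdd (DFunLike.congr_fun h1 (QuotientGroup.mk g))
    · intro x
      let F : Γ →* Multiplicative (ZMod 2) := (b.lift fun i => Multiplicative.ofAdd (x i)).comp
        (QuotientGroup.mk' 𝒜.normalSubgroup)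
      refine ⟨⟨fun g => (F g).toAdd, fun g h => ?_, fun g hg => ?_⟩, funext fun i => ?_⟩
      · change (F (g * h)).toAdd = _
        rw [map_mul, toAdd_mul]
      · have h1 : QuotientGroup.mk' 𝒜.normalSubgroup g = 1 :=
          (QuotientGroup.eq_one_iff g).mpr (mem_normalSubgroup hg)
        change Multiplicative.toAdd (b.lift _ (QuotientGroup.mk' 𝒜.normalSubgroup g)) = 0
        rw [h1, map_one, toAdd_one]
      · change Multiplicative.toAdd (b.lift _ (QuotientGroup.mk' 𝒜.normalSubgroup (c i))) = x i
        rw [hc, FreeGroupBasis.lift_apply_apply, FreeGroupBasis.repr_apply_coe, FreeGroup.lift_apply_of,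
          toAdd_ofAdd]
  have e := LinearEquiv.ofBijective f hf
  exact ⟨Module.Finite.equiv e.symm, by rw [e.finrank_eq, Module.finrank_pi, Fintype.card_fin]⟩

end FreeFactorSystem

namespace FreeSplitting

variable {Γ : Type u} [Group Γ] {T : FreeSplitting Γ} {𝒜 : FreeFactorSystem Γ}

lemma mem_stabilizer_smul {g h : Γ} {v : T.V} :
    h ∈ MulAction.stabilizer Γ (g • v) ↔ g⁻¹ * h * g ∈ MulAction.stabilizer Γ v := by
  rw [MulAction.mem_stabilizer_iff, MulAction.mem_stabilizer_iff, mul_smul, mul_smul,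
    inv_smul_eq_iff]

lemma stabilizer_smul_eq_bot {g : Γ} {v : T.V} :
    MulAction.stabilizer Γ (g • v) = ⊥ ↔ MulAction.stabilizer Γ v = ⊥ := by
  rw [MulAction.stabilizer_smul_eq_stabilizer_map_conj]
  exact Subgroup.map_eq_bot_iff_of_injective _ (MulAut.conj g).injective

lemma conjClassOf_stabilizer_smul (g : Γ) (v : T.V) :
    conjClassOf (MulAction.stabilizer Γ (g • v)) = conjClassOf (MulAction.stabilizer Γ v) :=
  conjClassOf_eq_iff.mpr ⟨g, fun _ => mem_stabilizer_smul⟩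

lemma exists_le_stabilizer {A A' : Subgroup Γ} (h : conjClassOf A = conjClassOf A') {v : T.V}
    (hv : A' ≤ MulAction.stabilizer Γ v) : ∃ g : Γ, A ≤ MulAction.stabilizer Γ (g • v) := by
  obtain ⟨g, hg⟩ := conjClassOf_eq_iff.mp h
  exact ⟨g, fun x hx => mem_stabilizer_smul.mpr (hv ((hg x).mp hx))⟩

lemma isRel_iff : T.IsRel 𝒜 ↔
    ∀ A, conjClassOf A ∈ 𝒜.components → ∃ v : T.V, A ≤ MulAction.stabilizer Γ v := by
  constructor
  · intro h A hA
    obtain ⟨_, ⟨v, -, rfl⟩, A', B, hA', hB, hle⟩ := h _ hA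
    obtain ⟨g, hg⟩ := exists_le_stabilizer hB le_rfl
    obtain ⟨g', hg'⟩ := exists_le_stabilizer hA'.symm (hle.trans hg)
    exact ⟨_, hg'⟩
  · intro h a ha
    obtain ⟨A, rfl⟩ := Quotient.exists_rep a
    obtain ⟨v, hv⟩ := h A ha
    exact ⟨_, ⟨v, fun hv' => FreeFactorSystem.ne_bot ha (le_bot_iff.mp (hv' ▸ hv)), rfl⟩,
      A, _, rfl, rfl, hv⟩

lemma isRel_of_vertexSystem_eq (h : T.vertexSystem = 𝒜.components) : T.IsRel 𝒜 := by
  rw [isRel_iff, ← h]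
  rintro A ⟨v, -, hv⟩
  obtain ⟨g, hg⟩ := exists_le_stabilizer hv.symm le_rfl
  exact ⟨_, hg⟩

lemma IsRel.elements_subset (h : T.IsRel 𝒜) : 𝒜.elements ⊆ T.elliptic := by
  rintro g ⟨A, hA, hg⟩
  obtain ⟨v, hv⟩ := isRel_iff.mp h A hA
  exact ⟨v, hv hg⟩

/-- If `ℱ(T) = 𝒜` then every nontrivial elliptic element lies in a subgroup representing an element
of `𝒜`. -/
lemma homsVanishing_eq (h : T.vertexSystem = 𝒜.components) :
    homsVanishing Γ T.elliptic = homsVanishing Γ 𝒜.elements := by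
  refine le_antisymm (homsVanishing_mono (isRel_of_vertexSystem_eq h).elements_subset) ?_
  intro d hd
  refine ⟨hd.1, ?_⟩
  rintro g ⟨v, hv⟩
  by_cases hg : g = 1
  · rw [hg]
    exact homsVanishing_one hd
  · refine hd.2 g ⟨MulAction.stabilizer Γ v, ?_, hv⟩
    rw [← h]
    exact ⟨v, stabilizer_ne_bot_iff.mpr ⟨g, hg, hv⟩, rfl⟩

end FreeSplitting

/-! ### Counting orbits -/

/-- Every nontrivial free group maps onto `ℤ/2`. -/
lemma IsFreeGroup.exists_hom_ne_one {G : Type*} [Group G] [IsFreeGroup G] [Nontrivial G] :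
    ∃ (χ : G →* Multiplicative (ZMod 2)) (g : G), χ g ≠ 1 := by
  obtain ⟨x⟩ : Nonempty (IsFreeGroup.Generators G) := by
    by_contra! hempty
    obtain ⟨g, hg⟩ := exists_ne (1 : G)
    have : MonoidHom.id G = 1 := IsFreeGroup.ext_hom fun a => hempty.elim a
    exact hg (DFunLike.congr_fun this g)
  refine ⟨IsFreeGroup.lift fun _ => Multiplicative.ofAdd 1, IsFreeGroup.of x, ?_⟩
  rw [IsFreeGroup.lift_of]
  decide

namespace FreeSplitting

variable {Γ : Type u} [Group Γ] {T : FreeSplitting Γ} {𝒜 : FreeFactorSystem Γ}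

variable (T) in
/-- The orbits of vertices with nontrivial stabilizer. -/
def StabOrbits : Set T.VertOrbits := {o | MulAction.stabilizer Γ o.out ≠ ⊥}

variable (T 𝒜) in
/-- The orbits of vertices with nontrivial stabilizer such that the stabilizer does not contain a
subgroup representing an element of `𝒜`. -/
def ExtraOrbits : Set T.VertOrbits :=
  {o | o ∈ T.StabOrbits ∧
    ∀ A, conjClassOf A ∈ 𝒜.components → ¬ A ≤ MulAction.stabilizer Γ o.out}

lemma orbit_out_eq {o o' : T.VertOrbits} {g : Γ} (h : o.out = g • o'.out) : o = o' := by
  rw [← o.out_eq, ← o'.out_eq]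
  exact orbit_mk_eq.mpr ⟨g, h.symm⟩

/-- An orbit of vertices which is not extra is determined by a component of `𝒜` contained in its
stabilizers, because a nontrivial subgroup fixes at most one vertex. -/
lemma ncard_stabOrbits_sdiff : (T.StabOrbits \ T.ExtraOrbits 𝒜).ncard ≤ 𝒜.card := by
  have h : ∀ o : T.VertOrbits, ∃ A, o ∈ T.StabOrbits \ T.ExtraOrbits 𝒜 →
      conjClassOf A ∈ 𝒜.components ∧ A ≤ MulAction.stabilizer Γ o.out := by
    intro o
    by_cases ho : o ∈ T.StabOrbits \ T.ExtraOrbits 𝒜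
    · obtain ⟨A, hA⟩ : ∃ A, conjClassOf A ∈ 𝒜.components ∧ A ≤ MulAction.stabilizer Γ o.out := by
        by_contra! hno
        exact ho.2 ⟨ho.1, hno⟩
      exact ⟨A, fun _ => hA⟩
    · exact ⟨⊥, fun h => absurd h ho⟩
  choose A hA using h
  refine Set.ncard_le_ncard_of_injOn (fun o => conjClassOf (A o)) (fun o ho => (hA o ho).1) ?_
    𝒜.components_finite
  intro o ho o' ho' heq
  obtain ⟨g, hg⟩ := exists_le_stabilizer heq (hA o' ho').2
  exact orbit_out_eq (eq_of_le_stabilizer (FreeFactorSystem.ne_bot (hA o ho).1) (hA o ho).2 hg)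

lemma card_le_ncard_stabOrbits (h : T.vertexSystem = 𝒜.components) :
    𝒜.card ≤ T.StabOrbits.ncard := by
  have himage : T.vertexSystem ⊆
      (fun o : T.VertOrbits => conjClassOf (MulAction.stabilizer Γ o.out)) '' T.StabOrbits := by
    rintro _ ⟨v, hv, rfl⟩
    obtain ⟨g, hg⟩ := exists_smul_out (Γ := Γ) v
    refine ⟨Quotient.mk _ v, fun h => hv ?_, ?_⟩
    · rw [← hg, stabilizer_smul_eq_bot, h]
    · rw [← hg]
      simp only [hg]
      rw [← conjClassOf_stabilizer_smul g, hg]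
  rw [FreeFactorSystem.card, ← h]
  exact (Set.ncard_le_ncard himage (Set.toFinite _)).trans (Set.ncard_image_le (Set.toFinite _))

lemma extraOrbits_eq_empty (h : T.vertexSystem = 𝒜.components) : T.ExtraOrbits 𝒜 = ∅ := by
  refine Set.eq_empty_of_forall_notMem fun o ho => ho.2 _ ?_ le_rfl
  rw [← h]
  exact ⟨_, ho.1, rfl⟩

/-- The stabilizer of a vertex in an extra orbit embeds into the free group `Γ / N(𝒜)`, so it is
free and has a nontrivial homomorphism to `ℤ/2`, which extends to `Γ`. -/
lemma exists_hom_of_extra (hT : T.IsRel 𝒜) {v : T.V} (hv : MulAction.stabilizer Γ v ≠ ⊥)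
    (hno : ∀ A, conjClassOf A ∈ 𝒜.components → ∀ g : Γ, ¬ A ≤ MulAction.stabilizer Γ (g • v)) :
    ∃ d ∈ homsVanishing Γ 𝒜.elements, (∃ h ∈ MulAction.stabilizer Γ v, d h = 1) ∧
      ∀ w, w ∉ MulAction.orbit Γ v → ∀ g ∈ MulAction.stabilizer Γ w, d g = 0 := by
  obtain ⟨Φ, c, hΦ, hkill⟩ := exists_extension v (MonoidHom.id (MulAction.stabilizer Γ v))
  have hΦA : ∀ g ∈ 𝒜.elements, Φ g = 1 := by
    rintro g ⟨A, hA, hg⟩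
    obtain ⟨w, hw⟩ := isRel_iff.mp hT A hA
    refine hkill w ?_ g (hw hg)
    rintro ⟨k, rfl⟩
    exact hno A hA k hw
  have hker := FreeFactorSystem.normalSubgroup_le_ker hΦA
  obtain ⟨b⟩ := 𝒜.nonempty_basis
  have := b.isFreeGroup
  let ι := (QuotientGroup.mk' 𝒜.normalSubgroup).comp (MulAction.stabilizer Γ v).subtype
  have hι : Function.Injective ι := by
    rw [injective_iff_map_eq_one]
    intro h hh
    have h1 : (h : Γ) ∈ 𝒜.normalSubgroup := (QuotientGroup.eq_one_iff _).mp hh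
    have h2 : Φ h = 1 := hker h1
    rw [hΦ, MonoidHom.id_apply] at h2
    exact conj_eq_one_iff.mp h2
  have := IsFreeGroup.ofMulEquiv (MonoidHom.ofInjective hι).symm
  have := (Subgroup.nontrivial_iff_ne_bot _).mpr hv
  obtain ⟨χ, h, hχ⟩ := IsFreeGroup.exists_hom_ne_one (G := MulAction.stabilizer Γ v)
  refine ⟨fun g => (χ (Φ g)).toAdd, ⟨fun g h => ?_, fun g hg => ?_⟩, ⟨h, h.2, ?_⟩,
    fun w hw g hg => ?_⟩
  · change (χ (Φ (g * h))).toAdd = _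
    rw [map_mul, map_mul, toAdd_mul]
  · change (χ (Φ g)).toAdd = 0
    rw [hΦA g hg, map_one, toAdd_one]
  · change (χ (Φ h)).toAdd = 1
    rw [hΦ, MonoidHom.id_apply, map_mul χ, map_mul χ, mul_right_comm, map_inv, mul_inv_cancel,
      one_mul]
    have key : ∀ x : ZMod 2, x ≠ 0 → x = 1 := by decide
    exact key _ fun h0 => hχ (toAdd_eq_zero.mp h0)
  · change (χ (Φ g)).toAdd = 0
    rw [hkill w hw g hg, map_one, toAdd_one]

/-- The homomorphisms which vanish on all vertex groups, together with one homomorphism for each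
extra orbit which is nontrivial on that orbit only, are linearly independent among the homomorphisms
which vanish on `𝒜`. -/
lemma finrank_add_ncard_le (hT : T.IsRel 𝒜) :
    Module.finrank (ZMod 2) (homsVanishing Γ T.elliptic) + (T.ExtraOrbits 𝒜).ncard ≤ 𝒜.corank := by
  classical
  obtain ⟨hfin, hrank⟩ := 𝒜.finrank_homsVanishing
  have hex : ∀ o : T.ExtraOrbits 𝒜, ∃ d ∈ homsVanishing Γ 𝒜.elements,
      (∃ h ∈ MulAction.stabilizer Γ o.1.out, d h = 1) ∧ ∀ w, w ∉ MulAction.orbit Γ o.1.out →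
        ∀ g ∈ MulAction.stabilizer Γ w, d g = 0 := fun o => by
    refine exists_hom_of_extra hT o.2.1 fun A hA g hle => ?_
    obtain ⟨w, hw⟩ := isRel_iff.mp hT A hA
    have h1 : conjClassOf A = conjClassOf (A.map (MulAut.conj g⁻¹).toMonoidHom) :=
      conjClassOf_eq_iff.mpr ⟨g, fun x => by
        simp only [Subgroup.mem_map]
        constructor
        · intro hx
          exact ⟨x, hx, by simp⟩
        · rintro ⟨y, hy, hyx⟩
          have : y = x := by simpa using hyx
          exact this ▸ hy⟩
    refine o.2.2 _ (h1 ▸ hA) ?_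
    rintro _ ⟨x, hx, rfl⟩
    have := mem_stabilizer_smul.mp (hle hx)
    simpa using this
  choose d hd hd1 hd0 using hex
  choose h hh hd1 using hd1
  have : Fintype (T.ExtraOrbits 𝒜) := Fintype.ofFinite _
  have hdd : ∀ o o' : T.ExtraOrbits 𝒜, d o (h o') = if o = o' then 1 else 0 := by
    intro o o'
    split_ifs with heq
    · rw [← heq, hd1]
    · refine hd0 o _ ?_ _ (hh o')
      rintro ⟨g, hg⟩
      exact heq (Subtype.ext (orbit_out_eq (g := g) hg.symm).symm)
  let f : (homsVanishing Γ T.elliptic × (T.ExtraOrbits 𝒜 → ZMod 2)) →ₗ[ZMod 2]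
      homsVanishing Γ 𝒜.elements :=
    (Submodule.inclusion (homsVanishing_mono hT.elements_subset)).coprod
      (Fintype.linearCombination (ZMod 2) fun o => (⟨d o, hd o⟩ : homsVanishing Γ 𝒜.elements))
  have hf : ∀ l c g, (f (l, c)).1 g = l.1 g + ∑ o, c o * d o g := by
    intro l c g
    simp only [f, LinearMap.coprod_apply, Fintype.linearCombination_apply, Submodule.coe_add,
      Pi.add_apply, Submodule.coe_sum, Finset.sum_apply]
    rfl
  have hinj : Function.Injective f := by
    rw [← LinearMap.ker_eq_bot, LinearMap.ker_eq_bot']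
    rintro ⟨l, c⟩ h0
    have h1 : ∀ g, l.1 g + ∑ o, c o * d o g = 0 := fun g => by
      rw [← hf, h0]
      rfl
    have hc : c = 0 := funext fun o => by
      have h2 := h1 (h o)
      rw [l.2.2 _ ⟨_, hh o⟩, zero_add] at h2
      simpa [hdd] using h2
    refine Prod.ext (Subtype.ext (funext fun g => ?_)) hc
    simpa [hc] using h1 g
  obtain ⟨hfin', -⟩ := euler T
  have h1 := LinearMap.finrank_le_finrank_of_injective hinj
  rwa [hrank, Module.finrank_prod, Module.finrank_pi, ← Nat.card_eq_fintype_card,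
    Nat.card_coe_set_eq] at h1

variable (T) in
/-- Vertices with trivial stabilizer have valence at most `3`, and the stabilizers of the others act
transitively on directions. -/
def LocallyGeneric : Prop := ∀ v : T.V,
  (MulAction.stabilizer Γ v = ⊥ → T.valence v ≤ 3) ∧
  (MulAction.stabilizer Γ v ≠ ⊥ → ∀ x y, T.graph.Adj v x → T.graph.Adj v y →
    ∃ g ∈ MulAction.stabilizer Γ v, g • x = y)

lemma isGeneric_iff : T.IsGeneric 𝒜 ↔ T.vertexSystem = 𝒜.components ∧ T.LocallyGeneric := Iff.rfl

variable (T) in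
/-- The orbits of darts issuing from the given orbit of vertices. -/
def outDarts (o : T.VertOrbits) : Set T.DartOrbits := {x | T.src x = o}

lemma mk_mem_outDarts {v x : T.V} (h : T.graph.Adj v x) :
    (Quotient.mk _ ⟨(v, x), h⟩ : T.DartOrbits) ∈ T.outDarts (Quotient.mk _ v) := rfl

lemma exists_of_mem_outDarts {v : T.V} {o : T.DartOrbits} (ho : o ∈ T.outDarts (Quotient.mk _ v)) :
    ∃ x, ∃ h : T.graph.Adj v x, o = Quotient.mk _ ⟨(v, x), h⟩ := by
  induction o using Quotient.inductionOn with | h d => ?_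
  obtain ⟨g, hg⟩ := orbit_mk_eq.mp (show (Quotient.mk _ d.1.1 : T.VertOrbits) = Quotient.mk _ v
    from ho)
  refine ⟨g⁻¹ • d.1.2, ?_, orbit_mk_eq.mpr ⟨g, Subtype.ext (Prod.ext hg (smul_inv_smul _ _))⟩⟩
  rw [← smul_adj_iff g, smul_inv_smul, hg]
  exact d.2

lemma mk_dart_eq_iff {v x y : T.V} (hx : T.graph.Adj v x) (hy : T.graph.Adj v y) :
    (Quotient.mk _ ⟨(v, x), hx⟩ : T.DartOrbits) = Quotient.mk _ ⟨(v, y), hy⟩ ↔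
      ∃ g ∈ MulAction.stabilizer Γ v, g • y = x := by
  refine orbit_mk_eq.trans (exists_congr fun g => ⟨fun h => ?_, fun h => ?_⟩)
  · exact ⟨congrArg (fun d : T.Dart => d.1.1) h, congrArg (fun d : T.Dart => d.1.2) h⟩
  · exact Subtype.ext (Prod.ext h.1 h.2)

/-- At a vertex with trivial stabilizer the directions correspond to the orbits of darts. -/
lemma encard_outDarts {v : T.V} (hv : MulAction.stabilizer Γ v = ⊥) :
    T.valence v = (T.outDarts (Quotient.mk _ v)).encard := by
  let f : T.graph.neighborSet v → T.outDarts (Quotient.mk _ v) := fun x =>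
    ⟨Quotient.mk _ ⟨(v, x.1), x.2⟩, rfl⟩
  refine Set.encard_congr (Equiv.ofBijective f ⟨fun x y hxy => ?_, fun o => ?_⟩)
  · obtain ⟨g, hg, hgy⟩ := (mk_dart_eq_iff x.2 y.2).mp (congrArg Subtype.val hxy)
    rw [hv, Subgroup.mem_bot] at hg
    rw [hg, one_smul] at hgy
    exact Subtype.ext hgy.symm
  · obtain ⟨x, hx, h⟩ := exists_of_mem_outDarts o.2
    exact ⟨⟨x, hx⟩, Subtype.ext h.symm⟩

lemma outDarts_nonempty (v : T.V) : (T.outDarts (Quotient.mk _ v)).Nonempty :=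
  let ⟨_, ha⟩ := exists_adj v
  ⟨_, mk_mem_outDarts ha⟩

lemma ncard_outDarts_le_one {v : T.V} : (T.outDarts (Quotient.mk _ v)).ncard ≤ 1 ↔
    ∀ x y, T.graph.Adj v x → T.graph.Adj v y → ∃ g ∈ MulAction.stabilizer Γ v, g • x = y := by
  rw [Set.ncard_le_one]
  constructor
  · intro h x y hx hy
    exact (mk_dart_eq_iff hy hx).mp (h _ (mk_mem_outDarts hy) _ (mk_mem_outDarts hx))
  · intro h o ho o' ho'
    obtain ⟨x, hx, rfl⟩ := exists_of_mem_outDarts ho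
    obtain ⟨y, hy, rfl⟩ := exists_of_mem_outDarts ho'
    exact (mk_dart_eq_iff hx hy).mpr (h y x hy hx)

lemma card_dartOrbits_eq_finsum :
    Nat.card T.DartOrbits = ∑ᶠ o : T.VertOrbits, (T.outDarts o).ncard := by
  classical
  have : Fintype T.VertOrbits := Fintype.ofFinite _
  rw [finsum_eq_sum_of_fintype, ← Nat.card_congr (Equiv.sigmaFiberEquiv T.src), Nat.card_sigma]
  rfl

/-- If all vertices are relatively natural, then counting darts by their initial vertices bounds the
number of orbits of vertices, with equality for locally generic trees only: an orbit of vertices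
contributes at least `3` orbits of darts if its stabilizers are trivial, and at least `1`
otherwise. -/
lemma three_mul_card_vertOrbits (hT : ∀ v, T.IsNatVertex v) :
    3 * Nat.card T.VertOrbits ≤ Nat.card T.DartOrbits + 2 * T.StabOrbits.ncard ∧
      (3 * Nat.card T.VertOrbits = Nat.card T.DartOrbits + 2 * T.StabOrbits.ncard ↔
        T.LocallyGeneric) := by
  classical
  have : Fintype T.VertOrbits := Fintype.ofFinite _
  have hS : T.StabOrbits.ncard = ∑ o : T.VertOrbits, if o ∈ T.StabOrbits then 1 else 0 := by
    rw [Finset.sum_boole, Set.ncard_eq_toFinset_card', Set.filter_mem_univ_eq_toFinset]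
    rfl
  have h3 : 3 * Nat.card T.VertOrbits = ∑ _o : T.VertOrbits, 3 := by
    rw [Finset.sum_const, Finset.card_univ, Nat.card_eq_fintype_card, smul_eq_mul, mul_comm]
  have hle : ∀ o : T.VertOrbits,
      3 ≤ (T.outDarts o).ncard + 2 * (if o ∈ T.StabOrbits then 1 else 0) := by
    intro o
    by_cases ho : o ∈ T.StabOrbits
    · have h1 := (outDarts_nonempty o.out).ncard_pos (Set.toFinite _)
      rw [o.out_eq] at h1
      rw [if_pos ho]
      omega
    · have ho' := not_not.mp ho
      have h1 : 3 ≤ T.valence o.out := (hT o.out).resolve_right (not_not.mpr ho')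
      rw [encard_outDarts ho', o.out_eq, ← (Set.toFinite _).cast_ncard_eq] at h1
      rw [if_neg ho]
      exact_mod_cast h1
  rw [card_dartOrbits_eq_finsum, finsum_eq_sum_of_fintype, hS, h3, Finset.mul_sum,
    ← Finset.sum_add_distrib]
  refine ⟨Finset.sum_le_sum fun o _ => hle o, ?_⟩
  rw [Finset.sum_eq_sum_iff_of_le fun o _ => hle o]
  constructor
  · intro h v
    have h1 := h (Quotient.mk _ v) (Finset.mem_univ _)
    have h2 : (Quotient.mk _ v : T.VertOrbits) ∈ T.StabOrbits ↔ MulAction.stabilizer Γ v ≠ ⊥ := by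
      obtain ⟨g, hg⟩ := exists_smul_out (Γ := Γ) v
      conv_rhs => rw [← hg]
      exact (not_congr stabilizer_smul_eq_bot).symm
    refine ⟨fun hv => ?_, fun hv => ?_⟩
    · rw [if_neg fun h => h2.mp h hv] at h1
      rw [encard_outDarts hv, ← (Set.toFinite _).cast_ncard_eq]
      exact_mod_cast (show (T.outDarts (Quotient.mk _ v)).ncard ≤ 3 by omega)
    · rw [if_pos (h2.mpr hv)] at h1
      exact ncard_outDarts_le_one.mp (by omega)
  · intro h o _
    refine le_antisymm (hle o) ?_
    by_cases ho : o ∈ T.StabOrbits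
    · have h1 := ncard_outDarts_le_one.mpr ((h o.out).2 ho)
      rw [o.out_eq] at h1
      rw [if_pos ho]
      omega
    · have ho' := not_not.mp ho
      have h1 := (h o.out).1 ho'
      rw [encard_outDarts ho', o.out_eq, ← (Set.toFinite _).cast_ncard_eq] at h1
      have h2 : (T.outDarts o).ncard ≤ 3 := by exact_mod_cast h1
      rw [if_neg ho]
      omega

/-- The bounds on the numbers of orbits of edges and vertices, by elimination from the Euler
characteristic formula, the count of darts and the bounds on the numbers of orbits of vertices
with nontrivial stabilizer. The factor `2` between darts and edges accounts for the constants. -/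
lemma card_bounds (hT : ∀ v, T.IsNatVertex v) (hrel : T.IsRel 𝒜) :
    Nat.card T.DartOrbits + 6 ≤ 6 * 𝒜.corank + 4 * 𝒜.card ∧
      Nat.card T.VertOrbits + 2 ≤ 2 * 𝒜.corank + 2 * 𝒜.card ∧
      (T.vertexSystem = 𝒜.components →
        (Nat.card T.DartOrbits + 6 = 6 * 𝒜.corank + 4 * 𝒜.card ↔ T.LocallyGeneric) ∧
        (Nat.card T.VertOrbits + 2 = 2 * 𝒜.corank + 2 * 𝒜.card ↔ T.LocallyGeneric)) := by
  obtain ⟨-, E, hE, hV⟩ := euler T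
  obtain ⟨h1, h2⟩ := three_mul_card_vertOrbits hT
  have h3 := finrank_add_ncard_le hrel
  have h4 := ncard_stabOrbits_sdiff (T := T) (𝒜 := 𝒜)
  have h5 := Set.ncard_sdiff_add_ncard_of_subset (s := T.ExtraOrbits 𝒜) (t := T.StabOrbits)
    (fun o ho => ho.1) (Set.toFinite _)
  refine ⟨by omega, by omega, fun h => ?_⟩
  have h6 := card_le_ncard_stabOrbits h
  rw [extraOrbits_eq_empty h, Set.ncard_empty] at h5 h3
  rw [extraOrbits_eq_empty h] at h4
  rw [homsVanishing_eq h, 𝒜.finrank_homsVanishing.2] at hV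
  rw [← h2]
  constructor <;> constructor <;> intro <;> omega

end FreeSplitting

/-! ### Bounds on relatively natural edges and vertices -/

namespace FreeSplitting

variable {Γ : Type u} [Group Γ] {T : FreeSplitting Γ} {𝒜 : FreeFactorSystem Γ}

/-- A free splitting without relatively natural vertices is a line on which `Γ` acts freely. Then
`𝒜` is empty and the Euler characteristic shows that `Γ` is free of rank `1`, so it is not freely
decomposable. -/
lemma IsRel.hasNat (hT : T.IsRel 𝒜) (hΓ : FreelyDecomposable Γ) : T.HasNat := by
  by_contra hno
  have hno' : ∀ v, ¬ 3 ≤ T.valence v ∧ MulAction.stabilizer Γ v = ⊥ := fun v => by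
    have := not_or.mp fun h : T.IsNatVertex v => hno ⟨v, h⟩
    exact ⟨this.1, not_not.mp this.2⟩
  have hempty : 𝒜.components = ∅ := by
    refine Set.eq_empty_of_forall_notMem fun a ha => ?_
    obtain ⟨A, rfl⟩ := Quotient.exists_rep a
    obtain ⟨v, hv⟩ := isRel_iff.mp hT A ha
    rw [(hno' v).2, le_bot_iff] at hv
    exact FreeFactorSystem.ne_bot ha hv
  have hvs : T.vertexSystem = 𝒜.components := by
    rw [hempty]
    refine Set.eq_empty_of_forall_notMem ?_
    rintro _ ⟨v, hv, -⟩
    exact hv (hno' v).2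
  have hval : ∀ o : T.VertOrbits, (T.outDarts o).ncard = 2 := by
    intro o
    obtain ⟨h1, h2⟩ := hno' o.out
    have h3 : 2 ≤ T.valence o.out := by
      obtain ⟨a, ha⟩ := exists_adj o.out
      obtain ⟨b, hb, hba⟩ := exists_adj_ne o.out a
      rw [valence, ← Set.encard_pair hba]
      exact Set.encard_le_encard (Set.insert_subset hb (Set.singleton_subset_iff.mpr ha))
    rw [encard_outDarts h2, o.out_eq, ← (Set.toFinite _).cast_ncard_eq] at h1 h3
    have h4 : ¬ 3 ≤ (T.outDarts o).ncard := fun h => h1 (by exact_mod_cast h)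
    have h5 : 2 ≤ (T.outDarts o).ncard := by exact_mod_cast h3
    omega
  have hD : Nat.card T.DartOrbits = Nat.card T.VertOrbits * 2 := by
    have : Fintype T.VertOrbits := Fintype.ofFinite _
    rw [card_dartOrbits_eq_finsum, finsum_eq_sum_of_fintype, Finset.sum_congr rfl fun o _ => hval o,
      Finset.sum_const, Finset.card_univ, Nat.card_eq_fintype_card, smul_eq_mul]
  obtain ⟨-, E, hE, hV⟩ := euler T
  rw [homsVanishing_eq hvs, 𝒜.finrank_homsVanishing.2] at hV
  have hr : 𝒜.corank = 1 := by omega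
  obtain ⟨b⟩ := 𝒜.nonempty_basis
  rw [hr] at b
  have hN : 𝒜.normalSubgroup = ⊥ := by
    rw [FreeFactorSystem.normalSubgroup, hempty]
    simp
  obtain ⟨x, y, hxy⟩ := hΓ.exists_mul_ne_mul
  have hcomm : ∀ p q : FreeGroup (Fin 1), p * q = q * p := by
    intro p q
    apply FreeGroup.mulEquivIntOfUnique.injective
    rw [map_mul, map_mul, mul_comm]
  refine hxy ?_
  have h1 : (QuotientGroup.mk (x * y) : Γ ⧸ 𝒜.normalSubgroup) = QuotientGroup.mk (y * x) := by
    apply b.repr.injective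
    rw [QuotientGroup.mk_mul, QuotientGroup.mk_mul, map_mul, map_mul, hcomm]
  rw [QuotientGroup.eq, hN, Subgroup.mem_bot, inv_mul_eq_one] at h1
  exact h1

section

variable (hT : T.HasNat)

lemma natTree_isRel : (T.natTree hT).IsRel 𝒜 ↔ T.IsRel 𝒜 := by
  unfold IsRel
  rw [natTree_vertexSystem]

lemma card_vertOrbits_natTree : T.natVertexOrbits.Finite ∧
    Nat.card (T.natTree hT).VertOrbits = T.natVertexOrbits.ncard := by
  let f : (T.natTree hT).VertOrbits → Set T.V := fun o => MulAction.orbit Γ (show T.NatVert from o.out).1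
  have hf : Function.Injective f := by
    intro o o' h
    have h1 : (show T.NatVert from o.out).1 ∈ f o' := by
      rw [← h]
      exact MulAction.mem_orbit_self _
    obtain ⟨g, hg⟩ := h1
    exact orbit_out_eq (T := T.natTree hT) (g := g) (Subtype.ext hg.symm)
  have hr : Set.range f = T.natVertexOrbits := by
    ext s
    constructor
    · rintro ⟨o, rfl⟩
      exact ⟨_, (show T.NatVert from o.out).2, rfl⟩
    · rintro ⟨v, hv, rfl⟩
      obtain ⟨g, hg⟩ := exists_smul_out (Γ := Γ) (X := (T.natTree hT).V) (⟨v, hv⟩ : T.NatVert)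
      refine ⟨Quotient.mk _ (⟨v, hv⟩ : T.NatVert), ?_⟩
      refine Eq.trans ?_ (congrArg (fun w : T.NatVert => MulAction.orbit Γ w.1) hg)
      exact (MulAction.orbit_smul g _).symm
  rw [← hr]
  refine ⟨Set.finite_range f, ?_⟩
  rw [← Nat.card_coe_set_eq, Nat.card_range_of_injective hf]

end

lemma IsRel.ncard_natEdgeOrbits_le (hT : T.IsRel 𝒜) (hn : T.HasNat) :
    (T.natEdgeOrbits.ncard : ℤ) ≤ 𝒜.depthFS + 1 := by
  obtain ⟨h1, -, -⟩ := card_bounds (natTree_isNatVertex hn) ((natTree_isRel hn).mpr hT)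
  have h2 := two_mul_ncard_natEdgeOrbits hn
  rw [FreeFactorSystem.depthFS]
  omega

lemma IsRel.ncard_natVertexOrbits_le (hT : T.IsRel 𝒜) (hn : T.HasNat) :
    (T.natVertexOrbits.ncard : ℤ) ≤ 𝒜.depthFS + 2 - 𝒜.corank := by
  obtain ⟨-, h1, -⟩ := card_bounds (natTree_isNatVertex hn) ((natTree_isRel hn).mpr hT)
  have h2 := (card_vertOrbits_natTree hn).2
  rw [FreeFactorSystem.depthFS]
  omega

lemma IsRel.isGeneric_iff_ncard (hT : T.IsRel 𝒜) (hn : T.HasNat) :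
    T.IsGeneric 𝒜 ↔ T.vertexSystem = 𝒜.components ∧
      (T.natVertexOrbits.ncard : ℤ) = 𝒜.depthFS + 2 - 𝒜.corank := by
  rw [← natTree_isGeneric hn, isGeneric_iff, natTree_vertexSystem]
  refine and_congr_right fun h => ?_
  obtain ⟨-, -, h1⟩ := card_bounds (natTree_isNatVertex hn) ((natTree_isRel hn).mpr hT)
  rw [natTree_vertexSystem] at h1
  rw [← (h1 h).2, FreeFactorSystem.depthFS, (card_vertOrbits_natTree hn).2]
  omega

lemma IsGeneric.ncard_natEdgeOrbits (hT : T.IsGeneric 𝒜) (hn : T.HasNat) :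
    (T.natEdgeOrbits.ncard : ℤ) = 𝒜.depthFS + 1 := by
  have hrel := isRel_of_vertexSystem_eq hT.1
  obtain ⟨-, -, h1⟩ := card_bounds (natTree_isNatVertex hn) ((natTree_isRel hn).mpr hrel)
  rw [natTree_vertexSystem] at h1
  have h2 := (h1 hT.1).1.mpr ((natTree_isGeneric hn).mpr hT).2
  have h3 := two_mul_ncard_natEdgeOrbits hn
  rw [FreeFactorSystem.depthFS]
  omega

end FreeSplitting

/-! ### Derivations on free products -/

/-- A connected graph is a tree if for every edge there is a set of vertices such that this edge is
the only one with exactly one end in it. -/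
lemma SimpleGraph.isTree_of_cut {V E : Type*} {G : SimpleGraph V} (s t : E → V)
    (hG : G.Connected)
    (hadj : ∀ x y, G.Adj x y ↔ ∃ e, (s e = x ∧ t e = y) ∨ (s e = y ∧ t e = x))
    (hcut : ∀ e, ∃ S : Set V, s e ∈ S ∧ t e ∉ S ∧ ∀ e', e' ≠ e → (s e' ∈ S ↔ t e' ∈ S)) :
    G.IsTree := by
  have key : ∀ e, ∃ S : Set V, G.IsWall S (s e) (t e) := by
    intro e
    obtain ⟨S, h1, h2, h3⟩ := hcut e
    refine ⟨S, (hadj _ _).mpr ⟨e, Or.inl ⟨rfl, rfl⟩⟩, h1, h2, fun x y hxy hx hy => ?_⟩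
    obtain ⟨e', he'⟩ := (hadj x y).mp hxy
    by_cases heq : e' = e
    · subst heq
      rcases he' with ⟨rfl, rfl⟩ | ⟨rfl, rfl⟩
      · exact ⟨rfl, rfl⟩
      · exact absurd h1 hy
    · rcases he' with ⟨rfl, rfl⟩ | ⟨rfl, rfl⟩
      · exact absurd ((h3 e' heq).mp hx) hy
      · exact absurd ((h3 e' heq).mpr hx) hy
  refine isTree_of_isWall hG fun v w h => ?_
  obtain ⟨e, ⟨rfl, rfl⟩ | ⟨rfl, rfl⟩⟩ := (hadj v w).mp h
  · exact key e
  · obtain ⟨S, hS⟩ := key e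
    exact ⟨_, hS.compl⟩

section Derivations

variable {Γ : Type u} [Group Γ]

variable (Γ) in
/-- The action of `Γ` on the group of functions `Γ → ℤ/2` by left translation. -/
def translation : Γ →* MulAut (Γ → Multiplicative (ZMod 2)) where
  toFun g :=
    { toFun := fun f x => f (g⁻¹ * x)
      invFun := fun f x => f (g * x)
      left_inv := fun f => by simp
      right_inv := fun f => by simp
      map_mul' := fun _ _ => rfl }
  map_one' := by
    ext f x
    simp
  map_mul' g h := by
    ext f x
    simp [mul_assoc]

/-- Derivations on a free product with values in the functions to `ℤ/2` correspond to derivations on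
the factors, since derivations are sections of a semidirect product. -/
lemma IsInternalFreeProduct.exists_derivation {ι : Type*} {H : ι → Subgroup Γ}
    (h : IsInternalFreeProduct H)
    (f : ∀ i, H i →* (Γ → Multiplicative (ZMod 2)) ⋊[translation Γ] Γ)
    (hf : ∀ i x, (f i x).right = x) :
    ∃ d : Γ → Γ → ZMod 2, (∀ g k x, d (g * k) x = d g x + d k (g⁻¹ * x)) ∧
      ∀ i (y : H i) x, d y x = ((f i y).left x).toAdd := by
  obtain ⟨F, hF⟩ := h.exists_lift f
  have hr : SemidirectProduct.rightHom.comp F = MonoidHom.id Γ := h.hom_ext fun i x hx => by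
    change (F x).right = x
    rw [hF i ⟨x, hx⟩, hf]
  have hr' : ∀ g, (F g).right = g := DFunLike.congr_fun hr
  refine ⟨fun g x => ((F g).left x).toAdd, fun g k x => ?_, fun i y x => by simp only [hF]⟩
  simp only [map_mul, SemidirectProduct.mul_left, hr']
  rfl

open scoped Classical in
/-- There is a derivation which on one free factor is the inner derivation given by the
characteristic function of `1`, and which vanishes on all other factors. -/
lemma IsInternalFreeProduct.exists_inner_derivation {ι : Type*} {H : ι → Subgroup Γ}
    (h : IsInternalFreeProduct H) (i : ι) :
    ∃ d : Γ → Γ → ZMod 2, (∀ g k x, d (g * k) x = d g x + d k (g⁻¹ * x)) ∧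
      (∀ y ∈ H i, ∀ x, d y x = (if x = 1 then 1 else 0) + (if x = y then 1 else 0)) ∧
      ∀ j, j ≠ i → ∀ y ∈ H j, ∀ x, d y x = 0 := by
  let δ : Γ → Multiplicative (ZMod 2) := fun x => Multiplicative.ofAdd (if x = 1 then 1 else 0)
  let f : ∀ j, H j →* (Γ → Multiplicative (ZMod 2)) ⋊[translation Γ] Γ := fun j =>
    if j = i then (MulAut.conj (SemidirectProduct.inl δ)).toMonoidHom.comp
      (SemidirectProduct.inr.comp (H j).subtype) else SemidirectProduct.inr.comp (H j).subtype
  obtain ⟨d, hd, hdf⟩ := h.exists_derivation f (by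
    intro j x
    by_cases hj : j = i
    · simp [f, if_pos hj]
    · simp [f, if_neg hj])
  refine ⟨d, hd, fun y hy x => ?_, fun j hj y hy x => ?_⟩
  · rw [hdf i ⟨y, hy⟩]
    simp only [f, if_pos]
    have h1 : ((SemidirectProduct.inl δ : _ ⋊[translation Γ] Γ) * SemidirectProduct.inr y *
        (SemidirectProduct.inl δ)⁻¹).left x = δ x * (δ (y⁻¹ * x))⁻¹ := by
      rw [SemidirectProduct.mul_left, SemidirectProduct.mul_left, SemidirectProduct.inv_left]
      change (δ x * 1) * (δ ((1⁻¹)⁻¹ * ((1 * y)⁻¹ * x)))⁻¹ = _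
      simp
    have h2 : ((SemidirectProduct.inl δ : _ ⋊[translation Γ] Γ) * SemidirectProduct.inr y *
        (SemidirectProduct.inl δ)⁻¹).left x = ((MulAut.conj (SemidirectProduct.inl δ)).toMonoidHom.comp
          (SemidirectProduct.inr.comp (H i).subtype) ⟨y, hy⟩).left x := rfl
    rw [← h2, h1]
    simp [δ, ZMod.neg_eq_self_mod_two, inv_mul_eq_one, eq_comm]
  · rw [hdf j ⟨y, hy⟩]
    simp only [f, if_neg hj]
    rfl

open scoped Classical in
/-- There is a derivation whose value at one basis element of a free factor is the characteristic
function of `1`, and which vanishes on the other basis elements and on the other factors. -/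
lemma IsInternalFreeProduct.exists_basis_derivation {ι κ : Type*} {H : ι → Subgroup Γ}
    (h : IsInternalFreeProduct H) {i : ι} (b : FreeGroupBasis κ (H i)) (l : κ) :
    ∃ d : Γ → Γ → ZMod 2, (∀ g k x, d (g * k) x = d g x + d k (g⁻¹ * x)) ∧
      (∀ m x, d (b m) x = if m = l ∧ x = 1 then 1 else 0) ∧
      ∀ j, j ≠ i → ∀ y ∈ H j, ∀ x, d y x = 0 := by
  let δ : κ → Γ → Multiplicative (ZMod 2) := fun m x =>
    Multiplicative.ofAdd (if m = l ∧ x = 1 then 1 else 0)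
  let f₀ : H i →* (Γ → Multiplicative (ZMod 2)) ⋊[translation Γ] Γ :=
    b.lift fun m => ⟨δ m, b m⟩
  have hf₀ : ∀ m, f₀ (b m) = ⟨δ m, b m⟩ := fun m => by
    simp only [f₀]
    rw [FreeGroupBasis.lift_apply_apply, FreeGroupBasis.repr_apply_coe, FreeGroup.lift_apply_of]
  have hf₀r : SemidirectProduct.rightHom.comp f₀ = (H i).subtype := b.ext_hom _ _ fun m => by
    change (f₀ (b m)).right = _
    rw [hf₀]
    rfl
  let f : ∀ j, H j →* (Γ → Multiplicative (ZMod 2)) ⋊[translation Γ] Γ := fun j =>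
    if hj : j = i then hj ▸ f₀ else SemidirectProduct.inr.comp (H j).subtype
  obtain ⟨d, hd, hdf⟩ := h.exists_derivation f (by
    intro j x
    by_cases hj : j = i
    · subst hj
      simp only [f, dif_pos]
      exact DFunLike.congr_fun hf₀r x
    · simp [f, dif_neg hj])
  refine ⟨d, hd, fun m x => ?_, fun j hj y hy x => ?_⟩
  · rw [hdf i (b m)]
    simp only [f, dif_pos]
    rw [hf₀]
    rfl
  · rw [hdf j ⟨y, hy⟩]
    simp only [f, dif_neg hj]
    rfl

end Derivations

/-! ### The tree of a free factorization -/

namespace FactorTree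

variable {Γ : Type u} [Group Γ] {K r : ℕ} {A : Fin K → Subgroup Γ} {B : Subgroup Γ}

variable (A) in
/-- The vertices of the tree of the factorization `Γ = A₁ * ⋯ * A_K * B`: elements of `Γ` and
cosets of the factors `A i`. -/
abbrev Vertex : Type u := Γ ⊕ Σ i, Γ ⧸ A i

variable (Γ K r) in
/-- The edges: for each `g` there is an edge from `g` to each coset `g A i`, and one
from `g` to `g b` for each element `b` of the basis of `B`. -/
abbrev Edge : Type u := Γ × (Fin K ⊕ Fin r)

/-- The initial vertex of an edge. -/
def source (e : Edge Γ K r) : Vertex A := Sum.inl e.1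

/-- The terminal vertex of an edge. -/
def target (A : Fin K → Subgroup Γ) (b : Fin r → Γ) (e : Edge Γ K r) : Vertex A :=
  match e.2 with
  | Sum.inl i => Sum.inr ⟨i, e.1⟩
  | Sum.inr j => Sum.inl (e.1 * b j)

/-- The tree of a free factorization. -/
def factorGraph (A : Fin K → Subgroup Γ) (b : Fin r → Γ) : SimpleGraph (Vertex A) where
  Adj x y := x ≠ y ∧ ∃ e : Edge Γ K r,
    (source e = x ∧ target A b e = y) ∨ (source e = y ∧ target A b e = x)
  symm := ⟨fun _ _ h => ⟨h.1.symm, h.2.imp fun _ => Or.symm⟩⟩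
  loopless := ⟨fun _ h => h.1 rfl⟩

variable {b : FreeGroupBasis (Fin r) B}
  (h : IsInternalFreeProduct fun o : Option (Fin K) => o.elim B A)

open scoped Classical in
include h in
/-- For each edge `o` of the quotient graph there is a function on vertices, with values in the
functions from `Γ` to `ℤ/2`, whose coboundary at `g o` is the characteristic function of `g` and
whose coboundary at the translates of other edges is zero. It is given by a derivation on `Γ`. -/
lemma exists_coloring (b : FreeGroupBasis (Fin r) B) (o : Fin K ⊕ Fin r) :
    ∃ F : Vertex A → Γ → ZMod 2, ∀ g o' x,
      F (target A (fun j => (b j : Γ)) (g, o')) x =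
        F (source (g, o')) x + if o' = o ∧ x = g then 1 else 0 := by
  have hdA : ∀ (d : Γ → Γ → ZMod 2), (∀ g k x, d (g * k) x = d g x + d k (g⁻¹ * x)) → ∀ i,
      (∀ y ∈ A i, ∀ x, d y x = 0) → ∀ g x : Γ,
        d (Quotient.out (QuotientGroup.mk g : Γ ⧸ A i)) x = d g x := by
    intro d hd i hi g x
    obtain ⟨a, ha⟩ := QuotientGroup.mk_out_eq_mul (A i) g
    rw [ha, hd, hi a a.2, add_zero]
  match o with
  | Sum.inl i =>
    obtain ⟨d, hd, hi, hj⟩ := h.exists_inner_derivation (some i)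
    have hj' : ∀ j, j ≠ i → ∀ y ∈ A j, ∀ x, d y x = 0 := fun j hji => hj (some j) (by simpa using hji)
    refine ⟨fun v x => match v with
      | Sum.inl g => d g x
      | Sum.inr ⟨j, q⟩ => d q.out x + if j = i ∧ x = q.out then 1 else 0, fun g o' x => ?_⟩
    match o' with
    | Sum.inl j =>
      change d (Quotient.out (QuotientGroup.mk g : Γ ⧸ A j)) x + _ = d g x + _
      by_cases hji : j = i
      · subst hji
        obtain ⟨a, ha⟩ := QuotientGroup.mk_out_eq_mul (A j) g
        rw [ha, hd, hi a a.2]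
        have h1 : g⁻¹ * x = 1 ↔ x = g := by rw [inv_mul_eq_one, eq_comm]
        have h2 : g⁻¹ * x = a ↔ x = g * a := inv_mul_eq_iff_eq_mul
        simp only [h1, h2, true_and]
        have h3 : ∀ p q s : ZMod 2, p + (q + s) + s = p + q := by decide
        exact h3 _ _ _
      · rw [hdA d hd j (hj' j hji)]
        simp [hji]
    | Sum.inr j =>
      change d (g * b j) x = d g x + _
      rw [hd, hj none (by simp) _ (b j).2]
      simp
  | Sum.inr l =>
    obtain ⟨d, hd, hb, hj⟩ := h.exists_basis_derivation (i := none) b l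
    refine ⟨fun v x => match v with
      | Sum.inl g => d g x
      | Sum.inr ⟨j, q⟩ => d q.out x, fun g o' x => ?_⟩
    match o' with
    | Sum.inl j =>
      change d (Quotient.out (QuotientGroup.mk g : Γ ⧸ A j)) x = d g x + _
      rw [hdA d hd j (hj (some j) (by simp))]
      simp
    | Sum.inr j =>
      change d (g * b j) x = d g x + _
      rw [hd, show d (b j) (g⁻¹ * x) = _ from hb j _]
      simp only [Sum.inr.injEq, inv_mul_eq_one, eq_comm (a := g)]

include h in
lemma source_ne_target (b : FreeGroupBasis (Fin r) B) (e : Edge Γ K r) :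
    source e ≠ target A (fun j => (b j : Γ)) e := by
  classical
  obtain ⟨F, hF⟩ := exists_coloring h b e.2
  intro heq
  have h1 := hF e.1 e.2 e.1
  rw [if_pos ⟨rfl, rfl⟩, ← heq] at h1
  simp at h1

include h in
lemma adj_iff (b : FreeGroupBasis (Fin r) B) (x y : Vertex A) :
    (factorGraph A fun j => (b j : Γ)).Adj x y ↔ ∃ e : Edge Γ K r,
      (source e = x ∧ target A (fun j => (b j : Γ)) e = y) ∨
      (source e = y ∧ target A (fun j => (b j : Γ)) e = x) := by
  refine ⟨fun h => h.2, fun he => ⟨?_, he⟩⟩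
  obtain ⟨e, ⟨rfl, rfl⟩ | ⟨rfl, rfl⟩⟩ := he
  · exact source_ne_target h b e
  · exact (source_ne_target h b e).symm

lemma smul_source (g : Γ) (e : Edge Γ K r) :
    (g • source e : Vertex A) = source (g * e.1, e.2) := rfl

lemma smul_target (b : Fin r → Γ) (g : Γ) (e : Edge Γ K r) :
    g • target A b e = target A b (g * e.1, e.2) := by
  obtain ⟨k, i | j⟩ := e
  · rfl
  · change (Sum.inl (g * (k * b j)) : Vertex A) = Sum.inl (g * k * b j)
    rw [mul_assoc]

include h in
/-- The elements which can be joined to `1` form a subgroup containing all free factors. -/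
lemma connected (b : FreeGroupBasis (Fin r) B) : (factorGraph A fun j => (b j : Γ)).Connected := by
  set G := factorGraph A fun j => (b j : Γ) with hG
  have hst : ∀ e, G.Adj (source e) (target A (fun j => (b j : Γ)) e) := fun e =>
    (adj_iff h b _ _).mpr ⟨e, Or.inl ⟨rfl, rfl⟩⟩
  have hedge : ∀ g i, G.Adj (Sum.inl g) (Sum.inr ⟨i, g⟩) := fun g i => hst (g, Sum.inl i)
  let H : Subgroup Γ :=
    { carrier := {k | ∀ g, G.Reachable (Sum.inl g) (Sum.inl (g * k))}
      mul_mem' := fun {a c} ha hc g => by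
        rw [← mul_assoc]
        exact (ha g).trans (hc _)
      one_mem' := fun g => by rw [mul_one]
      inv_mem' := fun {a} ha g => by simpa using (ha (g * a⁻¹)).symm }
  have hA : ∀ i, A i ≤ H := by
    intro i a ha g
    refine (hedge g i).reachable.trans ?_
    have h1 : ((g * a : Γ) : Γ ⧸ A i) = g := (QuotientGroup.mk_mul_of_mem g ha)
    have h2 := (hedge (g * a) i).symm.reachable
    rwa [h1] at h2
  have hB : B ≤ H := by
    intro y hy
    obtain ⟨w, hw⟩ := b.repr.symm.surjective ⟨y, hy⟩
    have hw' : y = (b.repr.symm w : Γ) := by rw [hw]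
    rw [hw']
    clear hw hw' hy
    induction w using FreeGroup.induction_on with
    | C1 => simp
    | of j => exact fun g => (hst (g, Sum.inr j)).reachable
    | inv_of j hj => simpa using H.inv_mem hj
    | mul w₁ w₂ h1 h2 => simpa using H.mul_mem h1 h2
  have hH : ∀ g, g ∈ H := by
    intro g
    obtain ⟨w, rfl⟩ := h.2 g
    induction w using Monoid.CoprodI.induction_on with
    | one => simp
    | of o x =>
      rw [Monoid.CoprodI.lift_of]
      match o with
      | none => exact hB x.2
      | some i => exact hA i x.2
    | mul w₁ w₂ h1 h2 => simpa using H.mul_mem h1 h2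
  have hall : ∀ x : Vertex A, G.Reachable (Sum.inl 1) x := by
    intro x
    match x with
    | Sum.inl g => simpa using hH g 1
    | Sum.inr ⟨i, q⟩ =>
      obtain ⟨g, rfl⟩ := QuotientGroup.mk_surjective q
      refine SimpleGraph.Reachable.trans ?_ (hedge g i).reachable
      simpa using hH g 1
  have : Nonempty (Vertex A) := ⟨Sum.inl 1⟩
  exact ⟨fun x y => (hall x).symm.trans (hall y)⟩

include h in
/-- The level sets of the functions of `exists_coloring` are walls of all edges. -/
lemma factorGraph_isTree (b : FreeGroupBasis (Fin r) B) :
    (factorGraph A fun j => (b j : Γ)).IsTree := by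
  classical
  refine SimpleGraph.isTree_of_cut source (target A fun j => (b j : Γ)) (connected h b)
    (adj_iff h b) fun e => ?_
  obtain ⟨F, hF⟩ := exists_coloring h b e.2
  refine ⟨{x | F x e.1 = F (source e) e.1}, rfl, fun h1 => ?_, fun e' he' => ?_⟩
  · have h2 := hF e.1 e.2 e.1
    rw [if_pos ⟨rfl, rfl⟩] at h2
    have h3 := h2.symm.trans h1
    simp at h3
  · have h2 := hF e'.1 e'.2 e.1
    rw [if_neg (fun h => he' (Prod.ext h.2.symm h.1)), add_zero] at h2
    change _ = _ ↔ _ = _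
    rw [h2]

lemma basis_mul_self (b : FreeGroupBasis (Fin r) B) (j : Fin r) : (b j : Γ) * b j ≠ 1 := by
  intro h1
  have h2 : b j * b j = 1 := Subtype.ext h1
  have h3 := congrArg (b.lift fun _ => Multiplicative.ofAdd (1 : ℤ)) h2
  rw [map_mul, map_one (b.lift _), FreeGroupBasis.lift_apply_apply, FreeGroupBasis.repr_apply_coe,
    FreeGroup.lift_apply_of, ← ofAdd_add] at h3
  exact absurd h3 (by decide)

lemma stabilizer_inl (g : Γ) : MulAction.stabilizer Γ (Sum.inl g : Vertex A) = ⊥ := by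
  refine (Subgroup.eq_bot_iff_forall _).mpr fun k hk => ?_
  have h1 : k * g = g := Sum.inl_injective hk
  simpa using h1

lemma mem_stabilizer_inr {i : Fin K} {g k : Γ} :
    k ∈ MulAction.stabilizer Γ (Sum.inr ⟨i, g⟩ : Vertex A) ↔ g⁻¹ * k * g ∈ A i := by
  have h1 : k ∈ MulAction.stabilizer Γ (Sum.inr ⟨i, g⟩ : Vertex A) ↔
      ((k * g : Γ) : Γ ⧸ A i) = g := by
    constructor
    · intro hk
      have h2 : (⟨i, (k * g : Γ)⟩ : Σ i, Γ ⧸ A i) = ⟨i, g⟩ := Sum.inr_injective hk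
      simpa using h2
    · intro hk
      exact congrArg (fun q => (Sum.inr ⟨i, q⟩ : Vertex A)) hk
  rw [h1, eq_comm, QuotientGroup.eq, mul_assoc]

end FactorTree

namespace FreeSplitting

variable {Γ : Type u} [Group Γ] {𝒜 : FreeFactorSystem Γ}

open FactorTree in
/-- Every proper free factor system is the vertex stabilizer system of a free splitting, the tree of
a realization. -/
lemma exists_vertexSystem_eq (hΓ : FreelyDecomposable Γ) (h𝒜 : 𝒜.IsProper) :
    ∃ T : FreeSplitting Γ, T.vertexSystem = 𝒜.components := by
  obtain ⟨K, A, B, hR⟩ := 𝒜.exists_realization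
  obtain ⟨r, ⟨b⟩⟩ := hR.cofactor_free
  have h := hR.freeProduct
  have hst : ∀ e, (factorGraph A fun j => (b j : Γ)).Adj (source e)
      (target A (fun j => (b j : Γ)) e) :=
    fun e => (adj_iff h b _ _).mpr ⟨e, Or.inl ⟨rfl, rfl⟩⟩
  have hsmul : ∀ (g : Γ) {v w : Vertex A}, (factorGraph A fun j => (b j : Γ)).Adj v w →
      (factorGraph A fun j => (b j : Γ)).Adj (g • v) (g • w) := by
    intro g v w hvw
    obtain ⟨e, ⟨rfl, rfl⟩ | ⟨rfl, rfl⟩⟩ := (adj_iff h b v w).mp hvw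
    · rw [smul_source, smul_target]
      exact hst _
    · rw [smul_source, smul_target]
      exact (hst _).symm
  have hfin : ∃ F : Set (Vertex A × Vertex A), F.Finite ∧
      ∀ v w, (factorGraph A fun j => (b j : Γ)).Adj v w →
        ∃ p ∈ F, ∃ g : Γ, v = g • p.1 ∧ w = g • p.2 := by
    refine finite_edge_orbits_of_finite (D := (Fin K ⊕ Fin r) × Bool) (fun p =>
      let e : Edge Γ K r := (1, p.1)
      if p.2 then (source e, target A (fun j => (b j : Γ)) e) else
        (target A (fun j => (b j : Γ)) e, source e)) fun v w hvw => ?_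
    obtain ⟨⟨g, o⟩, ⟨rfl, rfl⟩ | ⟨rfl, rfl⟩⟩ := (adj_iff h b v w).mp hvw
    · refine ⟨(o, true), g, ?_, ?_⟩
      · simp [smul_source]
      · simp [smul_target]
    · refine ⟨(o, false), g, ?_, ?_⟩
      · simp [smul_target]
      · simp [smul_source]
  -- No vertex has valence one. For the vertices of the free orbit this is where properness of `𝒜`
  -- is needed: one factor and a trivial cofactor would mean that this factor is all of `Γ`.
  have htwo : ∀ v : Vertex A, ∃ x y, (factorGraph A fun j => (b j : Γ)).Adj v x ∧
      (factorGraph A fun j => (b j : Γ)).Adj v y ∧ x ≠ y := by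
    intro v
    match v with
    | Sum.inl g =>
      by_cases hr : r = 0
      · subst hr
        have hB : ∀ x ∈ B, x = 1 := by
          intro x hx
          have : b.repr ⟨x, hx⟩ = 1 := Subsingleton.elim _ _
          exact congrArg Subtype.val ((MulEquiv.map_eq_one_iff b.repr).mp this)
        by_cases hK : ∃ i j : Fin K, i ≠ j
        · obtain ⟨i, j, hij⟩ := hK
          refine ⟨_, _, hst (g, Sum.inl i), hst (g, Sum.inl j), fun heq => hij ?_⟩
          exact congrArg Sigma.fst (Sum.inr_injective heq)
        · exfalso
          push Not at hK
          -- here `K ≤ 1` and `B` is trivial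
          by_cases hne : Nonempty (Fin K)
          · obtain ⟨i⟩ := hne
            refine h𝒜 ?_
            have htop : A i = ⊤ := by
              refine (Subgroup.eq_top_iff' _).mpr fun x => ?_
              obtain ⟨w, rfl⟩ := h.2 x
              induction w using Monoid.CoprodI.induction_on with
              | one => simp
              | of o x =>
                rw [Monoid.CoprodI.lift_of]
                match o with
                | none =>
                  have h1 : (x : Γ) = 1 := hB x x.2
                  change (x : Γ) ∈ A i
                  rw [h1]
                  exact one_mem _
                | some j =>
                  have h2 := x.2
                  rw [hK i j]
                  exact h2
              | mul w₁ w₂ h1 h2 => simpa using mul_mem h1 h2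
            rw [hR.components_eq]
            ext c
            constructor
            · rintro ⟨j, rfl⟩
              change conjClassOf (A j) = _
              rw [← hK i j, htop]
            · rintro rfl
              exact ⟨i, congrArg conjClassOf htop⟩
          · obtain ⟨x, y, hxy⟩ := hΓ.exists_mul_ne_mul
            have hone : MonoidHom.id Γ = 1 := h.hom_ext fun o x hx => by
              match o with
              | none => exact hB x hx
              | some j => exact absurd ⟨j⟩ hne
            have hone' : ∀ z : Γ, z = 1 := DFunLike.congr_fun hone
            exact hxy ((hone' _).trans (hone' _).symm)
      · let j : Fin r := ⟨0, Nat.pos_of_ne_zero hr⟩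
        have h1 := hst (g * (b j : Γ)⁻¹, Sum.inr j)
        change (factorGraph A fun j => (b j : Γ)).Adj (Sum.inl (g * (b j : Γ)⁻¹))
          (Sum.inl (g * (b j : Γ)⁻¹ * b j)) at h1
        rw [inv_mul_cancel_right] at h1
        refine ⟨_, _, hst (g, Sum.inr j), h1.symm, fun heq => basis_mul_self b j ?_⟩
        have h2 : g * (b j : Γ) = g * (b j : Γ)⁻¹ := Sum.inl_injective heq
        rw [mul_right_inj] at h2
        nth_rw 1 [h2]
        exact inv_mul_cancel _
    | Sum.inr ⟨i, q⟩ =>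
      obtain ⟨g, rfl⟩ := QuotientGroup.mk_surjective q
      obtain ⟨a, ha⟩ := Subgroup.ne_bot_iff_exists_ne_one.mp (hR.ne_bot i)
      have h1 := hst (g * a, Sum.inl i)
      have h2 : target A (fun j => (b j : Γ)) (g * a, Sum.inl i) = Sum.inr ⟨i, g⟩ :=
        congrArg (fun q => (Sum.inr ⟨i, q⟩ : Vertex A)) (QuotientGroup.mk_mul_of_mem g a.2)
      rw [h2] at h1
      refine ⟨_, _, (hst (g, Sum.inl i)).symm, h1.symm, fun heq => ha ?_⟩
      have h3 : g = g * (a : Γ) := Sum.inl_injective heq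
      exact Subtype.ext (left_eq_mul.mp h3)
  let T : FreeSplitting Γ :=
    { V := Vertex A
      graph := factorGraph A fun j => (b j : Γ)
      isTree := factorGraph_isTree h b
      smul_adj := hsmul
      not_point := by
        obtain ⟨x, y, -, -, hxy⟩ := htwo (Sum.inl 1)
        exact ⟨x, y, hxy⟩
      minimal := minimal_of_exists_two_adj (factorGraph_isTree h b) hsmul hfin htwo
      edge_stabilizer := by
        intro g v w hvw hs
        have key : ∀ e : Edge Γ K r, s(g • source e, g • target A (fun j => (b j : Γ)) e) =
            s(source e, target A (fun j => (b j : Γ)) e) → g = 1 := by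
          rintro ⟨k, o⟩ hs
          rcases Sym2.eq_iff.mp hs with ⟨h1, -⟩ | ⟨h1, h2⟩
          · have h3 : g * k = k := Sum.inl_injective h1
            simpa using h3
          · match o with
            | Sum.inl i => exact absurd h1 (by rintro ⟨⟩)
            | Sum.inr j =>
              have h3 : g * k = k * b j := Sum.inl_injective h1
              have h4 : g * (k * b j) = k := Sum.inl_injective h2
              rw [← mul_assoc, h3, mul_assoc] at h4
              exact absurd (mul_eq_left.mp h4) (basis_mul_self b j)
        obtain ⟨e, ⟨rfl, rfl⟩ | ⟨rfl, rfl⟩⟩ := (adj_iff h b v w).mp hvw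
        · exact key e hs
        · exact key e (by rw [Sym2.eq_swap, hs, Sym2.eq_swap])
      finite_edge_orbits := hfin }
  refine ⟨T, ?_⟩
  rw [hR.components_eq]
  have hclass : ∀ (g : Γ) i, conjClassOf (MulAction.stabilizer Γ (Sum.inr ⟨i, g⟩ : Vertex A)) =
      conjClassOf (A i) := fun g i => conjClassOf_eq_iff.mpr ⟨g, fun x => mem_stabilizer_inr⟩
  ext c
  constructor
  · rintro ⟨v, hv, rfl⟩
    match v with
    | Sum.inl g => exact absurd (stabilizer_inl g) hv
    | Sum.inr ⟨i, q⟩ =>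
      obtain ⟨g, rfl⟩ := QuotientGroup.mk_surjective q
      exact ⟨i, (hclass g i).symm⟩
  · rintro ⟨i, rfl⟩
    refine ⟨(Sum.inr ⟨i, (1 : Γ)⟩ : Vertex A), fun h1 => hR.ne_bot i ?_, hclass 1 i⟩
    refine (Subgroup.eq_bot_iff_forall _).mpr fun a ha => ?_
    have h2 : a ∈ MulAction.stabilizer Γ (Sum.inr ⟨i, (1 : Γ)⟩ : Vertex A) :=
      mem_stabilizer_inr.mpr (by simpa using ha)
    have h3 : a ∈ (⊥ : Subgroup Γ) := h1 ▸ h2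
    exact Subgroup.mem_bot.mp h3

end FreeSplitting

/-! ### Blowing up vertices -/

namespace FreeSplitting

variable {Γ : Type u} [Group Γ] {T : FreeSplitting Γ}

/-- The data for replacing the vertices of a free splitting `T` by trees: a `Γ`-set `W` over the
set of vertices of `T`, a graph on `W` whose components are the fibers, and an attaching
map, which assigns to each dart of `T` a point in the fiber over its initial vertex. The values of
`attach` at pairs which are not darts are irrelevant. By `reachable` and `cut` the fibers are
trees. -/
structure BlowUp (T : FreeSplitting Γ) where
  W : Type u
  [act : MulAction Γ W]
  proj : W → T.V
  fiber : SimpleGraph W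
  attach : T.V → T.V → W
  proj_smul : ∀ (g : Γ) x, proj (g • x) = g • proj x
  proj_fiber : ∀ x y, fiber.Adj x y → proj x = proj y
  proj_attach : ∀ v w, T.graph.Adj v w → proj (attach v w) = v
  attach_smul : ∀ (g : Γ) v w, T.graph.Adj v w → attach (g • v) (g • w) = g • attach v w
  smul_fiber : ∀ (g : Γ) x y, fiber.Adj x y → fiber.Adj (g • x) (g • y)
  reachable : ∀ x y, proj x = proj y → fiber.Reachable x y
  cut : ∀ x y, fiber.Adj x y → ∃ S : Set W, x ∈ S ∧ y ∉ S ∧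
    ∀ x' y', proj x' = proj x → fiber.Adj x' y' → x' ∈ S → y' ∉ S → x' = x ∧ y' = y
  edge_stabilizer : ∀ (g : Γ) x y, fiber.Adj x y → s(g • x, g • y) = s(x, y) → g = 1
  finite_fiber_orbits : ∃ F : Set (W × W), F.Finite ∧
    ∀ x y, fiber.Adj x y → ∃ p ∈ F, ∃ g : Γ, x = g • p.1 ∧ y = g • p.2

namespace BlowUp

attribute [instance] BlowUp.act

variable (B : BlowUp T)

/-- The tree obtained by replacing the vertices of `T` by the fibers. -/
def graph : SimpleGraph B.W where
  Adj x y := B.fiber.Adj x y ∨ (T.graph.Adj (B.proj x) (B.proj y) ∧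
    x = B.attach (B.proj x) (B.proj y) ∧ y = B.attach (B.proj y) (B.proj x))
  symm := ⟨fun _ _ h => h.imp SimpleGraph.Adj.symm fun h => ⟨h.1.symm, h.2.2, h.2.1⟩⟩
  loopless := ⟨fun _ h => h.elim (fun h => h.ne rfl) fun h => h.1.ne rfl⟩

variable {B}

lemma adj_of_fiber {x y : B.W} (h : B.fiber.Adj x y) : B.graph.Adj x y := Or.inl h

lemma adj_attach {v w : T.V} (h : T.graph.Adj v w) :
    B.graph.Adj (B.attach v w) (B.attach w v) := by
  right
  rw [B.proj_attach v w h, B.proj_attach w v h.symm]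
  exact ⟨h, rfl, rfl⟩

variable (B) in
lemma smul_adj (g : Γ) {x y : B.W} (h : B.graph.Adj x y) : B.graph.Adj (g • x) (g • y) := by
  rcases h with h | ⟨h, hx, hy⟩
  · exact adj_of_fiber (B.smul_fiber g x y h)
  · have h1 := adj_attach (B := B) (T.smul_adj g h)
    rwa [B.attach_smul g _ _ h, B.attach_smul g _ _ h.symm, ← hx, ← hy] at h1

variable (B) in
lemma connected : B.graph.Connected := by
  have hfib : ∀ x y, B.proj x = B.proj y → B.graph.Reachable x y := fun x y h =>
    (B.reachable x y h).mono fun _ _ => adj_of_fiber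
  obtain ⟨v₀⟩ : Nonempty T.V := inferInstance
  obtain ⟨a₀, ha₀⟩ := exists_adj v₀
  have : Nonempty B.W := ⟨B.attach v₀ a₀⟩
  refine ⟨fun x y => ?_⟩
  have key := T.isTree.connected.eq_univ_of_closed
    (A := {v | ∀ y, B.proj y = v → B.graph.Reachable x y}) (a := B.proj x)
    (fun y hy => hfib x y hy.symm) (fun v w h hv y hy => ?_)
  · exact key (B.proj y) y rfl
  · refine ((hv (B.attach v w) (B.proj_attach v w h)).trans (adj_attach h).reachable).trans ?_
    exact hfib _ _ (by rw [B.proj_attach w v h.symm, hy])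

/-- The walls of `T` pull back to walls of the blow-up. -/
lemma isWall_preimage {v w : T.V} (h : T.graph.Adj v w) :
    B.graph.IsWall (B.proj ⁻¹' T.graph.side v w) (B.attach v w) (B.attach w v) where
  adj := adj_attach h
  left_mem := by
    rw [Set.mem_preimage, B.proj_attach v w h]
    exact T.isTree.left_mem_side h
  right_notMem := by
    rw [Set.mem_preimage, B.proj_attach w v h.symm]
    exact T.isTree.right_notMem_side h
  unique := by
    rintro x y (hxy | ⟨hxy, hx, hy⟩) h1 h2
    · rw [Set.mem_preimage, ← B.proj_fiber x y hxy] at h2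
      exact absurd h1 h2
    · obtain ⟨h3, h4⟩ := (T.isTree.isWall_side h).unique _ _ hxy h1 h2
      exact ⟨hx.trans (by rw [h3, h4]), hy.trans (by rw [h3, h4])⟩

variable (B) in
/-- The walls of the blow-up are the walls of `T` and the cuts of the fibers, extended by the
retraction onto the fiber. -/
lemma isTree : B.graph.IsTree := by
  classical
  refine SimpleGraph.isTree_of_isWall B.connected fun x y hxy => ?_
  rcases hxy with hxy | ⟨hxy, hx, hy⟩
  · obtain ⟨S, h1, h2, h3⟩ := B.cut x y hxy
    have hxy' := B.proj_fiber x y hxy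
    have hn : ∀ z, ∃ a, z ≠ B.proj x → T.graph.Adj (B.proj x) a ∧ z ∈ T.graph.side a (B.proj x) := by
      intro z
      by_cases hz : z = B.proj x
      · exact ⟨z, fun h => absurd hz h⟩
      · exact (T.isTree.exists_adj_mem_side (Ne.symm hz)).imp fun a ha _ => ha
    choose n hn using hn
    -- the retraction of the tree onto the fiber which contains the given edge
    let ρ : B.W → B.W := fun z => if B.proj z = B.proj x then z else
      B.attach (B.proj x) (n (B.proj z))
    refine ⟨ρ ⁻¹' S, adj_of_fiber hxy, by simpa [ρ] using h1, by simpa [ρ, hxy'] using h2, ?_⟩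
    intro x' y' hxy'' hx' hy'
    have key : ∀ v, T.graph.Adj v (B.proj x) → n v = v := fun v hv =>
      (T.isTree.eq_of_mem_side hv.symm (hn v hv.ne).1 (T.isTree.left_mem_side hv) (hn v hv.ne).2).symm
    rcases hxy'' with h4 | ⟨h4, h5, h6⟩
    · have h5 := B.proj_fiber x' y' h4
      by_cases h6 : B.proj x' = B.proj x
      · refine h3 x' y' h6 h4 ?_ ?_
        · simpa [ρ, h6] using hx'
        · simpa [ρ, ← h5, h6] using hy'
      · simp only [Set.mem_preimage, ρ, ← h5, if_neg h6] at hx' hy'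
        exact absurd hx' hy'
    · exfalso
      by_cases h7 : B.proj x' = B.proj x
      · have h8 : B.proj y' ≠ B.proj x := by
          rw [← h7]
          exact h4.ne'
        simp only [Set.mem_preimage, ρ, if_pos h7, if_neg h8,
          key _ (h7 ▸ h4.symm)] at hx' hy'
        rw [h5, h7] at hx'
        exact hy' hx'
      · by_cases h8 : B.proj y' = B.proj x
        · simp only [Set.mem_preimage, ρ, if_neg h7, if_pos h8, key _ (h8 ▸ h4)] at hx' hy'
          rw [h6, h8] at hy'
          exact hy' hx'
        · simp only [Set.mem_preimage, ρ, if_neg h7, if_neg h8] at hx' hy'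
          have h9 : n (B.proj x') = n (B.proj y') := by
            have ha := hn _ h7
            have hb := hn _ h8
            refine T.isTree.eq_of_mem_side ha.1 hb.1 ha.2 ?_
            by_contra hc
            have := ((T.isTree.isWall_side hb.1.symm).unique _ _ h4.symm hb.2 hc).2
            exact h7 this
          rw [h9] at hx'
          exact hy' hx'
  · exact ⟨_, by
      have := isWall_preimage (B := B) hxy
      rwa [← hx, ← hy] at this⟩

variable (B) in
lemma finite_edge_orbits : ∃ F : Set (B.W × B.W), F.Finite ∧
    ∀ v w, B.graph.Adj v w → ∃ p ∈ F, ∃ g : Γ, v = g • p.1 ∧ w = g • p.2 := by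
  obtain ⟨F, hF, h⟩ := B.finite_fiber_orbits
  obtain ⟨F', hF', h'⟩ := T.finite_edge_orbits
  have : Finite F := hF
  have : Finite F' := hF'
  refine ⟨F ∪ (fun p => (B.attach p.1 p.2, B.attach p.2 p.1)) '' F', hF.union (hF'.image _), ?_⟩
  rintro x y (hxy | ⟨hxy, hx, hy⟩)
  · obtain ⟨p, hp, h⟩ := h x y hxy
    exact ⟨p, Or.inl hp, h⟩
  · obtain ⟨p, hp, g, h1, h2⟩ := h' _ _ hxy
    have h3 : T.graph.Adj p.1 p.2 := by rwa [h1, h2, smul_adj_iff] at hxy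
    refine ⟨_, Or.inr ⟨p, hp, rfl⟩, g, ?_, ?_⟩
    · rw [← B.attach_smul g _ _ h3, ← h1, ← h2, ← hx]
    · rw [← B.attach_smul g _ _ h3.symm, ← h1, ← h2, ← hy]

/-- The free splitting obtained by replacing the vertices of `T` by the fibers. -/
def tree (B : BlowUp T) (h : ∀ x, ∃ a b, B.graph.Adj x a ∧ B.graph.Adj x b ∧ a ≠ b) :
    FreeSplitting Γ where
  V := B.W
  graph := B.graph
  isTree := B.isTree
  smul_adj := fun g _ _ => B.smul_adj g
  not_point := by
    obtain ⟨x⟩ := B.connected.nonempty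
    obtain ⟨a, b, -, -, hab⟩ := h x
    exact ⟨a, b, hab⟩
  minimal := minimal_of_exists_two_adj B.isTree (fun g _ _ => B.smul_adj g) B.finite_edge_orbits h
  edge_stabilizer := by
    rintro g x y (hxy | ⟨hxy, -, -⟩) hs
    · exact B.edge_stabilizer g x y hxy hs
    · refine T.edge_stabilizer g hxy ?_
      have := congrArg (Sym2.map B.proj) hs
      simpa only [Sym2.map_mk, B.proj_smul] using this
  finite_edge_orbits := B.finite_edge_orbits

lemma isWallMap_proj (h : ∀ x, ∃ a b, B.graph.Adj x a ∧ B.graph.Adj x b ∧ a ≠ b) :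
    IsWallMap (X := B.tree h) (Y := T) B.proj where
  equivariant := B.proj_smul
  surjective := fun v =>
    let ⟨a, ha⟩ := exists_adj v
    ⟨B.attach v a, B.proj_attach v a ha⟩
  pull := fun v w hvw => ⟨B.attach v w, B.attach w v, adj_attach hvw, fun z =>
    Set.ext_iff.mp ((isWall_preimage hvw).eq_side B.connected) z⟩

end BlowUp

end FreeSplitting

/-! ### Pulling apart directions at a vertex -/

namespace FreeSplitting

variable {Γ : Type u} [Group Γ] {T : FreeSplitting Γ}

variable (T) in
/-- `T` has an expansion rel `𝒜` if it is the image of a free splitting rel `𝒜` under a wall map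
which identifies two relatively natural vertices. -/
def HasExpansion (𝒜 : FreeFactorSystem Γ) : Prop :=
  ∃ (U : FreeSplitting Γ) (p : U.V → T.V), IsWallMap p ∧ U.IsRel 𝒜 ∧
    ∃ z z', z ≠ z' ∧ p z = p z' ∧ U.IsNatVertex z ∧ U.IsNatVertex z'

/-- Pulling apart a vertex `v`: two darts `(v, x)` and `(v, y)` in different orbits are moved to a
new vertex with trivial stabilizer, which is connected to `v` by a new edge. The vertices of the
blow-up are those of `T` and the translates of the new vertex, which are indexed by `Γ`. -/
lemma hasExpansion_of_adj {𝒜 : FreeFactorSystem Γ} (hT : T.IsRel 𝒜) {v x y : T.V}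
    (hx : T.graph.Adj v x) (hy : T.graph.Adj v y)
    (hxy : ∀ g ∈ MulAction.stabilizer Γ v, g • x ≠ y)
    (hv : MulAction.stabilizer Γ v = ⊥ → ∃ a b, T.graph.Adj v a ∧ T.graph.Adj v b ∧ a ≠ b ∧
      a ≠ x ∧ a ≠ y ∧ b ≠ x ∧ b ≠ y) : T.HasExpansion 𝒜 := by
  classical
  have hne : x ≠ y := fun h => hxy 1 (one_mem _) (by rw [one_smul, h])
  have huniq : ∀ g g' : Γ, g • v = g' • v → (g • x = g' • x ∨ g • x = g' • y) ∨
      (g • y = g' • x ∨ g • y = g' • y) → g = g' := by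
    intro g g' h1 h2
    have h1' : (g'⁻¹ * g) • v = v := by rw [mul_smul, inv_smul_eq_iff, h1]
    have h1'' : (g⁻¹ * g') • v = v := by rw [mul_smul, inv_smul_eq_iff, h1]
    rcases h2 with (h2 | h2) | (h2 | h2)
    · exact (inv_mul_eq_one.mp (eq_one_of_smul_adj hx h1'
        (by rw [mul_smul, inv_smul_eq_iff, h2]))).symm
    · exact absurd (by rw [mul_smul, inv_smul_eq_iff, h2]) (hxy (g'⁻¹ * g) h1')
    · exact absurd (by rw [mul_smul, inv_smul_eq_iff, h2]) (hxy (g⁻¹ * g') h1'')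
    · exact (inv_mul_eq_one.mp (eq_one_of_smul_adj hy h1'
        (by rw [mul_smul, inv_smul_eq_iff, h2]))).symm
  -- `M u w g` says that the dart `(u, w)` is moved to the new vertex `g`
  let M : T.V → T.V → Γ → Prop := fun u w g => u = g • v ∧ (w = g • x ∨ w = g • y)
  have hM : ∀ u w g g', M u w g → M u w g' → g = g' := by
    rintro u w g g' ⟨h1, h2⟩ ⟨h3, h4⟩
    refine huniq g g' (h1.symm.trans h3) ?_
    rcases h2 with rfl | rfl
    · exact Or.inl h4
    · exact Or.inr h4
  let att : T.V → T.V → T.V ⊕ Γ := fun u w =>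
    if h : ∃ g, M u w g then Sum.inr h.choose else Sum.inl u
  have att_inr : ∀ u w g, M u w g → att u w = Sum.inr g := by
    intro u w g h
    have h' : ∃ g, M u w g := ⟨g, h⟩
    simp only [att, dif_pos h']
    exact congrArg _ (hM u w _ _ h'.choose_spec h)
  have att_inl : ∀ u w, (∀ g, ¬ M u w g) → att u w = Sum.inl u := by
    intro u w h
    simp only [att, dif_neg (not_exists.mpr h)]
  have M_smul : ∀ (k : Γ) u w g, M (k • u) (k • w) (k * g) ↔ M u w g := by
    intro k u w g
    simp only [M, mul_smul, smul_left_cancel_iff]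
  let F : SimpleGraph (T.V ⊕ Γ) :=
    { Adj := fun p q => ∃ g : Γ, (p = Sum.inr g ∧ q = Sum.inl (g • v)) ∨
        (q = Sum.inr g ∧ p = Sum.inl (g • v))
      symm := ⟨fun _ _ h => h.imp fun _ => Or.symm⟩
      loopless := ⟨by
        rintro p ⟨g, ⟨rfl, h⟩ | ⟨rfl, h⟩⟩ <;> simp at h⟩ }
  let B : BlowUp T :=
    { W := T.V ⊕ Γ
      proj := Sum.elim id fun g => g • v
      fiber := F
      attach := att
      proj_smul := by
        rintro g (u | k)
        · rfl
        · exact mul_smul g k v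
      proj_fiber := by
        rintro p q ⟨g, ⟨rfl, rfl⟩ | ⟨rfl, rfl⟩⟩ <;> rfl
      proj_attach := by
        intro u w _
        by_cases h : ∃ g, M u w g
        · obtain ⟨g, hg⟩ := h
          rw [att_inr u w g hg]
          exact hg.1.symm
        · rw [att_inl u w (not_exists.mp h)]
          rfl
      attach_smul := by
        intro g u w _
        by_cases h : ∃ g, M u w g
        · obtain ⟨k, hk⟩ := h
          rw [att_inr u w k hk, att_inr _ _ _ ((M_smul g u w k).mpr hk)]
          rfl
        · rw [att_inl u w (not_exists.mp h), att_inl]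
          · rfl
          · intro k hk
            refine not_exists.mp h (g⁻¹ * k) ((M_smul g u w _).mp ?_)
            rwa [mul_inv_cancel_left]
      smul_fiber := by
        rintro g p q ⟨k, ⟨rfl, rfl⟩ | ⟨rfl, rfl⟩⟩
        · exact ⟨g * k, Or.inl ⟨rfl, congrArg Sum.inl (mul_smul g k v).symm⟩⟩
        · exact ⟨g * k, Or.inr ⟨rfl, congrArg Sum.inl (mul_smul g k v).symm⟩⟩
      reachable := by
        have key : ∀ p : T.V ⊕ Γ, F.Reachable p
            (Sum.inl (Sum.elim id (fun g : Γ => g • v) p)) := by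
          rintro (u | g)
          · exact SimpleGraph.Reachable.refl _
          · exact SimpleGraph.Adj.reachable ⟨g, Or.inl ⟨rfl, rfl⟩⟩
        intro p q hpq
        have h1 := key p
        rw [hpq] at h1
        exact h1.trans (key q).symm
      cut := by
        rintro p q ⟨g, ⟨rfl, rfl⟩ | ⟨rfl, rfl⟩⟩
        · refine ⟨{Sum.inr g}, rfl, by simp, ?_⟩
          rintro p' q' - ⟨k, ⟨rfl, rfl⟩ | ⟨rfl, rfl⟩⟩ h1 h2
          · obtain rfl := Sum.inr_injective h1
            exact ⟨rfl, rfl⟩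
          · simp at h1
        · refine ⟨{Sum.inr g}ᶜ, by simp, by simp, ?_⟩
          rintro p' q' - ⟨k, ⟨rfl, rfl⟩ | ⟨rfl, rfl⟩⟩ h1 h2
          · simp at h2
          · obtain rfl := Sum.inr_injective (not_not.mp h2)
            exact ⟨rfl, rfl⟩
      edge_stabilizer := by
        have key : ∀ g k : Γ, s((Sum.inr (g * k) : T.V ⊕ Γ), Sum.inl (g • k • v)) =
            s(Sum.inr k, Sum.inl (k • v)) → g = 1 := by
          intro g k h
          rcases Sym2.eq_iff.mp h with ⟨h, -⟩ | ⟨h, -⟩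
          · simpa using h
          · simp at h
        rintro g p q ⟨k, ⟨rfl, rfl⟩ | ⟨rfl, rfl⟩⟩ h
        · exact key g k h
        · exact key g k (by rw [Sym2.eq_swap]; exact h.trans Sym2.eq_swap)
      finite_fiber_orbits := by
        refine ⟨{(Sum.inr 1, Sum.inl v), (Sum.inl v, Sum.inr 1)}, Set.toFinite _, ?_⟩
        rintro p q ⟨g, ⟨rfl, rfl⟩ | ⟨rfl, rfl⟩⟩
        · refine ⟨_, Or.inl rfl, g, ?_, rfl⟩
          exact congrArg Sum.inr (mul_one g).symm
        · refine ⟨_, Or.inr rfl, g, rfl, ?_⟩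
          exact congrArg Sum.inr (mul_one g).symm }
  have proj_att : ∀ u w, T.graph.Adj u w → B.proj (att u w) = u := B.proj_attach
  have adj_att : ∀ u w, T.graph.Adj u w → B.graph.Adj (att u w) (att w u) := fun u w h =>
    BlowUp.adj_attach (B := B) h
  have adj_new : ∀ g : Γ, B.graph.Adj (Sum.inr g) (Sum.inl (g • v)) := fun g =>
    BlowUp.adj_of_fiber (B := B) ⟨g, Or.inl ⟨rfl, rfl⟩⟩
  have hMx : ∀ g : Γ, att (g • v) (g • x) = Sum.inr g := fun g =>
    att_inr _ _ _ ⟨rfl, Or.inl rfl⟩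
  have hMy : ∀ g : Γ, att (g • v) (g • y) = Sum.inr g := fun g =>
    att_inr _ _ _ ⟨rfl, Or.inr rfl⟩
  have hnewx : ∀ g : Γ, B.graph.Adj (Sum.inr g) (att (g • x) (g • v)) := fun g => by
    rw [← hMx]
    exact adj_att _ _ (T.smul_adj g hx)
  have hnewy : ∀ g : Γ, B.graph.Adj (Sum.inr g) (att (g • y) (g • v)) := fun g => by
    rw [← hMy]
    exact adj_att _ _ (T.smul_adj g hy)
  have hold : MulAction.stabilizer Γ v = ⊥ → ∀ a, T.graph.Adj v a → a ≠ x → a ≠ y → ∀ g : Γ,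
      B.graph.Adj (Sum.inl (g • v)) (att (g • a) (g • v)) := by
    intro hbot a ha hax hay g
    have h1 : att (g • v) (g • a) = Sum.inl (g • v) := by
      refine att_inl _ _ ?_
      rintro k ⟨h2, h3⟩
      have h4 : k⁻¹ * g ∈ MulAction.stabilizer Γ v := by
        rw [MulAction.mem_stabilizer_iff, mul_smul, inv_smul_eq_iff, h2]
      rw [hbot, Subgroup.mem_bot, inv_mul_eq_one] at h4
      subst h4
      rcases h3 with h3 | h3
      · exact hax (smul_left_cancel k h3)
      · exact hay (smul_left_cancel k h3)
    rw [← h1]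
    exact adj_att _ _ (T.smul_adj g ha)
  have hB : ∀ z, ∃ a b, B.graph.Adj z a ∧ B.graph.Adj z b ∧ a ≠ b := by
    rintro (u | g)
    · by_cases hu : u ∈ MulAction.orbit Γ v
      · obtain ⟨g, rfl⟩ := hu
        by_cases hbot : MulAction.stabilizer Γ v = ⊥
        · obtain ⟨a, b, ha, hb, hab, hax, hay, hbx, hby⟩ := hv hbot
          refine ⟨_, _, hold hbot a ha hax hay g, hold hbot b hb hbx hby g, fun h => hab ?_⟩
          have h1 := congrArg B.proj h
          rw [proj_att _ _ (T.smul_adj g ha.symm), proj_att _ _ (T.smul_adj g hb.symm)] at h1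
          exact smul_left_cancel g h1
        · obtain ⟨k, hk, hkv⟩ := stabilizer_ne_bot_iff.mp hbot
          have h1 := adj_new (g * k)
          rw [mul_smul, hkv] at h1
          refine ⟨_, _, (adj_new g).symm, h1.symm, fun h => hk ?_⟩
          exact left_eq_mul.mp (Sum.inr_injective h)
      · obtain ⟨a, ha⟩ := exists_adj u
        obtain ⟨b, hb, hba⟩ := exists_adj_ne u a
        have h1 : ∀ a, att u a = Sum.inl u := fun a => att_inl _ _ fun g hg => hu ⟨g, hg.1.symm⟩
        have ha' := adj_att u a ha
        have hb' := adj_att u b hb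
        rw [h1] at ha' hb'
        refine ⟨_, _, ha', hb', fun h => hba ?_⟩
        have h2 := congrArg B.proj h
        rw [proj_att _ _ ha.symm, proj_att _ _ hb.symm] at h2
        exact h2.symm
    · refine ⟨_, _, adj_new g, hnewx g, fun h => ?_⟩
      have h1 := congrArg B.proj h
      rw [proj_att _ _ (T.smul_adj g hx.symm)] at h1
      exact (T.smul_adj g hx).ne h1
  refine ⟨B.tree hB, B.proj, BlowUp.isWallMap_proj hB, ?_, Sum.inr 1, Sum.inl v, Sum.inr_ne_inl,
    one_smul Γ v, Or.inl ?_, ?_⟩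
  · refine isRel_iff.mpr fun A hA => ?_
    obtain ⟨u, hu⟩ := isRel_iff.mp hT A hA
    exact ⟨Sum.inl u, fun a ha => congrArg Sum.inl (hu ha)⟩
  · have h1 := adj_new 1
    have h2 := hnewx 1
    have h3 := hnewy 1
    rw [one_smul, one_smul] at h2 h3
    rw [one_smul] at h1
    refine three_le_valence_iff.mpr ⟨_, _, _, h1, h2, h3, fun h => ?_, fun h => ?_, fun h => ?_⟩
    · have h4 := congrArg B.proj h
      rw [proj_att _ _ hx.symm] at h4
      exact hx.ne h4
    · have h4 := congrArg B.proj h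
      rw [proj_att _ _ hy.symm] at h4
      exact hy.ne h4
    · have h4 := congrArg B.proj h
      rw [proj_att _ _ hx.symm, proj_att _ _ hy.symm] at h4
      exact hne h4
  · by_cases hbot : MulAction.stabilizer Γ v = ⊥
    · obtain ⟨a, b, ha, hb, hab, hax, hay, hbx, hby⟩ := hv hbot
      have h1 := (adj_new 1).symm
      have h2 := hold hbot a ha hax hay 1
      have h3 := hold hbot b hb hbx hby 1
      rw [one_smul, one_smul] at h2 h3
      rw [one_smul] at h1
      refine Or.inl (three_le_valence_iff.mpr ⟨_, _, _, h1, h2, h3, fun h => ?_, fun h => ?_,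
        fun h => ?_⟩)
      · have h4 := congrArg B.proj h
        rw [proj_att _ _ ha.symm] at h4
        exact ha.ne ((one_smul Γ v).symm.trans h4)
      · have h4 := congrArg B.proj h
        rw [proj_att _ _ hb.symm] at h4
        exact hb.ne ((one_smul Γ v).symm.trans h4)
      · have h4 := congrArg B.proj h
        rw [proj_att _ _ ha.symm, proj_att _ _ hb.symm] at h4
        exact hab h4
    · obtain ⟨k, hk, hkv⟩ := stabilizer_ne_bot_iff.mp hbot
      exact Or.inr ((stabilizer_ne_bot_iff (T := B.tree hB)).mpr ⟨k, hk, congrArg Sum.inl hkv⟩)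

end FreeSplitting

/-! ### Expansions of free splittings which are not generic -/

namespace FreeSplitting

variable {Γ : Type u} [Group Γ] {T S : FreeSplitting Γ}

lemma smul_right_mem_side {g : Γ} {x y : T.V} (h : T.graph.Adj x y)
    (hx : g • x ∈ T.graph.side y x) : g • y ∈ T.graph.side y x := by
  by_contra hy
  obtain ⟨h1, h2⟩ := (T.isTree.isWall_side h.symm).unique _ _ (T.smul_adj g h) hx hy
  exact not_inversion h h1 h2

lemma smul_right_mem_side' {g : Γ} (hg : g ≠ 1) {x y : T.V} (h : T.graph.Adj x y)
    (hx : g • x ∈ T.graph.side x y) : g • y ∈ T.graph.side x y := by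
  by_contra hy
  obtain ⟨h1, h2⟩ := (T.isTree.isWall_side h).unique _ _ (T.smul_adj g h) hx hy
  exact hg (eq_one_of_smul_adj h h1 h2)

/-- If a subgroup has no global fixed point then there is an edge which has translates under
the subgroup on both sides: an edge on the axis of an element without fixed points or, if there is
no such element, an edge at the fixed point of one element on the way to the fixed point of another
one. -/
lemma exists_separating_edge (H : Subgroup Γ) (hH : ∀ a : T.V, ∃ h ∈ H, h • a ≠ a) :
    ∃ x y, T.graph.Adj x y ∧ (∃ h ∈ H, h • x ∈ T.graph.side x y ∧ h • y ∈ T.graph.side x y) ∧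
      ∃ k ∈ H, k • x ∈ T.graph.side y x ∧ k • y ∈ T.graph.side y x := by
  have hdich := fun g : Γ => exists_fixed_or_axis g (T := T) (S := Set.univ) Set.univ_nonempty
    (fun _ _ _ _ => Set.subset_univ _) (fun _ _ => Set.mem_univ _)
  by_cases hhyp : ∃ g ∈ H, ∀ a : T.V, g • a ≠ a
  · obtain ⟨g, hg, hno⟩ := hhyp
    obtain ⟨x, -, y, z, hy, hz, hyz, h1, h2⟩ := (hdich g).resolve_left fun ⟨a, _, ha⟩ => hno a ha
    have h3 : g⁻¹ • x ∈ T.graph.side x y := by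
      rw [T.isTree.mem_side_symm hy.symm]
      intro h4
      exact hyz (T.isTree.eq_of_mem_side hy hz h4 h2)
    have hg1 : g⁻¹ ≠ 1 := by
      intro h
      rw [inv_eq_one] at h
      exact hno x (by rw [h, one_smul])
    exact ⟨x, y, hy, ⟨g⁻¹, inv_mem hg, h3, smul_right_mem_side' hg1 hy h3⟩,
      ⟨g, hg, h1, smul_right_mem_side hy h1⟩⟩
  · push Not at hhyp
    obtain ⟨a₀⟩ : Nonempty T.V := inferInstance
    obtain ⟨h, hh, hne⟩ := hH a₀
    have hh1 : h ≠ 1 := by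
      rintro rfl
      exact hne (one_smul _ _)
    obtain ⟨a, ha⟩ := hhyp h hh
    obtain ⟨k, hk, hka⟩ := hH a
    have hk1 : k ≠ 1 := by
      rintro rfl
      exact hka (one_smul _ _)
    obtain ⟨b, hb⟩ := hhyp k hk
    have hab : a ≠ b := fun h => hka (h ▸ hb)
    obtain ⟨x, hx, hbx⟩ := T.isTree.exists_adj_mem_side hab
    have h1 : h • a ∈ T.graph.side a x := by
      rw [ha]
      exact T.isTree.left_mem_side hx
    have h2 : k • a ∈ T.graph.side x a := by
      by_contra h3
      rw [T.isTree.mem_side_symm hx, not_not] at h3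
      obtain ⟨c, hc, hac⟩ := T.isTree.exists_adj_mem_side hab.symm
      have hc' : T.graph.Adj b (k • c) := by
        have := T.smul_adj k hc
        rwa [hb] at this
      have hac' : k • a ∈ T.graph.side (k • c) b := by
        have := (smul_mem_side k).mpr hac
        rwa [hb] at this
      have h4 : b ∈ T.graph.seg a (k • a) := T.isTree.mem_seg_of_ne hc hc' hac hac' fun h5 =>
        hk1 (eq_one_of_smul_adj hc hb h5.symm)
      have h6 := T.isTree.mem_side_of_mem_seg h4 hx (T.isTree.left_mem_side hx) h3
      exact (T.isTree.mem_side_symm hx).mp hbx h6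
    exact ⟨a, x, hx, ⟨h, hh, h1, smul_right_mem_side' hh1 hx h1⟩,
      ⟨k, hk, h2, smul_right_mem_side hx h2⟩⟩

/-- A family of collapses of the tree `S`, indexed by a `Γ`-set: for each index, the set of those
edges (with both orientations) which are kept. -/
structure TreeFamily (P : Type u) [MulAction Γ P] (S : FreeSplitting Γ) where
  keep : P → S.V → S.V → Prop
  symm : ∀ {p c d}, keep p c d → keep p d c
  adj : ∀ {p c d}, keep p c d → S.graph.Adj c d
  smul : ∀ {p c d} (g : Γ), keep p c d → keep (g • p) (g • c) (g • d)

namespace TreeFamily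

variable {P : Type u} [MulAction Γ P] {e : TreeFamily P S}

variable (e) in
/-- Two vertices of `S` are identified in the fiber over `p` unless they are separated by an edge
which is kept. -/
def setoid : Setoid (P × S.V) where
  r a b := a.1 = b.1 ∧ ∀ c d, e.keep a.1 c d →
    (a.2 ∈ S.graph.side c d ↔ b.2 ∈ S.graph.side c d)
  iseqv :=
    { refl := fun _ => ⟨rfl, fun _ _ _ => Iff.rfl⟩
      symm := fun h => ⟨h.1.symm, fun c d hcd => (h.2 c d (h.1 ▸ hcd)).symm⟩
      trans := fun h h' => ⟨h.1.trans h'.1, fun c d hcd =>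
        (h.2 c d hcd).trans (h'.2 c d (h.1 ▸ hcd))⟩ }

variable (e) in
/-- The disjoint union over the index set of the vertex sets of the collapsed trees. -/
def W : Type u := Quotient e.setoid

variable (e) in
/-- The point of the fiber over `p` given by a vertex of `S`. -/
def pt (p : P) (a : S.V) : e.W := Quotient.mk e.setoid (p, a)

lemma exists_pt (z : e.W) : ∃ p a, z = e.pt p a := by
  obtain ⟨⟨p, a⟩, rfl⟩ := Quotient.exists_rep z
  exact ⟨p, a, rfl⟩

lemma pt_eq_iff {p p' : P} {a b : S.V} : e.pt p a = e.pt p' b ↔ p = p' ∧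
    ∀ c d, e.keep p c d → (a ∈ S.graph.side c d ↔ b ∈ S.graph.side c d) :=
  Quotient.eq (r := e.setoid)

lemma setoid_smul (g : Γ) {a b : P × S.V} (h : e.setoid a b) : e.setoid (g • a) (g • b) := by
  refine ⟨congrArg (g • ·) h.1, fun c d hcd => ?_⟩
  have h1 := e.smul g⁻¹ hcd
  change e.keep (g⁻¹ • g • a.1) _ _ at h1
  rw [inv_smul_smul] at h1
  have h2 := h.2 _ _ h1
  have key : ∀ z : S.V, z ∈ S.graph.side (g⁻¹ • c) (g⁻¹ • d) ↔ g • z ∈ S.graph.side c d := by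
    intro z
    rw [← smul_mem_side g, smul_inv_smul, smul_inv_smul]
  exact (key _).symm.trans (h2.trans (key _))

instance : MulAction Γ e.W where
  smul g := Quotient.map (g • ·) fun _ _ => setoid_smul g
  one_smul z := by
    obtain ⟨p, a, rfl⟩ := exists_pt z
    exact congrArg (Quotient.mk e.setoid) (one_smul Γ (p, a))
  mul_smul g h z := by
    obtain ⟨p, a, rfl⟩ := exists_pt z
    exact congrArg (Quotient.mk e.setoid) (mul_smul g h (p, a))

lemma smul_pt (g : Γ) (p : P) (a : S.V) : g • e.pt p a = e.pt (g • p) (g • a) := rfl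

variable (e) in
/-- The projection to the index set. -/
def proj : e.W → P := Quotient.lift Prod.fst fun _ _ h => h.1

lemma exists_pt_proj (z : e.W) : ∃ a, z = e.pt (e.proj z) a := by
  obtain ⟨p, a, rfl⟩ := exists_pt z
  exact ⟨a, rfl⟩

variable (e) in
/-- The edges of the collapsed trees are the edges which are kept. -/
def fiber : SimpleGraph e.W where
  Adj z z' := ∃ p c d, e.keep p c d ∧ z = e.pt p c ∧ z' = e.pt p d
  symm := ⟨by
    rintro _ _ ⟨p, c, d, h, rfl, rfl⟩
    exact ⟨p, d, c, e.symm h, rfl, rfl⟩⟩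
  loopless := ⟨by
    rintro _ ⟨p, c, d, h, rfl, h'⟩
    exact S.isTree.right_notMem_side (e.adj h)
      (((pt_eq_iff.mp h').2 c d h).mp (S.isTree.left_mem_side (e.adj h)))⟩

lemma fiber_adj {p : P} {c d : S.V} (h : e.keep p c d) :
    e.fiber.Adj (e.pt p c) (e.pt p d) := ⟨p, c, d, h, rfl, rfl⟩

lemma exists_of_fiber_adj {p : P} {a : S.V} {z : e.W} (h : e.fiber.Adj (e.pt p a) z) :
    ∃ c d, e.keep p c d ∧ e.pt p a = e.pt p c ∧ z = e.pt p d := by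
  obtain ⟨p', c, d, h, h1, rfl⟩ := h
  obtain rfl : p = p' := congrArg e.proj h1
  exact ⟨c, d, h, h1, rfl⟩

lemma pt_eq_of_not_keep {p : P} {c d : S.V} (hcd : S.graph.Adj c d) (h : ¬ e.keep p c d) :
    e.pt p c = e.pt p d := by
  refine pt_eq_iff.mpr ⟨rfl, fun c' d' h' => ?_⟩
  have hW := S.isTree.isWall_side (e.adj h')
  by_contra hne
  by_cases hc' : c ∈ S.graph.side c' d'
  · obtain ⟨rfl, rfl⟩ := hW.unique _ _ hcd hc' fun hd' => hne ⟨fun _ => hd', fun _ => hc'⟩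
    exact h h'
  · have hd' : d ∈ S.graph.side c' d' := by
      by_contra hd'
      exact hne ⟨fun h => absurd h hc', fun h => absurd h hd'⟩
    obtain ⟨rfl, rfl⟩ := hW.unique _ _ hcd.symm hd' hc'
    exact h (e.symm h')

lemma fiber_reachable (p : P) (a b : S.V) : e.fiber.Reachable (e.pt p a) (e.pt p b) := by
  refine S.isTree.connected.eq_univ_of_closed
    (A := {b | e.fiber.Reachable (e.pt p a) (e.pt p b)}) (a := a) (SimpleGraph.Reachable.refl _)
    (fun c d hcd hc => SimpleGraph.Reachable.trans hc ?_) b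
  by_cases h : e.keep p c d
  · exact (fiber_adj h).reachable
  · rw [pt_eq_of_not_keep hcd h]

/-- The side of an edge of a fiber. It is contained in this fiber. -/
def fiberSide (e : TreeFamily P S) (p : P) (c d : S.V) : Set e.W :=
  {z | ∃ a, z = e.pt p a ∧ a ∈ S.graph.side c d}

lemma pt_mem_fiberSide {p : P} {a c d : S.V} (h : e.keep p c d) :
    e.pt p a ∈ e.fiberSide p c d ↔ a ∈ S.graph.side c d := by
  refine ⟨?_, fun ha => ⟨a, rfl, ha⟩⟩
  rintro ⟨b, hb, hb'⟩
  exact ((pt_eq_iff.mp hb).2 c d h).mpr hb'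

lemma fiberSide_unique {p : P} {c d : S.V} (h : e.keep p c d) {z z' : e.W}
    (hz : e.fiber.Adj z z') (h1 : z ∈ e.fiberSide p c d) (h2 : z' ∉ e.fiberSide p c d) :
    z = e.pt p c ∧ z' = e.pt p d := by
  obtain ⟨b, rfl, hb⟩ := h1
  obtain ⟨c', d', h', h3, rfl⟩ := exists_of_fiber_adj hz
  have h4 : c' ∈ S.graph.side c d := ((pt_eq_iff.mp h3).2 c d h).mp hb
  obtain ⟨rfl, rfl⟩ := (S.isTree.isWall_side (e.adj h)).unique _ _ (e.adj h') h4
    fun hd => h2 ((pt_mem_fiberSide h).mpr hd)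
  exact ⟨h3, rfl⟩

lemma exists_equivariant (T : FreeSplitting Γ) {X : Type*} [MulAction Γ X] (x : X) :
    ∃ f : T.Dart → X, ∀ (g : Γ) d, f (g • d) = g • f d := by
  obtain ⟨γ, -, hγ⟩ := exists_transporter T
  exact ⟨fun d => γ d • x, fun g d => by simp only [hγ, mul_smul]⟩

lemma eq_one_of_fiber_adj {z z' : e.W} (hz : e.fiber.Adj z z') {g : Γ}
    (hs : s(g • z, g • z') = s(z, z')) : g = 1 := by
  obtain ⟨p, c, d, h, rfl, rfl⟩ := hz
  have hl := S.isTree.left_mem_side (e.adj h)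
  have hr := S.isTree.right_notMem_side (e.adj h)
  have hW := S.isTree.isWall_side (e.adj h)
  rw [smul_pt, smul_pt] at hs
  rcases Sym2.eq_iff.mp hs with ⟨h1, h2⟩ | ⟨h1, h2⟩
  · obtain ⟨hp, -⟩ := pt_eq_iff.mp h1
    rw [hp] at h1 h2
    have h3 := ((pt_eq_iff.mp h1).2 c d h).mpr hl
    have h4 := fun h4 => hr (((pt_eq_iff.mp h2).2 c d h).mp h4)
    obtain ⟨h5, h6⟩ := hW.unique _ _ (S.smul_adj g (e.adj h)) h3 h4
    exact eq_one_of_smul_adj (e.adj h) h5 h6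
  · obtain ⟨hp, -⟩ := pt_eq_iff.mp h1
    rw [hp] at h1 h2
    have h3 := ((pt_eq_iff.mp h2).2 c d h).mpr hl
    have h4 := fun h4 => hr (((pt_eq_iff.mp h1).2 c d h).mp h4)
    obtain ⟨h5, h6⟩ := hW.unique _ _ (S.smul_adj g (e.adj h).symm) h3 h4
    exact (not_inversion (e.adj h) h6 h5).elim

lemma smul_fiber (g : Γ) {z z' : e.W} (h : e.fiber.Adj z z') : e.fiber.Adj (g • z) (g • z') := by
  obtain ⟨p, c, d, h, rfl, rfl⟩ := h
  exact fiber_adj (e.smul g h)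

open scoped Classical in
/-- The blow-up of the vertices of `T` by means of a family of collapses of the tree `S`. Each dart
is attached at a translate of the given vertex `x`, chosen equivariantly. -/
noncomputable def blowUp (e : TreeFamily T.V S) (x : S.V)
    (hfin : ∃ F : Set (e.W × e.W), F.Finite ∧
      ∀ z z', e.fiber.Adj z z' → ∃ p ∈ F, ∃ g : Γ, z = g • p.1 ∧ z' = g • p.2) : BlowUp T where
  W := e.W
  proj := e.proj
  fiber := e.fiber
  attach v w := if h : T.graph.Adj v w then
    e.pt v ((exists_equivariant T x).choose ⟨(v, w), h⟩) else e.pt v x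
  proj_smul g z := by
    obtain ⟨p, a, rfl⟩ := exists_pt z
    rfl
  proj_fiber := by
    rintro _ _ ⟨p, c, d, -, rfl, rfl⟩
    rfl
  proj_attach v w h := by
    rw [dif_pos h]
    rfl
  attach_smul g v w h := by
    rw [dif_pos h, dif_pos (T.smul_adj g h), smul_pt]
    exact congrArg (e.pt (g • v)) ((exists_equivariant T x).choose_spec g ⟨(v, w), h⟩)
  smul_fiber g _ _ h := smul_fiber g h
  reachable z z' h := by
    obtain ⟨p, a, rfl⟩ := exists_pt z
    obtain ⟨p', b, rfl⟩ := exists_pt z'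
    obtain rfl : p = p' := h
    exact fiber_reachable p a b
  cut := by
    rintro _ _ ⟨p, c, d, h, rfl, rfl⟩
    refine ⟨e.fiberSide p c d, (pt_mem_fiberSide h).mpr (S.isTree.left_mem_side (e.adj h)),
      fun h' => S.isTree.right_notMem_side (e.adj h) ((pt_mem_fiberSide h).mp h'), ?_⟩
    exact fun z z' _ hz h1 h2 => fiberSide_unique h hz h1 h2
  edge_stabilizer _ _ _ hz hs := eq_one_of_fiber_adj hz hs
  finite_fiber_orbits := hfin

lemma exists_fiber_adj {p : P} {c d : S.V} (h : e.keep p c d) (a : S.V) :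
    ∃ c d, e.keep p c d ∧ e.pt p a = e.pt p c := by
  obtain ⟨b, hb⟩ : ∃ b, e.pt p a ≠ e.pt p b := by
    by_contra! hall
    exact (fiber_adj h).ne ((hall c).symm.trans (hall d))
  obtain ⟨w⟩ := fiber_reachable (e := e) p a b
  generalize e.pt p b = q at hb w
  cases w with
  | nil => exact absurd rfl hb
  | cons h' _ =>
    obtain ⟨c, d, h1, h2, -⟩ := exists_of_fiber_adj h'
    exact ⟨c, d, h1, h2⟩

/-- If there is another edge of the fiber on the side of `c` then the vertex `c` of the fiber has a
second neighbour. -/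
lemma exists_fiber_adj_ne {p : P} {c d c' d' : S.V} (h : e.keep p c d)
    (h' : e.keep p c' d') (hc : c' ∈ S.graph.side c d) (hd : d' ∈ S.graph.side c d) :
    ∃ z, e.fiber.Adj (e.pt p c) z ∧ z ≠ e.pt p d := by
  by_contra! hno
  obtain ⟨q, hq, hq'⟩ : ∃ q, q ∈ S.graph.side c d ∧ e.pt p q ≠ e.pt p c := by
    by_contra! hall
    exact (fiber_adj h').ne ((hall c' hc).trans (hall d' hd).symm)
  have closed : ∀ z z', e.fiber.Adj z z' → z ∈ e.fiberSide p c d \ {e.pt p c} →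
      z' ∈ e.fiberSide p c d \ {e.pt p c} := by
    rintro z z' hz ⟨h1, h2⟩
    by_contra h3
    by_cases h4 : z' ∈ e.fiberSide p c d
    · have h5 : z' = e.pt p c := by
        by_contra h5
        exact h3 ⟨h4, h5⟩
      subst h5
      rw [hno z hz.symm, pt_mem_fiberSide h] at h1
      exact S.isTree.right_notMem_side (e.adj h) h1
    · exact h2 (fiberSide_unique h hz h1 h4).1
  have hreach : ∀ z z', e.fiber.Reachable z z' → z ∈ e.fiberSide p c d \ {e.pt p c} →
      z' ∈ e.fiberSide p c d \ {e.pt p c} := by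
    rintro z z' ⟨w⟩ hz
    induction w with
    | nil => exact hz
    | cons hadj _ ih => exact ih (closed _ _ hadj hz)
  exact (hreach _ _ (fiber_reachable p q c) ⟨(pt_mem_fiberSide h).mpr hq, hq'⟩).2 rfl

end TreeFamily

/-- A free splitting rel `𝒜` has an expansion if some vertex group fixes no vertex of some other
free splitting `S` rel `𝒜`. The vertices in the orbit of this vertex `v` are replaced by copies of
a collapse of `S` in which the vertex group still has no fixed point, and the darts at `v` are
attached arbitrarily but equivariantly. -/
lemma hasExpansion_of_no_fixed {𝒜 : FreeFactorSystem Γ} (hT : T.IsRel 𝒜) (hS : S.IsRel 𝒜)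
    (v : T.V) (hv : ∀ a : S.V, ∃ h ∈ MulAction.stabilizer Γ v, h • a ≠ a) :
    T.HasExpansion 𝒜 := by
  obtain ⟨x, y, hxy, ⟨h, hh, hhx, hhy⟩, k, hk, hkx, hky⟩ := exists_separating_edge _ hv
  -- the fiber over `v` keeps the translates of the edge from `x` to `y` under the stabilizer of `v`
  let e : TreeFamily T.V S :=
    { keep := fun p c d => ∃ g : Γ, p = g • v ∧
        ((c = g • x ∧ d = g • y) ∨ (c = g • y ∧ d = g • x))
      symm := fun ⟨g, h1, h2⟩ => ⟨g, h1, h2.symm.imp And.symm And.symm⟩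
      adj := by
        rintro p c d ⟨g, -, ⟨rfl, rfl⟩ | ⟨rfl, rfl⟩⟩
        · exact S.smul_adj g hxy
        · exact S.smul_adj g hxy.symm
      smul := by
        rintro p c d k ⟨g, rfl, ⟨rfl, rfl⟩ | ⟨rfl, rfl⟩⟩
        · exact ⟨k * g, by simp only [mul_smul], Or.inl (by simp only [mul_smul, and_self])⟩
        · exact ⟨k * g, by simp only [mul_smul], Or.inr (by simp only [mul_smul, and_self])⟩ }
  have hfin : ∃ F : Set (e.W × e.W), F.Finite ∧
      ∀ z z', e.fiber.Adj z z' → ∃ p ∈ F, ∃ g : Γ, z = g • p.1 ∧ z' = g • p.2 := by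
    refine ⟨{(e.pt v x, e.pt v y), (e.pt v y, e.pt v x)}, Set.toFinite _, ?_⟩
    rintro _ _ ⟨_, _, _, ⟨g, rfl, ⟨rfl, rfl⟩ | ⟨rfl, rfl⟩⟩, rfl, rfl⟩
    · exact ⟨_, Or.inl rfl, g, rfl, rfl⟩
    · exact ⟨_, Or.inr rfl, g, rfl, rfl⟩
  let B := e.blowUp x hfin
  -- every edge which is kept is moved to its other side by the stabilizer of the index
  have hmove : ∀ p c d, e.keep p c d → ∃ k : Γ, k • p = p ∧ k • c ∈ S.graph.side d c ∧
      k • d ∈ S.graph.side d c := by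
    rintro _ _ _ ⟨g, rfl, ⟨rfl, rfl⟩ | ⟨rfl, rfl⟩⟩
    · refine ⟨g * k * g⁻¹, ?_, ?_, ?_⟩
      · rw [mul_smul, inv_smul_smul, mul_smul]
        exact congrArg (g • ·) hk
      · rw [mul_smul, inv_smul_smul, mul_smul]
        exact (smul_mem_side g).mpr hkx
      · rw [mul_smul, inv_smul_smul, mul_smul]
        exact (smul_mem_side g).mpr hky
    · refine ⟨g * h * g⁻¹, ?_, ?_, ?_⟩
      · rw [mul_smul, inv_smul_smul, mul_smul]
        exact congrArg (g • ·) hh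
      · rw [mul_smul, inv_smul_smul, mul_smul]
        exact (smul_mem_side g).mpr hhy
      · rw [mul_smul, inv_smul_smul, mul_smul]
        exact (smul_mem_side g).mpr hhx
  have htwo : ∀ p a, p ∈ MulAction.orbit Γ v → ∃ z z', e.fiber.Adj (e.pt p a) z ∧
      e.fiber.Adj (e.pt p a) z' ∧ z ≠ z' := by
    rintro _ a ⟨g, rfl⟩
    have h1 : e.keep (g • v) (g • x) (g • y) := ⟨g, rfl, Or.inl ⟨rfl, rfl⟩⟩
    obtain ⟨c, d, h2, h3⟩ := TreeFamily.exists_fiber_adj h1 a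
    obtain ⟨m, hm1, hm2, hm3⟩ := hmove _ _ _ (e.symm h2)
    have h4 := e.smul m h2
    rw [hm1] at h4
    obtain ⟨z, hz, hz'⟩ := TreeFamily.exists_fiber_adj_ne h2 h4 hm3 hm2
    rw [h3]
    exact ⟨z, _, hz, TreeFamily.fiber_adj h2, hz'⟩
  have hB : ∀ z, ∃ a b, B.graph.Adj z a ∧ B.graph.Adj z b ∧ a ≠ b := by
    intro (z : e.W)
    obtain ⟨p, a, rfl⟩ := TreeFamily.exists_pt z
    by_cases hp : p ∈ MulAction.orbit Γ v
    · obtain ⟨z, z', h1, h2, h3⟩ := htwo p a hp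
      exact ⟨z, z', BlowUp.adj_of_fiber (B := B) h1,
        BlowUp.adj_of_fiber (B := B) h2, h3⟩
    · have h1 : ∀ b, e.pt p a = e.pt p b := fun b => TreeFamily.pt_eq_iff.mpr ⟨rfl, fun c d h => by
        obtain ⟨g, h, -⟩ := h
        exact absurd ⟨g, h.symm⟩ hp⟩
      have h2 : ∀ w, T.graph.Adj p w → e.pt p a = B.attach p w := fun w hw => by
        obtain ⟨b, hb⟩ := TreeFamily.exists_pt_proj (e := e) (B.attach p w)
        have h3 : e.proj (B.attach p w) = p := B.proj_attach p w hw
        rw [hb, h3]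
        exact h1 b
      obtain ⟨w, hw⟩ := exists_adj p
      obtain ⟨w', hw', hne⟩ := exists_adj_ne p w
      have h3 := BlowUp.adj_attach (B := B) hw
      have h4 := BlowUp.adj_attach (B := B) hw'
      rw [← h2 w hw] at h3
      rw [← h2 w' hw'] at h4
      refine ⟨_, _, h3, h4, fun h5 => hne ?_⟩
      rw [← B.proj_attach w p hw.symm, ← B.proj_attach w' p hw'.symm, h5]
  obtain ⟨q, hq⟩ := exists_adj v
  obtain ⟨a, ha⟩ := TreeFamily.exists_pt_proj (e := e) (B.attach v q)
  have hpv : e.proj (B.attach v q) = v := B.proj_attach v q hq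
  rw [hpv] at ha
  have hnat : (B.tree hB).IsNatVertex (e.pt v a) := by
    obtain ⟨z, z', h1, h2, h3⟩ := htwo v a (MulAction.mem_orbit_self v)
    have h4 := BlowUp.adj_attach (B := B) hq
    rw [ha] at h4
    have h5 : ∀ z, e.fiber.Adj (e.pt v a) z → z ≠ B.attach q v := by
      rintro _ hz rfl
      have h6 := B.proj_fiber _ _ hz
      rw [B.proj_attach q v hq.symm] at h6
      exact hq.ne h6
    exact Or.inl (three_le_valence_iff.mpr ⟨z, z', _, BlowUp.adj_of_fiber (B := B) h1,
      BlowUp.adj_of_fiber (B := B) h2, h4, h3, h5 z h1, h5 z' h2⟩)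
  have h1 : e.keep v x y := ⟨1, (one_smul _ _).symm,
    Or.inl ⟨(one_smul _ _).symm, (one_smul _ _).symm⟩⟩
  obtain ⟨c, d, h2, h3⟩ := TreeFamily.exists_fiber_adj h1 a
  obtain ⟨m, hm1, hm2, -⟩ := hmove _ _ _ h2
  refine ⟨B.tree hB, B.proj, BlowUp.isWallMap_proj hB, isRel_iff.mpr fun A hA => ?_,
    e.pt v a, m • e.pt v a, fun h4 => ?_, hm1.symm, hnat, ?_⟩
  · obtain ⟨p, hp⟩ := isRel_iff.mp hT A hA
    obtain ⟨b, hb⟩ := isRel_iff.mp hS A hA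
    refine ⟨e.pt p b, fun g hg => ?_⟩
    have h4 : g • p = p := hp hg
    have h5 : g • b = b := hb hg
    change e.pt (g • p) (g • b) = e.pt p b
    rw [h4, h5]
  · rw [h3, TreeFamily.smul_pt, hm1] at h4
    have h5 := ((TreeFamily.pt_eq_iff.mp h4).2 c d h2).mp (S.isTree.left_mem_side (e.adj h2))
    exact (S.isTree.mem_side_symm (e.adj h2)).mp hm2 h5
  · exact (smul_isNatVertex (T := B.tree hB) m).mpr hnat

/-- A free splitting rel `𝒜` which is not generic has an expansion. By the previous results, in a
free splitting without expansions the vertex groups fix vertices of `S`, so they represent elements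
of `𝒜`, and there are no directions at a vertex which could be pulled apart. -/
lemma IsRel.hasExpansion {𝒜 : FreeFactorSystem Γ} (hT : T.IsRel 𝒜)
    (hS : S.vertexSystem = 𝒜.components) (hgen : ¬ T.IsGeneric 𝒜) : T.HasExpansion 𝒜 := by
  by_contra hno
  have hSrel := isRel_of_vertexSystem_eq hS
  have hfix : ∀ v : T.V, ∃ a : S.V, MulAction.stabilizer Γ v ≤ MulAction.stabilizer Γ a := by
    intro v
    by_contra! h
    refine hno (hasExpansion_of_no_fixed hT hSrel v fun a => ?_)
    obtain ⟨g, hg, hga⟩ := SetLike.not_le_iff_exists.mp (h a)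
    exact ⟨g, hg, hga⟩
  -- `T` and `S` are both rel `𝒜` and a nontrivial subgroup fixes at most one vertex, so the
  -- nontrivial vertex groups of both trees coincide
  have hsys : T.vertexSystem = 𝒜.components := by
    have key : ∀ (v : T.V) (a : S.V), MulAction.stabilizer Γ v ≠ ⊥ →
        MulAction.stabilizer Γ v ≤ MulAction.stabilizer Γ a →
        MulAction.stabilizer Γ v = MulAction.stabilizer Γ a ∧
          conjClassOf (MulAction.stabilizer Γ a) ∈ 𝒜.components := by
      intro v a hv hle
      have ha : conjClassOf (MulAction.stabilizer Γ a) ∈ 𝒜.components := by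
        rw [← hS]
        exact ⟨a, fun h => hv (le_bot_iff.mp (h ▸ hle)), rfl⟩
      obtain ⟨w, hw⟩ := isRel_iff.mp hT _ ha
      obtain rfl := eq_of_le_stabilizer hv le_rfl (hle.trans hw)
      exact ⟨le_antisymm hle hw, ha⟩
    ext c
    constructor
    · rintro ⟨v, hv, rfl⟩
      obtain ⟨a, ha⟩ := hfix v
      obtain ⟨h1, h2⟩ := key v a hv ha
      rwa [h1]
    · intro hc
      obtain ⟨A, rfl⟩ := Quotient.exists_rep c
      have hA := FreeFactorSystem.ne_bot hc
      obtain ⟨v, hv⟩ := isRel_iff.mp hT A hc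
      obtain ⟨a, ha⟩ := hfix v
      have hv' : MulAction.stabilizer Γ v ≠ ⊥ := fun h => hA (le_bot_iff.mp (h ▸ hv))
      obtain ⟨b, -, hb⟩ : ∃ b : S.V, MulAction.stabilizer Γ b ≠ ⊥ ∧
          conjClassOf (MulAction.stabilizer Γ b) = conjClassOf A := hS.symm.le hc
      obtain ⟨k, hk⟩ := exists_le_stabilizer hb.symm le_rfl
      have hab := eq_of_le_stabilizer hA (hv.trans ha) hk
      have h1 := (key v a hv' ha).1
      refine ⟨v, hv', ?_⟩
      rw [h1, hab, conjClassOf_stabilizer_smul]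
      exact hb
  refine hgen ⟨hsys, fun v => ⟨fun hv => ?_, fun hv x y hx hy => ?_⟩⟩
  · by_contra hval
    obtain ⟨x, y, a, hx, hy, ha, hxy, hxa, hya⟩ := three_le_valence_iff.mp (not_le.mp hval).le
    obtain ⟨b, hb, hbn⟩ : ∃ b, T.graph.Adj v b ∧ b ∉ ({x, y, a} : Set T.V) := by
      by_contra! hall
      refine hval ((Set.encard_le_encard (t := {x, y, a}) fun b hb => hall b hb).trans ?_)
      exact (Set.encard_insert_le _ _).trans (by
        rw [Set.encard_pair hya]
        norm_num)
    simp only [Set.mem_insert_iff, Set.mem_singleton_iff, not_or] at hbn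
    refine hno (hasExpansion_of_adj hT hx hy ?_ fun _ =>
      ⟨a, b, ha, hb, Ne.symm hbn.2.2, hxa.symm, hya.symm, hbn.1, hbn.2.1⟩)
    intro g hg
    rw [hv, Subgroup.mem_bot] at hg
    rwa [hg, one_smul]
  · by_contra! hxy
    exact hno (hasExpansion_of_adj hT hx hy hxy fun h => absurd h hv)

end FreeSplitting

/-! ### Collapsing one orbit of edges -/

namespace FreeSplitting

variable {Γ : Type u} [Group Γ] {X T S : FreeSplitting Γ}

lemma TreeFamily.isWall_fiberSide {P : Type u} [MulAction Γ P] {e : TreeFamily P X} {p : P}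
    {c d : X.V} (h : e.keep p c d) :
    e.fiber.IsWall (e.fiberSide p c d) (e.pt p c) (e.pt p d) where
  adj := fiber_adj h
  left_mem := (pt_mem_fiberSide h).mpr (X.isTree.left_mem_side (e.adj h))
  right_notMem h' := X.isTree.right_notMem_side (e.adj h) ((pt_mem_fiberSide h).mp h')
  unique _ _ hz h1 h2 := fiberSide_unique h hz h1 h2

lemma TreeFamily.isTree_fiber {e : TreeFamily PUnit.{u + 1} X} : e.fiber.IsTree := by
  have hconn : e.fiber.Connected := by
    obtain ⟨a⟩ : Nonempty X.V := inferInstance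
    have : Nonempty e.W := ⟨e.pt ⟨⟩ a⟩
    refine ⟨fun z z' => ?_⟩
    obtain ⟨⟨⟩, a, rfl⟩ := exists_pt z
    obtain ⟨⟨⟩, b, rfl⟩ := exists_pt z'
    exact fiber_reachable _ a b
  refine SimpleGraph.isTree_of_isWall hconn ?_
  rintro _ _ ⟨p, c, d, h, rfl, rfl⟩
  exact ⟨_, isWall_fiberSide h⟩

/-- A free splitting can be collapsed along an invariant set of edges which does not contain all
edges; here `K` is the set of those edges which are not collapsed. Every wall map which collapses at
least these edges factors through the result. -/
lemma exists_collapse (K : X.V → X.V → Prop) (hsymm : ∀ c d, K c d → K d c)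
    (hadj : ∀ c d, K c d → X.graph.Adj c d) (hsmul : ∀ (g : Γ) c d, K c d → K (g • c) (g • d))
    (hne : ∃ c d, K c d) :
    ∃ (Z : FreeSplitting Γ) (q : X.V → Z.V), IsWallMap q ∧
      (∀ c d, X.graph.Adj c d → (q c = q d ↔ ¬ K c d)) ∧
      ∀ (Y : FreeSplitting Γ) (f : X.V → Y.V), IsWallMap f →
        (∀ c d, X.graph.Adj c d → ¬ K c d → f c = f d) → ∃ f' : Z.V → Y.V, IsWallMap f' := by
  let e : TreeFamily PUnit.{u + 1} X :=
    { keep := fun _ => K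
      symm := hsymm _ _
      adj := hadj _ _
      smul := fun g => hsmul g _ _ }
  have hfin : ∃ F : Set (e.W × e.W), F.Finite ∧
      ∀ z z', e.fiber.Adj z z' → ∃ p ∈ F, ∃ g : Γ, z = g • p.1 ∧ z' = g • p.2 := by
    obtain ⟨F, hF, h⟩ := X.finite_edge_orbits
    refine ⟨(fun p => (e.pt ⟨⟩ p.1, e.pt ⟨⟩ p.2)) '' F, hF.image _, ?_⟩
    rintro _ _ ⟨⟨⟩, c, d, hcd, rfl, rfl⟩
    obtain ⟨p, hp, g, rfl, rfl⟩ := h c d (hadj c d hcd)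
    exact ⟨_, ⟨p, hp, rfl⟩, g, rfl, rfl⟩
  obtain ⟨c₀, d₀, hcd₀⟩ := hne
  have htwo : ∀ z, ∃ a b, e.fiber.Adj z a ∧ e.fiber.Adj z b ∧ a ≠ b := by
    intro z
    obtain ⟨⟨⟩, a, rfl⟩ := TreeFamily.exists_pt z
    obtain ⟨c, d, (h1 : K c d), h2⟩ := TreeFamily.exists_fiber_adj (e := e) (p := ⟨⟩) hcd₀ a
    obtain ⟨g, hg, hg'⟩ := exists_smul_mem_side₂ (hadj _ _ h1) (hadj _ _ hcd₀)
    obtain ⟨z, hz, hz'⟩ := TreeFamily.exists_fiber_adj_ne (e := e) (p := ⟨⟩) h1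
      (hsmul g _ _ hcd₀) hg hg'
    rw [h2]
    exact ⟨z, _, hz, TreeFamily.fiber_adj h1, hz'⟩
  let Z : FreeSplitting Γ :=
    { V := e.W
      graph := e.fiber
      isTree := TreeFamily.isTree_fiber
      smul_adj := fun g _ _ h => TreeFamily.smul_fiber g h
      not_point := ⟨_, _, (TreeFamily.fiber_adj (e := e) (p := ⟨⟩) hcd₀).ne⟩
      minimal := minimal_of_exists_two_adj TreeFamily.isTree_fiber
        (fun g _ _ h => TreeFamily.smul_fiber g h) hfin htwo
      edge_stabilizer := fun g _ _ h hs => TreeFamily.eq_one_of_fiber_adj h hs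
      finite_edge_orbits := hfin }
  have hside : ∀ c d, K c d → ∀ z, e.pt ⟨⟩ z ∈ Z.graph.side (e.pt ⟨⟩ c) (e.pt ⟨⟩ d) ↔
      z ∈ X.graph.side c d := by
    intro c d h z
    have hW := TreeFamily.isWall_fiberSide (e := e) (p := ⟨⟩) h
    rw [← hW.eq_side Z.isTree.connected]
    exact TreeFamily.pt_mem_fiberSide h
  have hq : IsWallMap (X := X) (Y := Z) (e.pt ⟨⟩) :=
    { equivariant := fun g v => rfl
      surjective := fun z => by
        obtain ⟨⟨⟩, a, rfl⟩ := TreeFamily.exists_pt z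
        exact ⟨a, rfl⟩
      pull := by
        rintro _ _ ⟨⟨⟩, c, d, h, rfl, rfl⟩
        exact ⟨c, d, hadj c d h, hside c d h⟩ }
  refine ⟨Z, e.pt ⟨⟩, hq, fun c d hcd => ⟨fun h hK => ?_, fun hK => ?_⟩, fun Y f hf hfK => ?_⟩
  · exact (TreeFamily.fiber_adj (e := e) (p := ⟨⟩) hK).ne h
  · exact TreeFamily.pt_eq_of_not_keep (e := e) hcd hK
  · -- an edge of `Y` comes from an edge which is kept
    have hkeep : ∀ y y', Y.graph.Adj y y' → ∃ c d, K c d ∧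
        ∀ z, f z ∈ Y.graph.side y y' ↔ z ∈ X.graph.side c d := by
      intro y y' h
      obtain ⟨c, d, hcd, h1⟩ := hf.pull y y' h
      refine ⟨c, d, ?_, h1⟩
      by_contra hK
      have h2 := (h1 c).mpr (X.isTree.left_mem_side hcd)
      rw [hfK c d hcd hK, h1] at h2
      exact X.isTree.right_notMem_side hcd h2
    have hlift : ∀ a b, e.pt ⟨⟩ a = e.pt ⟨⟩ b → f a = f b := by
      intro a b hab
      refine Y.isTree.eq_of_forall_side fun y y' h ha => ?_
      obtain ⟨c, d, hK, h1⟩ := hkeep y y' h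
      rw [h1] at ha ⊢
      exact ((TreeFamily.pt_eq_iff.mp hab).2 c d hK).mp ha
    have hex : ∀ z : e.W, ∃ y, ∀ a, z = e.pt ⟨⟩ a → f a = y := by
      intro z
      obtain ⟨⟨⟩, a, rfl⟩ := TreeFamily.exists_pt z
      exact ⟨f a, fun b hb => hlift b a hb.symm⟩
    choose f' hf' using hex
    have hf'' : ∀ a, f' (e.pt ⟨⟩ a) = f a := fun a => (hf' _ a rfl).symm
    refine ⟨f', fun g (z : e.W) => ?_, fun y => ?_, fun y y' h => ?_⟩
    · obtain ⟨⟨⟩, a, rfl⟩ := TreeFamily.exists_pt z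
      rw [hf'', ← hf.equivariant, ← hf'']
      rfl
    · obtain ⟨a, rfl⟩ := hf.surjective y
      exact ⟨_, hf'' a⟩
    · obtain ⟨c, d, hK, h1⟩ := hkeep y y' h
      refine ⟨_, _, TreeFamily.fiber_adj (e := e) (p := ⟨⟩) hK, fun (z : e.W) => ?_⟩
      obtain ⟨⟨⟩, a, rfl⟩ := TreeFamily.exists_pt z
      rw [hf'', h1]
      exact (hside c d hK a).symm

lemma NatAdj.adj_of_forall (hX : ∀ v, X.IsNatVertex v) {v w : X.V} (h : X.NatAdj v w) :
    X.graph.Adj v w := by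
  obtain ⟨a, ha, hwa⟩ := X.isTree.exists_adj_mem_side h.1
  have h1 : a ∈ X.graph.seg v w := by
    rw [SimpleGraph.mem_seg, SimpleGraph.dist_eq_one_iff_adj.mpr ha,
      X.isTree.dist_eq_of_mem_side ha hwa, add_comm]
  rcases h.2.2.2 a h1 (hX a) with rfl | rfl
  · exact absurd rfl ha.ne
  · exact ha

lemma natAdj_of_adj (hX : ∀ v, X.IsNatVertex v) {v w : X.V} (h : X.graph.Adj v w) :
    X.NatAdj v w :=
  ⟨h.ne, hX v, hX w, fun z hz _ => by rwa [X.isTree.seg_eq_pair_of_adj h] at hz⟩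

lemma IsWallMap.isRel {𝒜 : FreeFactorSystem Γ} {f : T.V → S.V} (hf : IsWallMap f)
    (hT : T.IsRel 𝒜) : S.IsRel 𝒜 := by
  refine isRel_iff.mpr fun A hA => ?_
  obtain ⟨v, hv⟩ := isRel_iff.mp hT A hA
  refine ⟨f v, fun g hg => ?_⟩
  rw [MulAction.mem_stabilizer_iff, ← hf.equivariant, show g • v = v from hv hg]

/-- Collapsing one orbit of edges of a tree all of whose vertices are relatively natural. Wall maps
which collapse an edge in this orbit factor through the result. -/
lemma exists_elementary_collapse (hX : ∀ v, X.IsNatVertex v) {x y : X.V} (hxy : X.graph.Adj x y)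
    (hne : ∃ c d, X.graph.Adj c d ∧
      X.graph.seg c d ∉ MulAction.orbit Γ (X.graph.seg x y)) :
    ∃ (Z : FreeSplitting Γ) (q : X.V → Z.V), IsWallMap q ∧
      X.natEdgeOrbits.ncard = Z.natEdgeOrbits.ncard + 1 ∧
      ∀ (Y : FreeSplitting Γ) (f : X.V → Y.V), IsWallMap f → f x = f y →
        ∃ f' : Z.V → Y.V, IsWallMap f' := by
  obtain ⟨c₀, d₀, h0, h0'⟩ := hne
  obtain ⟨Z, q, hq, hqK, huniv⟩ := exists_collapse
    (fun c d => X.graph.Adj c d ∧ X.graph.seg c d ∉ MulAction.orbit Γ (X.graph.seg x y))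
    (fun c d h => ⟨h.1.symm, by rw [SimpleGraph.seg_comm d c]; exact h.2⟩) (fun c d h => h.1)
    (fun g c d h => ⟨X.smul_adj g h.1, fun hmem => h.2 (by
      rw [← smul_seg] at hmem
      simpa using MulAction.mem_orbit_of_mem_orbit g⁻¹ hmem)⟩) ⟨c₀, d₀, h0, h0'⟩
  refine ⟨Z, q, hq, ?_, fun Y f hf hfxy => huniv Y f hf fun c d hcd hK => ?_⟩
  · have hZ : Z.HasNat := ⟨q x, hq.isNatVertex (hX x)⟩
    rw [hq.toCollapseMap.ncard_natEdgeOrbits hZ, Nat.add_left_cancel_iff]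
    rw [Set.ncard_eq_one]
    refine ⟨MulAction.orbit Γ (X.graph.seg x y), Set.Subset.antisymm ?_ ?_⟩
    · rintro _ ⟨s, ⟨hs, hs'⟩, rfl⟩
      obtain ⟨v, w, hvw, rfl⟩ := mem_natEdges.mp hs
      have h1 : X.graph.Adj v w := hvw.adj_of_forall hX
      have h2 : q v = q w := hs' v (SimpleGraph.left_mem_seg _ _) w (SimpleGraph.right_mem_seg _ _)
      have h3 := (hqK v w h1).mp h2
      have h4 : X.graph.seg v w ∈ MulAction.orbit Γ (X.graph.seg x y) := by
        by_contra h4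
        exact h3 ⟨h1, h4⟩
      exact MulAction.orbit_eq_iff.mpr h4
    · rintro _ rfl
      have h1 : q x = q y := (hqK x y hxy).mpr fun h => h.2 (MulAction.mem_orbit_self _)
      refine ⟨X.graph.seg x y, ⟨mem_natEdges.mpr ⟨x, y, natAdj_of_adj hX hxy, rfl⟩, ?_⟩, rfl⟩
      intro a ha b hb
      exact (hq.fiber_convex rfl h1.symm ha).trans (hq.fiber_convex rfl h1.symm hb).symm
  · have h1 : X.graph.seg c d ∈ MulAction.orbit Γ (X.graph.seg x y) := by
      by_contra h1
      exact hK ⟨hcd, h1⟩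
    obtain ⟨g, hg⟩ := h1
    have h2 : X.graph.seg (g • x) (g • y) = X.graph.seg c d := by
      rw [← smul_seg]
      exact hg
    have h3 : f (g • x) = f (g • y) := by rw [hf.equivariant, hf.equivariant, hfxy]
    have hc : c ∈ X.graph.seg (g • x) (g • y) := h2 ▸ SimpleGraph.left_mem_seg _ _
    have hd : d ∈ X.graph.seg (g • x) (g • y) := h2 ▸ SimpleGraph.right_mem_seg _ _
    exact (hf.fiber_convex rfl h3.symm hc).trans (hf.fiber_convex rfl h3.symm hd).symm

lemma ncard_natEdgeOrbits_natTree (hT : T.HasNat) :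
    (T.natTree hT).natEdgeOrbits.ncard = T.natEdgeOrbits.ncard :=
  (natIso_of_cls_eq (natTree_cls hT)).ncard_natEdgeOrbits_eq (natTree_hasNat hT)

/-- A free splitting with several orbits of relatively natural edges collapses properly. -/
lemma exists_natCollapse_of_two_le {𝒜 : FreeFactorSystem Γ} (hrel : T.IsRel 𝒜) (hT : T.HasNat)
    (h : 2 ≤ T.natEdgeOrbits.ncard) :
    ∃ Z : FreeSplitting Γ, Z.IsRel 𝒜 ∧ NatCollapse T Z ∧
      T.natEdgeOrbits.ncard = Z.natEdgeOrbits.ncard + 1 := by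
  have hX := natTree_isNatVertex hT
  obtain ⟨x⟩ : Nonempty (T.natTree hT).V := inferInstance
  obtain ⟨y, hxy⟩ := exists_adj x
  have hne : ∃ c d, (T.natTree hT).graph.Adj c d ∧ (T.natTree hT).graph.seg c d ∉
      MulAction.orbit Γ ((T.natTree hT).graph.seg x y) := by
    by_contra! hall
    have h1 : (T.natTree hT).natEdgeOrbits ⊆
        {MulAction.orbit Γ ((T.natTree hT).graph.seg x y)} := by
      rintro _ ⟨s, hs, rfl⟩
      obtain ⟨v, w, hvw, rfl⟩ := mem_natEdges.mp hs
      exact MulAction.orbit_eq_iff.mpr (hall v w (hvw.adj_of_forall hX))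
    have h2 := Set.ncard_le_ncard h1
    rw [Set.ncard_singleton, ncard_natEdgeOrbits_natTree] at h2
    omega
  obtain ⟨Z, q, hq, hE, -⟩ := exists_elementary_collapse hX hxy hne
  rw [ncard_natEdgeOrbits_natTree] at hE
  have hZ : Z.HasNat := ⟨q x, hq.isNatVertex (hX x)⟩
  exact ⟨Z, hq.isRel ((natTree_isRel hT).mpr hrel),
    ((natIso_of_cls_eq (natTree_cls hT)).symm.natCollapse hT).trans (hq.natCollapse hZ), hE⟩

/-- A collapse which loses orbits of edges factors through a collapse which loses exactly one. -/
lemma NatCollapse.exists_between {𝒜 : FreeFactorSystem Γ} (hrel : T.IsRel 𝒜)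
    (h : NatCollapse T S) (hE : S.natEdgeOrbits.ncard < T.natEdgeOrbits.ncard) :
    ∃ Z : FreeSplitting Γ, Z.IsRel 𝒜 ∧ NatCollapse T Z ∧ NatCollapse Z S ∧
      T.natEdgeOrbits.ncard = Z.natEdgeOrbits.ncard + 1 := by
  obtain ⟨hT, hS, f, hf⟩ := h
  have hX := natTree_isNatVertex hT
  obtain ⟨x, y, hxy, hfxy⟩ : ∃ x y, (T.natTree hT).graph.Adj x y ∧ f x = f y := by
    by_contra! hno
    have h1 := hf.card_dartOrbits
    have h2 : IsWallMap.collapsedOrbits f = ∅ := by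
      refine Set.eq_empty_of_forall_notMem ?_
      rintro _ ⟨d, -, hd⟩
      exact hno _ _ d.2 hd
    rw [h2, Set.ncard_empty, two_mul_ncard_natEdgeOrbits, two_mul_ncard_natEdgeOrbits] at h1
    omega
  have hne : ∃ c d, (T.natTree hT).graph.Adj c d ∧ (T.natTree hT).graph.seg c d ∉
      MulAction.orbit Γ ((T.natTree hT).graph.seg x y) := by
    obtain ⟨s⟩ : Nonempty (S.natTree hS).V := inferInstance
    obtain ⟨s', hs⟩ := exists_adj s
    obtain ⟨c, d, hcd, h1, h2, -⟩ := hf.exists_lift hs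
    refine ⟨c, d, hcd, ?_⟩
    rintro ⟨g, hg⟩
    have h3 : f (g • x) = f (g • y) := by rw [hf.equivariant, hf.equivariant, hfxy]
    have h4 : (T.natTree hT).graph.seg (g • x) (g • y) = (T.natTree hT).graph.seg c d := by
      rw [← smul_seg]
      exact hg
    have hc : c ∈ (T.natTree hT).graph.seg (g • x) (g • y) := h4 ▸ SimpleGraph.left_mem_seg _ _
    have hd : d ∈ (T.natTree hT).graph.seg (g • x) (g • y) := h4 ▸ SimpleGraph.right_mem_seg _ _
    refine hs.ne ?_
    rw [← h1, ← h2]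
    exact (hf.fiber_convex rfl h3.symm hc).trans (hf.fiber_convex rfl h3.symm hd).symm
  obtain ⟨Z, q, hq, hE', huniv⟩ := exists_elementary_collapse hX hxy hne
  rw [ncard_natEdgeOrbits_natTree] at hE'
  have hZ : Z.HasNat := ⟨q x, hq.isNatVertex (hX x)⟩
  obtain ⟨f', hf'⟩ := huniv _ f hf hfxy
  exact ⟨Z, hq.isRel ((natTree_isRel hT).mpr hrel),
    ((natIso_of_cls_eq (natTree_cls hT)).symm.natCollapse hT).trans (hq.natCollapse hZ),
    (hf'.natCollapse (natTree_hasNat hS)).trans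
      ((natIso_of_cls_eq (natTree_cls hS)).natCollapse (natTree_hasNat hS)), hE'⟩

/-- An expansion has strictly more orbits of relatively natural edges. -/
lemma HasExpansion.exists_collapseMap {𝒜 : FreeFactorSystem Γ} (h : T.HasExpansion 𝒜)
    (hT : T.HasNat) : ∃ U : FreeSplitting Γ, U.IsRel 𝒜 ∧ Nonempty (CollapseMap U T) ∧
      T.natEdgeOrbits.ncard < U.natEdgeOrbits.ncard := by
  obtain ⟨U, p, hp, hU, z, z', hne, hpz, hz, hz'⟩ := h
  refine ⟨U, hU, ⟨hp.toCollapseMap⟩, ?_⟩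
  have hUn : U.HasNat := ⟨z, hz⟩
  refine lt_of_le_of_ne (hp.natCollapse hT).ncard_le fun hE => hne ?_
  have hinj := ((hp.natMap hUn hT).natIso_of_ncard hE).1
  have h1 := @hinj ⟨z, hz⟩ ⟨z', hz'⟩ (Subtype.ext hpz)
  exact congrArg Subtype.val h1

end FreeSplitting

/-! ### Chains of collapses -/

namespace FreeSplitting

variable {Γ : Type u} [Group Γ] {S T : FreeSplitting Γ} {𝒜 : FreeFactorSystem Γ}

lemma one_le_ncard_natEdgeOrbits (hT : T.HasNat) : 1 ≤ T.natEdgeOrbits.ncard := by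
  rw [Nat.one_le_iff_ne_zero, Nat.ne_zero_iff_zero_lt, Set.ncard_pos (natEdgeOrbits_finite hT)]
  obtain ⟨x⟩ : Nonempty (T.natTree hT).V := inferInstance
  obtain ⟨y, hxy⟩ := (T.natTree hT).isTree.1.preconnected.exists_adj_of_nontrivial x
  exact ⟨_, _, mem_natEdges.mpr ⟨_, _, (natTree_adj hT).mp hxy, rfl⟩, rfl⟩

lemma NatCollapse.cls_eq (h : NatCollapse T S)
    (hE : T.natEdgeOrbits.ncard = S.natEdgeOrbits.ncard) : T.cls = S.cls :=
  (h.natIso hE.symm).cls_eq h.1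

/-- The number of orbits of relatively natural edges of a class of free splittings, computed for a
chosen representative. If there are relatively natural vertices then it does not depend on the
representative. -/
noncomputable def edgeCount (c : Class Γ) : ℕ := (Quot.out c).natEdgeOrbits.ncard

lemma cls_out (c : Class Γ) : (Quot.out c).cls = c := Quot.out_eq c

/-- Generic free splittings are those with the maximal number of orbits of edges, and those which
are not collapses of other free splittings rel `𝒜`, since the others have expansions. -/
theorem tfae_isGeneric (hΓ : FreelyDecomposable Γ) (h𝒜 : 𝒜.IsProper) (hT : T.IsRel 𝒜) :
    [ (T.natEdgeOrbits.ncard : ℤ) = 𝒜.depthFS + 1, T.IsGeneric 𝒜,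
      ∀ U : FreeSplitting Γ, U.IsRel 𝒜 → Nonempty (CollapseMap U T) → U.cls = T.cls ].TFAE := by
  have hn := hT.hasNat hΓ
  tfae_have 2 → 1 := fun h => h.ncard_natEdgeOrbits hn
  tfae_have 1 → 3 := by
    rintro h U hU ⟨f⟩
    have hc := f.natCollapse hn
    have h1 := hU.ncard_natEdgeOrbits_le hc.1
    have h2 := hc.ncard_le
    exact hc.cls_eq (by omega)
  tfae_have 3 → 2 := by
    intro h
    by_contra hgen
    obtain ⟨S, hS⟩ := exists_vertexSystem_eq hΓ h𝒜
    obtain ⟨U, hU, hf, hE⟩ := (hT.hasExpansion hS hgen).exists_collapseMap hn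
    have h1 := (natIso_of_cls_eq (h U hU hf)).symm.ncard_natEdgeOrbits_eq hn
    omega
  tfae_finish

section Faces

variable {s t : Finset (Class Γ)}

/-- Distinct vertices of a simplex have different numbers of edge orbits. -/
lemma edgeCount_injOn (hΓ : FreelyDecomposable Γ) (hs : s ∈ (relFreeSplittingComplex 𝒜).faces) :
    Set.InjOn edgeCount (s : Set (Class Γ)) := by
  have key : ∀ c ∈ s, ∀ d ∈ s, edgeCount c = edgeCount d → Prec c d → c = d := by
    intro c hc d hd he h
    rw [← cls_out c, ← cls_out d] at h
    rw [← cls_out c] at hc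
    have h1 := (prec_iff ((hs.2 _ hc).hasNat hΓ)).mp h
    rw [← cls_out c, ← cls_out d]
    exact (h1.cls_eq he.symm).symm
  intro c hc d hd he
  by_contra hne
  rcases hs.1.2 hc hd hne with h | h
  · exact hne (key c hc d hd he h)
  · exact hne (key d hd c hc he.symm h).symm

/-- A simplex has at most `D_FS(𝒜) + 1` vertices, since the numbers of edge orbits of its
vertices are distinct and lie between `1` and `D_FS(𝒜) + 1`. -/
lemma card_le_of_mem_faces (hΓ : FreelyDecomposable Γ)
    (hs : s ∈ (relFreeSplittingComplex 𝒜).faces) : (s.card : ℤ) ≤ 𝒜.depthFS + 1 := by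
  have hb : ∀ c ∈ s, 1 ≤ edgeCount c ∧ (edgeCount c : ℤ) ≤ 𝒜.depthFS + 1 := by
    intro c hc
    rw [← cls_out c] at hc
    have hrel := hs.2 _ hc
    exact ⟨one_le_ncard_natEdgeOrbits (hrel.hasNat hΓ),
      hrel.ncard_natEdgeOrbits_le (hrel.hasNat hΓ)⟩
  have h1 : s.card ≤ (Finset.Icc 1 (𝒜.depthFS + 1).toNat).card :=
    Finset.card_le_card_of_injOn edgeCount (fun c hc => by
      have := hb c hc
      simp only [Finset.coe_Icc, Set.mem_Icc]
      omega) (edgeCount_injOn hΓ hs)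
  rw [Nat.card_Icc] at h1
  obtain ⟨c, hc⟩ := hs.1.1
  have := hb c hc
  omega

open scoped Classical in
lemma insert_mem_faces (hs : s ∈ (relFreeSplittingComplex 𝒜).faces) (hT : T.IsRel 𝒜)
    (h : ∀ c ∈ s, Prec T.cls c ∨ Prec c T.cls) :
    insert T.cls s ∈ (relFreeSplittingComplex 𝒜).faces := by
  refine ⟨⟨Finset.insert_nonempty _ _, ?_⟩, fun U hU => ?_⟩
  · rw [Finset.coe_insert]
    exact hs.1.2.insert fun c hc _ => h c hc
  · rcases Finset.mem_insert.mp hU with h1 | h1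
    · exact (natIso_of_cls_eq h1.symm).isRel hT
    · exact hs.2 U h1

lemma singleton_mem_faces (hT : T.IsRel 𝒜) :
    {T.cls} ∈ (relFreeSplittingComplex 𝒜).faces := by
  refine ⟨⟨Finset.singleton_nonempty _, ?_⟩, fun U hU => ?_⟩
  · rw [Finset.coe_singleton]
    exact Set.subsingleton_singleton.isChain
  · exact (natIso_of_cls_eq (Finset.mem_singleton.mp hU).symm).isRel hT

/-- A maximal simplex contains the class of every free splitting rel `𝒜` comparable with all its
vertices. -/
lemma cls_mem_of_maximal (hs : Maximal (fun t => t ∈ (relFreeSplittingComplex 𝒜).faces) s)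
    (hT : T.IsRel 𝒜) (h : ∀ c ∈ s, Prec T.cls c ∨ Prec c T.cls) : T.cls ∈ s := by
  classical
  exact hs.2 (insert_mem_faces hs.1 hT h) (Finset.subset_insert _ _) (Finset.mem_insert_self _ _)

/-- The vertices of a simplex, in the order of increasing numbers of edge orbits. -/
lemma exists_sorted (hΓ : FreelyDecomposable Γ) (hs : s ∈ (relFreeSplittingComplex 𝒜).faces) :
    ∃ (D : ℕ) (c : Fin (D + 1) → Class Γ), (s : Set (Class Γ)) = Set.range c ∧
      StrictMono fun d => edgeCount (c d) := by
  classical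
  obtain ⟨D, hD⟩ : ∃ D, s.card = D + 1 :=
    Nat.exists_eq_succ_of_ne_zero (Finset.card_ne_zero.mpr hs.1.1)
  have hcard : (s.image edgeCount).card = D + 1 := by
    rw [Finset.card_image_of_injOn (edgeCount_injOn hΓ hs), hD]
  let e := (s.image edgeCount).orderEmbOfFin hcard
  have he : ∀ d, ∃ c ∈ s, edgeCount c = e d := fun d =>
    Finset.mem_image.mp (Finset.orderEmbOfFin_mem _ hcard d)
  choose c hc hce using he
  refine ⟨D, c, Set.Subset.antisymm (fun x hx => ?_) ?_, fun i j hij => ?_⟩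
  · have hx' : edgeCount x ∈ Set.range e := by
      rw [Finset.range_orderEmbOfFin]
      exact Finset.mem_coe.mpr (Finset.mem_image_of_mem _ hx)
    obtain ⟨d, hd⟩ := hx'
    exact ⟨d, edgeCount_injOn hΓ hs (hc d) hx ((hce d).trans hd)⟩
  · rintro _ ⟨d, rfl⟩
    exact hc d
  · simp only [hce]
    exact e.strictMono hij

/-- Every simplex is realized by a sequence of relatively natural collapse maps. -/
theorem exists_collapse_sequence (hΓ : FreelyDecomposable Γ)
    (hs : s ∈ (relFreeSplittingComplex 𝒜).faces) :
    ∃ (D : ℕ) (T : Fin (D + 1) → FreeSplitting Γ)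
      (f : ∀ d : Fin D, CollapseMap (T d.succ) (T d.castSucc)),
      Function.Injective (fun d => (T d).cls) ∧
      (s : Set (Class Γ)) = Set.range (fun d => (T d).cls) ∧ ∀ d, (f d).IsRelNatural := by
  obtain ⟨D, c, hc, hmono⟩ := exists_sorted hΓ hs
  have hmem : ∀ d, c d ∈ s := fun d => Finset.mem_coe.mp (hc ▸ Set.mem_range_self d)
  have hn : ∀ d, (Quot.out (c d)).HasNat := fun d =>
    (hs.2 _ (by rw [cls_out]; exact hmem d)).hasNat hΓ
  have hcls : ∀ d, ((Quot.out (c d)).natTree (hn d)).cls = c d := fun d =>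
    (natTree_cls _).trans (cls_out _)
  have hmap : ∀ d : Fin D, ∃ p : ((Quot.out (c d.succ)).natTree (hn _)).V →
      ((Quot.out (c d.castSucc)).natTree (hn _)).V, IsWallMap p := by
    intro d
    have hlt : edgeCount (c d.castSucc) < edgeCount (c d.succ) := hmono d.castSucc_lt_succ
    have hprec : Prec (c d.castSucc) (c d.succ) := by
      rcases hs.1.2 (hmem d.castSucc) (hmem d.succ) (fun h => by rw [h] at hlt; omega) with h | h
      · exact h
      · rw [← cls_out (c d.castSucc), ← cls_out (c d.succ)] at h
        have := ((prec_iff (hn _)).mp h).ncard_le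
        exact absurd hlt (not_lt.mpr this)
    rw [← cls_out (c d.castSucc), ← cls_out (c d.succ)] at hprec
    obtain ⟨_, _, p, hp⟩ := (prec_iff (hn _)).mp hprec
    exact ⟨p, hp⟩
  choose p hp using hmap
  refine ⟨D, fun d => (Quot.out (c d)).natTree (hn d), fun d => (hp d).toCollapseMap, ?_, ?_,
    fun d => (hp d).isRelNatural (natTree_isNatVertex _)⟩
  · simp only [hcls]
    exact fun i j hij => hmono.injective (congrArg edgeCount hij)
  · simp only [hcls]
    exact hc

lemma natCollapse_of_le {D : ℕ} {T : Fin (D + 1) → FreeSplitting Γ} (hn : ∀ d, (T d).HasNat)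
    (h : ∀ d : Fin D, NatCollapse (T d.succ) (T d.castSucc)) {i j : Fin (D + 1)} (hij : i ≤ j) :
    NatCollapse (T j) (T i) := by
  induction j using Fin.induction with
  | zero =>
    rw [Fin.le_zero_iff.mp hij]
    exact (NatIso.refl _).natCollapse (hn _)
  | succ d ih =>
    rcases hij.eq_or_lt with rfl | hlt
    · exact (NatIso.refl _).natCollapse (hn _)
    · exact (h d).trans (ih (Fin.le_castSucc_iff.mpr hlt))

/-- Characterization of the maximal simplices. Along a sequence of collapse maps the number of
edge orbits is at least `1` at the start, grows at every step, and is at most `D_FS(𝒜) + 1`; a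
step which is not as small as possible leaves room for a further vertex of the simplex. -/
theorem tfae_maximal (hΓ : FreelyDecomposable Γ) (h𝒜 : 𝒜.IsProper)
    (hs : s ∈ (relFreeSplittingComplex 𝒜).faces) {D : ℕ} {T : Fin (D + 1) → FreeSplitting Γ}
    (f : ∀ d : Fin D, CollapseMap (T d.succ) (T d.castSucc))
    (hinj : Function.Injective (fun d => (T d).cls))
    (hrange : (s : Set (Class Γ)) = Set.range (fun d => (T d).cls))
    (hnat : ∀ d, (f d).IsRelNatural) :
    [ (D : ℤ) = 𝒜.depthFS,
      (T (Fin.last D)).IsGeneric 𝒜 ∧ (∀ d, (f d).IsElementary) ∧ (T 0).IsOneEdge,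
      Maximal (fun t => t ∈ (relFreeSplittingComplex 𝒜).faces) s ].TFAE := by
  have hmem : ∀ d, (T d).cls ∈ s := fun d =>
    Finset.mem_coe.mp (hrange ▸ Set.mem_range_self d)
  have hrel : ∀ d, (T d).IsRel 𝒜 := fun d => hs.2 _ (hmem d)
  have hn : ∀ d, (T d).HasNat := fun d => (hrel d).hasNat hΓ
  have hstep : ∀ d : Fin D, NatCollapse (T d.succ) (T d.castSucc) := fun d =>
    (f d).natCollapse (hn _)
  have hcol : ∀ {i j : Fin (D + 1)}, i ≤ j → NatCollapse (T j) (T i) := natCollapse_of_le hn hstep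
  have hcount := fun d : Fin D => (f d).ncard_natEdgeOrbits (hn d.castSucc)
  have hlt : ∀ d : Fin D, (T d.castSucc).natEdgeOrbits.ncard < (T d.succ).natEdgeOrbits.ncard := by
    intro d
    refine lt_of_le_of_ne (hstep d).ncard_le fun h => ?_
    exact d.castSucc_lt_succ.ne' (hinj ((hstep d).cls_eq h.symm))
  have hmono : StrictMono fun d => (T d).natEdgeOrbits.ncard := Fin.strictMono_iff_lt_succ.mpr hlt
  have hone : 1 ≤ (T 0).natEdgeOrbits.ncard := one_le_ncard_natEdgeOrbits (hn 0)
  have htop := (hrel (Fin.last D)).ncard_natEdgeOrbits_le (hn _)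
  have hgen := (tfae_isGeneric hΓ h𝒜 (hrel (Fin.last D))).out 0 1
  have hlow : ∀ d : Fin (D + 1), (d : ℕ) + 1 ≤ (T d).natEdgeOrbits.ncard := by
    intro d
    induction d using Fin.induction with
    | zero => simpa using hone
    | succ d ih =>
      have := hlt d
      simp only [Fin.val_castSucc, Fin.val_succ] at ih ⊢
      omega
  have hup : ∀ d : Fin (D + 1),
      (T d).natEdgeOrbits.ncard + (D - d) ≤ (T (Fin.last D)).natEdgeOrbits.ncard := by
    intro d
    induction d using Fin.reverseInduction with
    | last => simp
    | cast d ih =>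
      have := hlt d
      have := d.2
      simp only [Fin.val_castSucc, Fin.val_succ] at ih ⊢
      omega
  -- A free splitting comparable with all `T d` but with a different edge count contradicts
  -- maximality.
  have hnew : Maximal (fun t => t ∈ (relFreeSplittingComplex 𝒜).faces) s →
      ∀ U : FreeSplitting Γ, U.IsRel 𝒜 →
      (∀ d, (NatCollapse U (T d) ∨ NatCollapse (T d) U) ∧
        U.natEdgeOrbits.ncard ≠ (T d).natEdgeOrbits.ncard) → False := by
    intro hmax U hU h
    have hUs : U.cls ∈ s := by
      refine cls_mem_of_maximal hmax hU fun c hc => ?_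
      obtain ⟨d, rfl⟩ : c ∈ Set.range (fun d => (T d).cls) := hrange ▸ hc
      rcases (h d).1 with h1 | h1
      · exact Or.inr ((prec_iff (hn d)).mpr h1)
      · exact Or.inl ((prec_iff (hU.hasNat hΓ)).mpr h1)
    obtain ⟨d, hd⟩ : U.cls ∈ Set.range (fun d => (T d).cls) := hrange ▸ hUs
    exact (h d).2 ((natIso_of_cls_eq hd).symm.ncard_natEdgeOrbits_eq (hU.hasNat hΓ))
  tfae_have 1 → 2 := by
    intro hD
    have hall : ∀ d : Fin (D + 1), (T d).natEdgeOrbits.ncard = d + 1 := fun d => by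
      have h1 := hlow d
      have h2 := hup d
      have := d.2
      omega
    refine ⟨hgen.mp ?_, fun d => ⟨hnat d, ?_⟩, ?_⟩
    · rw [hall, Fin.val_last]
      push_cast
      omega
    · have h1 := hcount d
      rw [hall, hall, Fin.val_succ, Fin.val_castSucc] at h1
      omega
    · rw [IsOneEdge, hall]
      simp
  tfae_have 2 → 1 := by
    rintro ⟨h1, h2, h3⟩
    have hall : ∀ d : Fin (D + 1), (T d).natEdgeOrbits.ncard = d + 1 := by
      intro d
      induction d using Fin.induction with
      | zero => exact h3
      | succ d ih =>
        rw [hcount d, ih, (h2 d).2]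
        simp
    have h4 := hgen.mpr h1
    rw [hall, Fin.val_last] at h4
    push_cast at h4
    omega
  tfae_have 1 → 3 := by
    intro hD
    have hcard : s.card = D + 1 := by
      rw [← Set.ncard_coe_finset, hrange, ← Set.image_univ, Set.ncard_image_of_injective _ hinj,
        Set.ncard_univ, Nat.card_fin]
    refine ⟨hs, fun t ht hst => ?_⟩
    have := card_le_of_mem_faces hΓ ht
    exact (Finset.eq_of_subset_of_card_le hst (by omega)).ge
  tfae_have 3 → 2 := by
    intro hmax
    refine ⟨?_, fun d => ⟨hnat d, ?_⟩, ?_⟩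
    · by_contra h
      obtain ⟨S, hS⟩ := exists_vertexSystem_eq hΓ h𝒜
      obtain ⟨U, hU, ⟨q⟩, hE⟩ := ((hrel _).hasExpansion hS h).exists_collapseMap (hn _)
      refine hnew hmax U hU fun d => ⟨Or.inl ((q.natCollapse (hn _)).trans (hcol d.le_last)), ?_⟩
      have := hmono.monotone d.le_last
      omega
    · by_contra h
      have h1 := hcount d
      have h2 := hlt d
      obtain ⟨Z, hZ, hZ1, hZ2, hE⟩ := NatCollapse.exists_between (hrel d.succ) (hstep d) h2
      refine hnew hmax Z hZ fun j => ?_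
      rcases le_or_gt j d.castSucc with hj | hj
      · refine ⟨Or.inl (hZ2.trans (hcol hj)), ?_⟩
        have := hmono.monotone hj
        omega
      · have hj' : d.succ ≤ j := Fin.castSucc_lt_iff_succ_le.mp hj
        refine ⟨Or.inr ((hcol hj').trans hZ1), ?_⟩
        have := hmono.monotone hj'
        omega
    · by_contra h
      unfold IsOneEdge at h
      obtain ⟨Z, hZ, hZ1, hE⟩ := exists_natCollapse_of_two_le (hrel 0) (hn 0) (by omega)
      refine hnew hmax Z hZ fun j => ⟨Or.inr ((hcol j.zero_le).trans hZ1), ?_⟩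
      have := hmono.monotone j.zero_le
      omega
  tfae_finish

/-- Every simplex is a face of a simplex with `D_FS(𝒜) + 1` vertices. -/
theorem exists_face_card_eq (hΓ : FreelyDecomposable Γ) (h𝒜 : 𝒜.IsProper)
    (hs : s ∈ (relFreeSplittingComplex 𝒜).faces) :
    ∃ t ∈ (relFreeSplittingComplex 𝒜).faces, s ⊆ t ∧ (t.card : ℤ) = 𝒜.depthFS + 1 := by
  -- A face of largest cardinality among those containing `s` is a maximal simplex.
  have hbdd : ∀ t, (t ∈ (relFreeSplittingComplex 𝒜).faces ∧ s ⊆ t) →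
      t.card ≤ (𝒜.depthFS + 1).toNat := fun t ht => by
    have := card_le_of_mem_faces hΓ ht.1
    omega
  obtain ⟨n, ⟨t, ⟨ht, hst⟩, hn⟩, hmax⟩ : ∃ n, (∃ t, (t ∈ (relFreeSplittingComplex 𝒜).faces ∧
      s ⊆ t) ∧ t.card = n) ∧ ∀ t, (t ∈ (relFreeSplittingComplex 𝒜).faces ∧ s ⊆ t) → t.card ≤ n := by
    classical
    refine ⟨_, Nat.findGreatest_spec (P := fun n => ∃ t, (t ∈ (relFreeSplittingComplex 𝒜).faces ∧
      s ⊆ t) ∧ t.card = n) (hbdd s ⟨hs, subset_rfl⟩) ⟨s, ⟨hs, subset_rfl⟩, rfl⟩, fun t ht =>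
        Nat.le_findGreatest (hbdd t ht) ⟨t, ht, rfl⟩⟩
  have hmaximal : Maximal (fun t => t ∈ (relFreeSplittingComplex 𝒜).faces) t :=
    ⟨ht, fun r hr htr => (Finset.eq_of_subset_of_card_le htr
      (hn ▸ hmax r ⟨hr, hst.trans htr⟩)).ge⟩
  obtain ⟨D, T, f, hinj, hrange, hnat⟩ := exists_collapse_sequence hΓ ht
  have hD := ((tfae_maximal hΓ h𝒜 ht f hinj hrange hnat).out 2 0).mp hmaximal
  refine ⟨t, ht, hst, ?_⟩
  rw [← hD, ← Set.ncard_coe_finset, hrange, ← Set.image_univ,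
    Set.ncard_image_of_injective _ hinj, Set.ncard_univ, Nat.card_fin]
  push_cast
  rfl

/-- The dimension of the relative free splitting complex. -/
theorem exists_complexDim_eq (hΓ : FreelyDecomposable Γ) (h𝒜 : 𝒜.IsProper) :
    ∃ N : ℕ, (N : ℤ) = 𝒜.depthFS ∧
      complexDim (relFreeSplittingComplex 𝒜) = (N : WithBot ℕ∞) ∧
      ∀ s ∈ (relFreeSplittingComplex 𝒜).faces,
        ∃ t ∈ (relFreeSplittingComplex 𝒜).faces, s ⊆ t ∧ t.card = N + 1 := by
  obtain ⟨S, hS⟩ := exists_vertexSystem_eq hΓ h𝒜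
  obtain ⟨t, ht, hst, htcard⟩ :=
    exists_face_card_eq hΓ h𝒜 (singleton_mem_faces (isRel_of_vertexSystem_eq hS))
  obtain ⟨N, hN⟩ : ∃ N, t.card = N + 1 :=
    Nat.exists_eq_succ_of_ne_zero (Finset.card_ne_zero.mpr ht.1.1)
  refine ⟨N, by omega, le_antisymm (iSup_le fun r => ?_) ?_, fun s hs => ?_⟩
  · have := card_le_of_mem_faces hΓ r.2
    exact Nat.cast_le.mpr (by omega)
  · refine le_iSup_of_le ⟨t, ht⟩ ?_
    simp [hN]
  · obtain ⟨r, hr, hsr, hrcard⟩ := exists_face_card_eq hΓ h𝒜 hs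
    exact ⟨r, hr, hsr, by omega⟩

end Faces

end FreeSplitting

theorem mainTheorem6 {Γ : Type*} [Group Γ] (hΓ : FreelyDecomposable Γ)
    (𝒜 : FreeFactorSystem Γ) (h𝒜 : 𝒜.IsProper) :
    -- counts of relatively natural edge and vertex orbits; generic free splittings
    (∀ T : FreeSplitting Γ, T.IsRel 𝒜 →
      (T.natEdgeOrbits.Finite ∧ (T.natEdgeOrbits.ncard : ℤ) ≤ 𝒜.depthFS + 1) ∧
      [ (T.natEdgeOrbits.ncard : ℤ) = 𝒜.depthFS + 1,
        T.IsGeneric 𝒜,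
        ∀ U : FreeSplitting Γ, U.IsRel 𝒜 → Nonempty (FreeSplitting.CollapseMap U T) →
          U.cls = T.cls ].TFAE ∧
      (T.natVertexOrbits.Finite ∧
        (T.natVertexOrbits.ncard : ℤ) ≤ 𝒜.depthFS + 2 - 𝒜.corank) ∧
      (T.IsGeneric 𝒜 ↔ T.vertexSystem = 𝒜.components ∧
        (T.natVertexOrbits.ncard : ℤ) = 𝒜.depthFS + 2 - 𝒜.corank)) ∧
    -- every simplex has a corresponding sequence of relatively natural collapse maps
    (∀ s ∈ (relFreeSplittingComplex 𝒜).faces,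
      ∃ (D : ℕ) (T : Fin (D + 1) → FreeSplitting Γ)
        (f : ∀ d : Fin D, FreeSplitting.CollapseMap (T d.succ) (T d.castSucc)),
        Function.Injective (fun d => (T d).cls) ∧
        (s : Set (FreeSplitting.Class Γ)) = Set.range (fun d => (T d).cls) ∧
        ∀ d, (f d).IsRelNatural) ∧
    -- characterization of maximal simplices, for every such sequence
    (∀ s ∈ (relFreeSplittingComplex 𝒜).faces,
      ∀ (D : ℕ) (T : Fin (D + 1) → FreeSplitting Γ)
        (f : ∀ d : Fin D, FreeSplitting.CollapseMap (T d.succ) (T d.castSucc)),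
        Function.Injective (fun d => (T d).cls) →
        (s : Set (FreeSplitting.Class Γ)) = Set.range (fun d => (T d).cls) →
        (∀ d, (f d).IsRelNatural) →
        [ (D : ℤ) = 𝒜.depthFS,
          (T (Fin.last D)).IsGeneric 𝒜 ∧ (∀ d, (f d).IsElementary) ∧ (T 0).IsOneEdge,
          Maximal (fun t => t ∈ (relFreeSplittingComplex 𝒜).faces) s ].TFAE) ∧
    -- the dimension, and every simplex is a face of a simplex of maximal dimension
    ∃ N : ℕ, (N : ℤ) = 𝒜.depthFS ∧
      complexDim (relFreeSplittingComplex 𝒜) = (N : WithBot ℕ∞) ∧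
      ∀ s ∈ (relFreeSplittingComplex 𝒜).faces,
        ∃ t ∈ (relFreeSplittingComplex 𝒜).faces, s ⊆ t ∧ t.card = N + 1 := by
  refine ⟨fun T hT => ?_, fun s hs => FreeSplitting.exists_collapse_sequence hΓ hs,
    fun s hs D T f hinj hrange hnat =>
      FreeSplitting.tfae_maximal hΓ h𝒜 hs f hinj hrange hnat,
    FreeSplitting.exists_complexDim_eq hΓ h𝒜⟩
  have hn := hT.hasNat hΓ
  exact ⟨⟨FreeSplitting.natEdgeOrbits_finite hn, hT.ncard_natEdgeOrbits_le hn⟩,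
    FreeSplitting.tfae_isGeneric hΓ h𝒜 hT,
    ⟨(FreeSplitting.card_vertOrbits_natTree hn).1, hT.ncard_natVertexOrbits_le hn⟩,
    hT.isGeneric_iff_ncard hn⟩
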